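/- **Setting.** Spinor indices $\alpha,\dot\alpha$ run over $1,2$ and $i=1,2,3$; repeated indices are summed. Let $F=\mathbb R^{4|12}_{\rm cpl}\times\mathbb CP^1\times\mathbb CP^1$ with coordinates $(x^{\alpha\dot\alpha},\eta^{\dot\alpha}_i,\theta^{i\alpha})$ on $\mathbb R^{4|12}_{\rm cpl}=\mathbb R^{4|0}\times\mathbb C^{0|12}$, where $\overline{x^{1\dot1}}=x^{2\dot2}$, $\overline{x^{1\dot2}}=-x^{2\dot1}$ and $\eta,\theta$ are odd, and homogeneous coordinates $\lambda_{\dot\alpha},\mu_\alpha$ on the projective lines. Superfunctions are smooth in $(x,\lambda,\mu)$ and polynomial in $\eta,\theta$ (not in their conjugates). Put $\hat\lambda=(-\bar\lambda_{\dot2},\bar\lambda_{\dot1})$, $\hat\mu=(-\bar\mu_2,\bar\mu_1)$, raise indices with $\varepsilon^{12}=-1=-\varepsilon^{21}$ (both chiralities), put $|\lambda|^2=\lambda_{\dot\alpha}\hat\lambda^{\dot\alpha}$, $|\mu|^2=\mu_\alpha\hat\mu^\alpha$, and $$\eta_i=\eta^{\dot\alpha}_i\lambda_{\dot\alpha},\quad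 \theta^i=\theta^{i\alpha}\mu_\alpha,\quad \tilde\eta_i=-\frac{\eta^{\dot\alpha}_i\hat\lambda_{\dot\alpha}}{|\lambda|^2},\quad \tilde\theta^i=-\frac{\theta^{i\alpha}\hat\mu_\alpha}{|\mu|^2},$$ $$E_{\rm W}=\frac{\mu^\alpha\hat\lambda^{\dot\alpha}}{|\lambda|^2}\frac{\partial}{\partial x^{\alpha\dot\alpha}},\qquad E_{\hat{\rm W}}=-\frac{\hat\mu^\alpha\lambda^{\dot\alpha}}{|\mu|^2}\frac{\partial}{\partial x^{\alpha\dot\alpha}} .$$ The CR frame $\hat E_A$ is $\hat E_{\rm F}=\mu^\alpha\lambda^{\dot\alpha}\partial_{x^{\alpha\dot\alpha}}$, $\hat E_{\rm L}=|\lambda|^2\lambda_{\dot\alpha}\partial_{\hat\lambda_{\dot\alpha}}$, $\hat E_{\rm R}=|\mu|^2\mu_\alpha\partial_{\hat\mu_\alpha}$, $\hat E^i=\lambda^{\dot\alpha}(\partial_{\eta^{\dot\alpha}_i}+\theta^{i\alpha}\partial_{x^{\alpha\dot\alpha}})$, $\hat E_i=\mu^\alpha(\partial_{\theta^{i\alpha}}+\eta^{\dot\alpha}_i\partial_{x^{\alpha\dot\alpha}})$.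 Another frame of the same distribution is $\hat E'_{\rm F}=\hat E_{\rm F}$, $\hat E'_{\rm L}=\hat E_{\rm L}+\tilde\theta^i\eta_i\hat E_{\rm F}$, $\hat E'_{\rm R}=\hat E_{\rm R}-\theta^i\tilde\eta_i\hat E_{\rm F}$, $\hat E'^i=\hat E^i-\tilde\theta^i\hat E_{\rm F}$, $\hat E'_i=\hat E_i-\tilde\eta_i\hat E_{\rm F}$, with dual coframe $\hat e'^A$. The twisted frame $\hat V_A$ is $\hat V_{\rm F}=\hat E_{\rm F}$, $\hat V_{\rm L}=\hat E_{\rm L}+\theta^i\eta_iE_{\hat{\rm W}}$, $\hat V_{\rm R}=\hat E_{\rm R}+\theta^i\eta_iE_{\rm W}$, $\hat V^i=\lambda^{\dot\alpha}\partial_{\eta^{\dot\alpha}_i}$, $\hat V_i=\mu^\alpha\partial_{\theta^{i\alpha}}$, with dual coframe $\hat v^A$. Let $\Omega^{0,\bullet}_{\rm CR}(F)$ and $\Omega^{0,\bullet}_{\rm CR,tw}(F)$ be the algebras of global sections of the exterior algebras of the duals of the distributions spanned by $\hat E_A$ and by $\hat V_A$ (in homogeneous coordinates: forms invariant under $\lambda\mapsto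 t\lambda$, $\mu\mapsto s\mu$, $t,s\in\mathbb C^\times$), bigraded by form degree and Grassmann parity, with $\bar\partial_{\rm CR}$, $\bar\partial_{\rm CR,tw}$ the exterior differentials along these distributions ($\hat e^A\hat E_A$ and $\hat v^A\hat V_A$ on superfunctions). Let $\mathfrak g$ be a Lie algebra over a field $\Bbbk$ with an embedding $\Bbbk\to\mathbb C$ (e.g. $\Bbbk=\mathbb R,\mathbb C$), and $$\mathfrak L_{\rm CR}=(\Omega^{0,\bullet}_{\rm CR}(F)\otimes_\Bbbk\mathfrak g,\bar\partial_{\rm CR},[-,-]),\qquad \mathfrak L_{\rm CR,tw}=(\Omega^{0,\bullet}_{\rm CR,tw}(F)\otimes_\Bbbk\mathfrak g,\bar\partial_{\rm CR,tw},[-,-]),$$ with $[v\otimes a,w\otimes b]=(v\wedge w)\otimes[a,b]$. **Proposition.** 1. The vector field $X=\tilde\theta^i\eta_iE_{\rm W}+\theta^i\tilde\eta_iE_{\hat{\rm W}}$ is nilpotent, so $g=e^{X}$ is a well-defined invertible operator with $g^{-1}=e^{-X}$, and $\hat V_A=g\hat E'_Ag^{-1}$ for all $A$. 2. The only non-vanishing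 supercommutators of members of the frames are $[\hat E_i,\hat E^j]=[\hat E^j,\hat E_i]=2\delta_i{}^j\hat E_{\rm F}$ for $\hat E_A$, $[\hat E'_{\rm L},\hat E'_{\rm R}]=-[\hat E'_{\rm R},\hat E'_{\rm L}]=2\theta^i\eta_i\hat E'_{\rm F}$ for $\hat E'_A$, and $[\hat V_{\rm L},\hat V_{\rm R}]=-[\hat V_{\rm R},\hat V_{\rm L}]=2\theta^i\eta_i\hat V_{\rm F}$ for $\hat V_A$. Thus $[\hat E'_A,\hat E'_B]=C_{AB}{}^C\hat E'_C$ and $[\hat V_A,\hat V_B]=C_{AB}{}^C\hat V_C$ with the same structure functions, and $gC_{AB}{}^C=C_{AB}{}^Cg$. Moreover $\hat e'^{\rm F}=\hat e^{\rm F}-\hat e^{\rm L}\tilde\theta^i\eta_i+\hat e^{\rm R}\theta^i\tilde\eta_i+\hat e_i\tilde\theta^i+\hat e^i\tilde\eta_i$, the other $\hat e'^A$ equal $\hat e^A$, and $\hat e'^A\hat E'_A=\hat e^A\hat E_A$. 3. $(\Omega^{0,\bullet}_{\rm CR}(F),\bar\partial_{\rm CR})$ and $(\Omega^{0,\bullet}_{\rm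 CR,tw}(F),\bar\partial_{\rm CR,tw})$ are cochain complexes, and $\mathfrak L_{\rm CR}$ and $\mathfrak L_{\rm CR,tw}$ are differential graded Lie algebras. 4. The algebra isomorphism determined by $f\mapsto g^{-1}f$ on superfunctions and $\hat v^A\mapsto\hat e'^A$ restricts to an isomorphism $\varphi:\Omega^{0,\bullet}_{\rm CR,tw}(F)\to\Omega^{0,\bullet}_{\rm CR}(F)$ of algebras which preserves form degree and Grassmann parity and satisfies $\varphi\circ\bar\partial_{\rm CR,tw}=\bar\partial_{\rm CR}\circ\varphi$. In particular, the two cochain complexes are isomorphic, hence quasi-isomorphic. 5. $\varphi\otimes{\rm id}_{\mathfrak g}$ is an isomorphism $\mathfrak L_{\rm CR,tw}\to\mathfrak L_{\rm CR}$ of differential graded Lie algebras; in particular, they are quasi-isomorphic. -/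

import Mathlib

open scoped TensorProduct ContDiff

namespace CRAmbitwistor

noncomputable section

/-! ### The body: `ℝ⁴ × (ℂ² \ 0) × (ℂ² \ 0)` -/

/-- Ambient space of the body. A point is `(z, λ, μ)`, where `z 0 = x^{1 1'}` and `z 1 = x^{1 2'}`
are complex coordinates on Euclidean `ℝ⁴` (the reality conditions are `x^{2 2'} = conj x^{1 1'}`,
`x^{2 1'} = - conj x^{1 2'}`), and `λ`, `μ` are homogeneous coordinates on the two projective
lines. -/
abbrev Amb : Type := (Fin 2 → ℂ) × (Fin 2 → ℂ) × (Fin 2 → ℂ)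

def bodySet : Set Amb := {p | p.2.1 ≠ 0 ∧ p.2.2 ≠ 0}

abbrev Body : Type := {p : Amb // p ∈ bodySet}

theorem isOpen_bodySet : IsOpen bodySet :=
  (isOpen_ne_fun (by fun_prop) (by fun_prop)).inter (isOpen_ne_fun (by fun_prop) (by fun_prop))

open Classical in
def extendZero (f : Body → ℂ) : Amb → ℂ := fun p => if h : p ∈ bodySet then f ⟨p, h⟩ else 0

theorem extendZero_of_mem (f : Body → ℂ) {p : Amb} (h : p ∈ bodySet) :
    extendZero f p = f ⟨p, h⟩ := dif_pos h

/-- Complex-valued smooth (in the real sense) functions on the body. -/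
def smoothSub : Subalgebra ℂ (Body → ℂ) where
  carrier := {f | ContDiffOn ℝ ∞ (extendZero f) bodySet}
  mul_mem' {f g} hf hg := (ContDiffOn.mul hf hg).congr fun p hp => by
    simp [extendZero_of_mem _ hp]
  add_mem' {f g} hf hg := (ContDiffOn.add hf hg).congr fun p hp => by
    simp [extendZero_of_mem _ hp]
  algebraMap_mem' c := (contDiffOn_const (c := c)).congr fun p hp => by
    simp [extendZero_of_mem _ hp]

abbrev SmoothFn : Type := smoothSub

def mkSmooth (F : Amb → ℂ) (hF : ContDiffOn ℝ ∞ F bodySet) : SmoothFn :=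
  ⟨fun p => F p, hF.congr fun p hp => by simp [extendZero_of_mem _ hp]⟩

theorem smooth_contDiffOn (f : SmoothFn) : ContDiffOn ℝ ∞ (extendZero f.1) bodySet := f.2

theorem smooth_differentiableAt (f : SmoothFn) (p : Body) :
    DifferentiableAt ℝ (extendZero f.1) p.1 :=
  ((smooth_contDiffOn f).differentiableOn (by simp)).differentiableAt
    (isOpen_bodySet.mem_nhds p.2)

/-- Real directional derivative along a constant vector field. -/
def dirDeriv (v : Amb) : SmoothFn →ₗ[ℂ] SmoothFn where
  toFun f := mkSmooth (fun p => fderiv ℝ (extendZero f.1) p v)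
    (((smooth_contDiffOn f).fderiv_of_isOpen isOpen_bodySet (m := ∞) (by simp)).clm_apply
      contDiffOn_const)
  map_add' f g := by
    ext p
    have : extendZero (f + g).1 = extendZero f.1 + extendZero g.1 := by
      ext q; by_cases h : q ∈ bodySet <;> simp [extendZero, h]
    simp only [mkSmooth, this]
    rw [fderiv_add (smooth_differentiableAt f p) (smooth_differentiableAt g p)]
    rfl
  map_smul' c f := by
    ext p
    have : extendZero (c • f).1 = c • extendZero f.1 := by
      ext q; by_cases h : q ∈ bodySet <;> simp [extendZero, h]
    simp only [mkSmooth, this]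
    rw [fderiv_const_smul (smooth_differentiableAt f p)]
    rfl

/-- Wirtinger derivative `∂_v = (D_v - i D_{iv}) / 2`. -/
def dHol (v : Amb) : SmoothFn →ₗ[ℂ] SmoothFn :=
  (1 / 2 : ℂ) • (dirDeriv v - Complex.I • dirDeriv (Complex.I • v))

/-- Wirtinger derivative `∂̄_v = (D_v + i D_{iv}) / 2`. -/
def dAnti (v : Amb) : SmoothFn →ₗ[ℂ] SmoothFn :=
  (1 / 2 : ℂ) • (dirDeriv v + Complex.I • dirDeriv (Complex.I • v))

def xVec (k : Fin 2) : Amb := (Pi.single k 1, 0, 0)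

def lamVec (k : Fin 2) : Amb := (0, Pi.single k 1, 0)

def muVec (k : Fin 2) : Amb := (0, 0, Pi.single k 1)

/-- `∂/∂x^{α α'}`, first index undotted. -/
def dX : Fin 2 → Fin 2 → SmoothFn →ₗ[ℂ] SmoothFn :=
  ![![dHol (xVec 0), dHol (xVec 1)], ![-dAnti (xVec 1), dAnti (xVec 0)]]

/-- `∂/∂(hat λ)_{α'}`, where `hat λ = (-conj λ₂, conj λ₁)`. -/
def dLamHat : Fin 2 → SmoothFn →ₗ[ℂ] SmoothFn := ![-dAnti (lamVec 1), dAnti (lamVec 0)]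

/-- `∂/∂(hat μ)_α`, where `hat μ = (-conj μ₂, conj μ₁)`. -/
def dMuHat : Fin 2 → SmoothFn →ₗ[ℂ] SmoothFn := ![-dAnti (muVec 1), dAnti (muVec 0)]

/-! ### Spinor algebra -/

/-- The quaternionic structure. -/
def quat (s : Fin 2 → ℂ) : Fin 2 → ℂ := ![-starRingEnd ℂ (s 1), starRingEnd ℂ (s 0)]

/-- Raising an index, `s^α = ε^{αβ} s_β`, with `ε_{12} = 1` and `ε_{αγ} ε^{γβ} = δ_α^β`, that is,
`ε^{12} = -1`. -/
def raise (s : Fin 2 → ℂ) : Fin 2 → ℂ := ![-s 1, s 0]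

/-- `|s|² = s_α (hat s)^α`. -/
def spinorNorm (s : Fin 2 → ℂ) : ℂ := ∑ a, s a * raise (quat s) a

theorem spinorNorm_eq (s : Fin 2 → ℂ) :
    spinorNorm s = -(s 0 * starRingEnd ℂ (s 0) + s 1 * starRingEnd ℂ (s 1)) := by
  simp [spinorNorm, raise, quat, Fin.sum_univ_two]; ring

theorem spinorNorm_ne_zero {s : Fin 2 → ℂ} (h : s ≠ 0) : spinorNorm s ≠ 0 := by
  rw [spinorNorm_eq, Complex.mul_conj, Complex.mul_conj, ← Complex.ofReal_add, neg_ne_zero]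
  intro h0
  have h1 : Complex.normSq (s 0) + Complex.normSq (s 1) = 0 := by exact_mod_cast h0
  have h2 := Complex.normSq_nonneg (s 0)
  have h3 := Complex.normSq_nonneg (s 1)
  apply h
  ext k
  fin_cases k
  · exact Complex.normSq_eq_zero.1 (show Complex.normSq (s 0) = 0 by linarith)
  · exact Complex.normSq_eq_zero.1 (show Complex.normSq (s 1) = 0 by linarith)

theorem contDiff_conj : ContDiff ℝ ∞ (fun w : ℂ => starRingEnd ℂ w) :=
  Complex.conjCLE.contDiff

theorem contDiff_lam (k : Fin 2) : ContDiff ℝ ∞ (fun p : Amb => p.2.1 k) := by fun_prop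

theorem contDiff_mu (k : Fin 2) : ContDiff ℝ ∞ (fun p : Amb => p.2.2 k) := by fun_prop

theorem contDiff_normLam : ContDiff ℝ ∞ (fun p : Amb => spinorNorm p.2.1) := by
  simp only [spinorNorm_eq]
  exact (((contDiff_lam 0).mul (contDiff_conj.comp (contDiff_lam 0))).add
    ((contDiff_lam 1).mul (contDiff_conj.comp (contDiff_lam 1)))).neg

theorem contDiff_normMu : ContDiff ℝ ∞ (fun p : Amb => spinorNorm p.2.2) := by
  simp only [spinorNorm_eq]
  exact (((contDiff_mu 0).mul (contDiff_conj.comp (contDiff_mu 0))).add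
    ((contDiff_mu 1).mul (contDiff_conj.comp (contDiff_mu 1)))).neg

/-- `λ_{α'}`. -/
def lam (k : Fin 2) : SmoothFn := mkSmooth (fun p => p.2.1 k) (contDiff_lam k).contDiffOn

/-- `μ_α`. -/
def mu (k : Fin 2) : SmoothFn := mkSmooth (fun p => p.2.2 k) (contDiff_mu k).contDiffOn

/-- `(hat λ)_{α'}`. -/
def lamHat (k : Fin 2) : SmoothFn := mkSmooth (fun p => quat p.2.1 k) <| by
  fin_cases k
  · exact ((contDiff_conj.comp (contDiff_lam 1)).neg).contDiffOn
  · exact (contDiff_conj.comp (contDiff_lam 0)).contDiffOn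

/-- `(hat μ)_α`. -/
def muHat (k : Fin 2) : SmoothFn := mkSmooth (fun p => quat p.2.2 k) <| by
  fin_cases k
  · exact ((contDiff_conj.comp (contDiff_mu 1)).neg).contDiffOn
  · exact (contDiff_conj.comp (contDiff_mu 0)).contDiffOn

/-- `|λ|²`. -/
def normLam : SmoothFn := mkSmooth (fun p => spinorNorm p.2.1) contDiff_normLam.contDiffOn

/-- `|μ|²`. -/
def normMu : SmoothFn := mkSmooth (fun p => spinorNorm p.2.2) contDiff_normMu.contDiffOn

/-- `1 / |λ|²`. -/
def normLamInv : SmoothFn := mkSmooth (fun p => (spinorNorm p.2.1)⁻¹)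
  (contDiff_normLam.contDiffOn.inv fun _ hp => spinorNorm_ne_zero hp.1)

/-- `1 / |μ|²`. -/
def normMuInv : SmoothFn := mkSmooth (fun p => (spinorNorm p.2.2)⁻¹)
  (contDiff_normMu.contDiffOn.inv fun _ hp => spinorNorm_ne_zero hp.2)

def raiseFn (s : Fin 2 → SmoothFn) : Fin 2 → SmoothFn := ![-s 1, s 0]

/-- `λ^{α'}`. -/
def lamUp : Fin 2 → SmoothFn := raiseFn lam

/-- `μ^α`. -/
def muUp : Fin 2 → SmoothFn := raiseFn mu

/-- `(hat λ)^{α'}`. -/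
def lamHatUp : Fin 2 → SmoothFn := raiseFn lamHat

/-- `(hat μ)^α`. -/
def muHatUp : Fin 2 → SmoothFn := raiseFn muHat

/-- The rescaling `(x, λ, μ) ↦ (x, t λ, s μ)` of the homogeneous coordinates. -/
def scalePt (t s : ℂˣ) (p : Amb) : Amb := (p.1, (t : ℂ) • p.2.1, (s : ℂ) • p.2.2)

theorem scalePt_mem (t s : ℂˣ) {p : Amb} (h : p ∈ bodySet) : scalePt t s p ∈ bodySet :=
  ⟨smul_ne_zero t.ne_zero h.1, smul_ne_zero s.ne_zero h.2⟩

theorem contDiff_scalePt (t s : ℂˣ) : ContDiff ℝ ∞ (scalePt t s) := by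
  unfold scalePt; fun_prop

/-- Pullback of functions along `scalePt t s`. -/
def pullScale (t s : ℂˣ) : SmoothFn →ₐ[ℂ] SmoothFn where
  toFun f := ⟨fun p => f.1 ⟨scalePt t s p, scalePt_mem t s p.2⟩,
    ((smooth_contDiffOn f).comp (contDiff_scalePt t s).contDiffOn
      fun _ hp => scalePt_mem t s hp).congr fun p hp => by
        simp [extendZero_of_mem _ hp, extendZero_of_mem _ (scalePt_mem t s hp)]⟩
  map_one' := rfl
  map_mul' _ _ := rfl
  map_zero' := rfl
  map_add' _ _ := rfl
  commutes' _ := rfl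
/-! ### Superforms

The algebra of `(0,•)`-forms is the free supercommutative algebra, over the smooth functions on the
body, on the odd generators `η^{α'}_i`, `θ^{iα}` (fermionic coordinates) and `e^F`, `e^L`, `e^R`
(coframe elements dual to the bosonic frame fields), and the even generators `e_i`, `e^i` (coframe
elements dual to the fermionic frame fields). Thus the sign rule is governed by the total parity,
form degree plus Grassmann parity, and forms are written to the left of their coefficients. -/

inductive OddGen : Type
  | eta (a : Fin 2) (i : Fin 3)
  | theta (i : Fin 3) (a : Fin 2)
  | formF
  | formL
  | formR
  deriving DecidableEq, Fintype

inductive EvenGen : Type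
  | up (i : Fin 3)
  | dn (i : Fin 3)
  deriving DecidableEq, Fintype

abbrev FormAlgRaw : Type :=
  SmoothFn ⊗[ℂ] (ExteriorAlgebra ℂ (OddGen → ℂ) ⊗[ℂ] MvPolynomial EvenGen ℂ)

def FormAlg : Type := FormAlgRaw

instance : Ring FormAlg := inferInstanceAs (Ring FormAlgRaw)

instance instAlgebraFormAlg {S : Type*} [CommSemiring S] [Algebra S ℂ] : Algebra S FormAlg :=
  inferInstanceAs (Algebra S FormAlgRaw)

instance {S : Type*} [CommSemiring S] [Algebra S ℂ] : IsScalarTower S ℂ FormAlg :=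
  inferInstanceAs (IsScalarTower S ℂ FormAlgRaw)

/-- The product of a function on the body, an element of the exterior algebra and a polynomial. -/
def elem (f : SmoothFn) (x : ExteriorAlgebra ℂ (OddGen → ℂ)) (y : MvPolynomial EvenGen ℂ) :
    FormAlg := (f ⊗ₜ (x ⊗ₜ y) : FormAlgRaw)

/-- A function on the body as a superfunction. -/
def ofFn (f : SmoothFn) : FormAlg := elem f 1 1

def oddVar (k : OddGen) : FormAlg := elem 1 (ExteriorAlgebra.ι ℂ (Pi.single k 1)) 1

def evenVar (k : EvenGen) : FormAlg := elem 1 1 (MvPolynomial.X k)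

/-- Operators on superforms. -/
abbrev Op : Type := Module.End ℂ FormAlg

/-- An operator on functions on the body, acting on the coefficients. -/
def bodyOp (D : SmoothFn →ₗ[ℂ] SmoothFn) : Op :=
  (TensorProduct.map D LinearMap.id : FormAlgRaw →ₗ[ℂ] FormAlgRaw)

/-- The odd left derivation `∂/∂ξ` for an odd generator `ξ`. -/
def oddDer (k : OddGen) : Op :=
  (TensorProduct.map LinearMap.id
    (TensorProduct.map (CliffordAlgebra.contractLeft (Q := (0 : QuadraticForm ℂ (OddGen → ℂ)))
      (LinearMap.proj k)) LinearMap.id) : FormAlgRaw →ₗ[ℂ] FormAlgRaw)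

/-- The even derivation `∂/∂y` for an even generator `y`. -/
def evenDer (k : EvenGen) : Op :=
  (TensorProduct.map LinearMap.id
    (TensorProduct.map LinearMap.id (MvPolynomial.pderiv k).toLinearMap) :
      FormAlgRaw →ₗ[ℂ] FormAlgRaw)

/-- Left multiplication. -/
def mulBy (x : FormAlg) : Op := LinearMap.mulLeft ℂ x

/-- The algebra homomorphism that acts by `φ` on functions on the body and rescales the
generators. -/
def rescale (φ : SmoothFn →ₐ[ℂ] SmoothFn) (a : OddGen → ℂ) (b : EvenGen → ℂ) :
    FormAlg →ₐ[ℂ] FormAlg :=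
  (Algebra.TensorProduct.map φ
    (Algebra.TensorProduct.map
      (ExteriorAlgebra.map (LinearMap.pi fun k => a k • LinearMap.proj k))
      (MvPolynomial.aeval fun k => b k • MvPolynomial.X k)) : FormAlgRaw →ₐ[ℂ] FormAlgRaw)

/-! ### Vector fields

A vector field is represented by the superderivation of `FormAlg` that acts on the coefficients and
annihilates the coframe generators. -/

def eta (a : Fin 2) (i : Fin 3) : FormAlg := oddVar (.eta a i)

def theta (i : Fin 3) (a : Fin 2) : FormAlg := oddVar (.theta i a)

/-- `∂/∂x^{α α'}`. -/
def pX (a b : Fin 2) : Op := bodyOp (dX a b)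

/-- `D^i_{α'} = ∂/∂η^{α'}_i + θ^{iα} ∂/∂x^{α α'}`. -/
def covEta (i : Fin 3) (b : Fin 2) : Op :=
  oddDer (.eta b i) + ∑ a, mulBy (theta i a) * pX a b

/-- `D_{iα} = ∂/∂θ^{iα} + η^{α'}_i ∂/∂x^{α α'}`. -/
def covTheta (i : Fin 3) (a : Fin 2) : Op :=
  oddDer (.theta i a) + ∑ b, mulBy (eta b i) * pX a b

/-- The fermionic coordinate `η_i = η^{α'}_i λ_{α'}`. -/
def etaC (i : Fin 3) : FormAlg := ∑ b, eta b i * ofFn (lam b)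

/-- `θ^i = θ^{iα} μ_α`. -/
def thetaC (i : Fin 3) : FormAlg := ∑ a, theta i a * ofFn (mu a)

/-- `η̃_i = - η^{α'}_i (hat λ)_{α'} / |λ|²`. -/
def etaT (i : Fin 3) : FormAlg := -∑ b, eta b i * ofFn (lamHat b * normLamInv)

/-- `θ̃^i = - θ^{iα} (hat μ)_α / |μ|²`. -/
def thetaT (i : Fin 3) : FormAlg := -∑ a, theta i a * ofFn (muHat a * normMuInv)

/-- `Ê_F = μ^α λ^{α'} ∂/∂x^{α α'}`. -/
def hatEF : Op := ∑ a, ∑ b, mulBy (ofFn (muUp a * lamUp b)) * pX a b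

/-- `Ê_L = |λ|² λ_{α'} ∂/∂(hat λ)_{α'}`. -/
def hatEL : Op := ∑ b, mulBy (ofFn (normLam * lam b)) * bodyOp (dLamHat b)

/-- `Ê_R = |μ|² μ_α ∂/∂(hat μ)_α`. -/
def hatER : Op := ∑ a, mulBy (ofFn (normMu * mu a)) * bodyOp (dMuHat a)

/-- `E_W = μ^α (hat λ)^{α'} / |λ|² ∂/∂x^{α α'}`. -/
def fieldW : Op := ∑ a, ∑ b, mulBy (ofFn (muUp a * lamHatUp b * normLamInv)) * pX a b

/-- `E_Ŵ = - (hat μ)^α λ^{α'} / |μ|² ∂/∂x^{α α'}`. -/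
def fieldWHat : Op := -∑ a, ∑ b, mulBy (ofFn (muHatUp a * lamUp b * normMuInv)) * pX a b

/-- Labels of the frame fields of the CR distribution: `F`, `L`, `R` are bosonic, `up i` labels
`Ê^i` and `dn i` labels `Ê_i`, both fermionic. -/
inductive Dir : Type
  | F
  | L
  | R
  | up (i : Fin 3)
  | dn (i : Fin 3)
  deriving DecidableEq, Fintype

/-- The Grassmann parity of the frame field. -/
def Dir.par : Dir → ℕ
  | .F => 0
  | .L => 0
  | .R => 0
  | .up _ => 1
  | .dn _ => 1

/-- The CR frame `Ê_F, Ê_L, Ê_R, Ê^i, Ê_i`. -/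
def frameCR : Dir → Op
  | .F => hatEF
  | .L => hatEL
  | .R => hatER
  | .up i => ∑ b, mulBy (ofFn (lamUp b)) * covEta i b
  | .dn i => ∑ a, mulBy (ofFn (muUp a)) * covTheta i a

/-- The changed CR frame `Ê'_F, Ê'_L, Ê'_R, Ê'^i, Ê'_i`, which spans the same distribution. -/
def framePrime : Dir → Op
  | .F => hatEF
  | .L => hatEL + mulBy (∑ i, thetaT i * etaC i) * hatEF
  | .R => hatER - mulBy (∑ i, thetaC i * etaT i) * hatEF
  | .up i => frameCR (.up i) - mulBy (thetaT i) * hatEF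
  | .dn i => frameCR (.dn i) - mulBy (etaT i) * hatEF

/-- The twisted CR frame `V̂_F, V̂_L, V̂_R, V̂^i, V̂_i`. -/
def frameTw : Dir → Op
  | .F => hatEF
  | .L => hatEL + mulBy (∑ i, thetaC i * etaC i) * fieldWHat
  | .R => hatER + mulBy (∑ i, thetaC i * etaC i) * fieldW
  | .up i => ∑ b, mulBy (ofFn (lamUp b)) * oddDer (.eta b i)
  | .dn i => ∑ a, mulBy (ofFn (muUp a)) * oddDer (.theta i a)

/-- The exponent `θ̃^i η_i E_W + θ^i η̃_i E_Ŵ` of the twist. -/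
def twistField : Op :=
  mulBy (∑ i, thetaT i * etaC i) * fieldW + mulBy (∑ i, thetaC i * etaT i) * fieldWHat

/-- The twist `g`; its exponent is nilpotent. -/
def twist : Op := IsNilpotent.exp twistField

def twistInv : Op := IsNilpotent.exp (-twistField)

/-- The supercommutator `[X_A, X_B]` of the members of a frame. -/
def superComm (E : Dir → Op) (A B : Dir) : Op :=
  E A * E B - (-1 : ℂ) ^ (A.par * B.par) • (E B * E A)

/-- Structure functions `C_{AB}^C` of the CR frame: `[Ê_i, Ê^j] = 2 δ_i^j Ê_F`. -/
def structCR : Dir → Dir → Dir → FormAlg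
  | .dn i, .up j, .F => if i = j then 2 else 0
  | .up j, .dn i, .F => if i = j then 2 else 0
  | _, _, _ => 0

/-- Structure functions of the changed and of the twisted frame:
`[V̂_L, V̂_R] = 2 θ^i η_i V̂_F`. -/
def structTw : Dir → Dir → Dir → FormAlg
  | .L, .R, .F => 2 * ∑ i, thetaC i * etaC i
  | .R, .L, .F => -(2 * ∑ i, thetaC i * etaC i)
  | _, _, _ => 0

/-! ### The CR differentials -/

/-- The coframe element `e^A` dual to the frame field labelled by `A`. -/
def coframe : Dir → FormAlg
  | .F => oddVar .formF
  | .L => oddVar .formL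
  | .R => oddVar .formR
  | .up i => evenVar (.up i)
  | .dn i => evenVar (.dn i)

/-- The derivation `∂/∂e^A`. -/
def coframeDer : Dir → Op
  | .F => oddDer .formF
  | .L => oddDer .formL
  | .R => oddDer .formR
  | .up i => evenDer (.up i)
  | .dn i => evenDer (.dn i)

/-- The exterior differential along a distribution with frame `E` and structure functions `C`: the
derivation with `f ↦ e^A E_A f` on functions and, by duality,
`e^D ↦ - 1/2 (-1)^{|A| + |A||B|} e^A e^B C_{AB}^D` on the coframe. -/
def frameDifferential (E : Dir → Op) (C : Dir → Dir → Dir → FormAlg) : Op :=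
  ∑ A, mulBy (coframe A) * E A -
    (1 / 2 : ℂ) • ∑ A, ∑ B, ∑ D, (-1 : ℂ) ^ (A.par + A.par * B.par) •
      (mulBy (coframe A * coframe B * C A B D) * coframeDer D)

/-- The changed coframe `ê'^A`, dual to `framePrime`, in terms of the coframe dual to `frameCR`
(forms are written to the left of their coefficients). -/
def coframePrime : Dir → FormAlg
  | .F => coframe .F - coframe .L * ∑ i, thetaT i * etaC i + coframe .R * ∑ i, thetaC i * etaT i
      + ∑ i, coframe (.up i) * thetaT i + ∑ i, coframe (.dn i) * etaT i
  | A => coframe A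

/-! ### Homogeneity and gradings -/

/-- The weight of the frame field `A` under `λ ↦ t λ`, `μ ↦ s μ`. -/
def dirWeight (t s : ℂ) : Dir → ℂ
  | .F => t * s
  | .L => t ^ 2
  | .R => s ^ 2
  | .up _ => t
  | .dn _ => s

def oddWeight (t s : ℂ) : OddGen → ℂ
  | .eta _ _ => 1
  | .theta _ _ => 1
  | .formF => (dirWeight t s .F)⁻¹
  | .formL => (dirWeight t s .L)⁻¹
  | .formR => (dirWeight t s .R)⁻¹

def evenWeight (t s : ℂ) : EvenGen → ℂ
  | .up i => (dirWeight t s (.up i))⁻¹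
  | .dn i => (dirWeight t s (.dn i))⁻¹

/-- The action of `(t, s)` on superforms: functions are pulled back along
`(x, λ, μ) ↦ (x, t λ, s μ)`, the coordinates `η^{α'}_i`, `θ^{iα}` are fixed, and the coframe scales
inversely to the frame. -/
def projScale (t s : ℂˣ) : FormAlg →ₐ[ℂ] FormAlg :=
  rescale (pullScale t s) (oddWeight t s) (evenWeight t s)

/-- `e^A ↦ c e^A` for all `A`; superfunctions are fixed. -/
def degScale (c : ℂ) : FormAlg →ₐ[ℂ] FormAlg :=
  rescale (AlgHom.id ℂ _)
    (fun
      | .eta _ _ => 1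
      | .theta _ _ => 1
      | .formF => c
      | .formL => c
      | .formR => c)
    (fun _ => c)

/-- The Grassmann parity involution: `η`, `θ` and the forms dual to fermionic vector fields change
sign. -/
def parityInv : FormAlg →ₐ[ℂ] FormAlg :=
  rescale (AlgHom.id ℂ _)
    (fun
      | .eta _ _ => -1
      | .theta _ _ => -1
      | .formF => 1
      | .formL => 1
      | .formR => 1)
    (fun _ => -1)

/-- The global `(0,•)`-forms on `F = ℝ^{4|12} × ℂP¹ × ℂP¹`: the superforms in homogeneous
coordinates that are invariant under rescaling. The form `e^A f_A` is invariant if and only if `f_A`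
is homogeneous of the same degree as the frame field labelled by `A`. -/
def Omega : Subalgebra ℂ FormAlg where
  carrier := {w | ∀ t s : ℂˣ, projScale t s w = w}
  mul_mem' ha hb t s := by rw [map_mul, ha t s, hb t s]
  add_mem' ha hb t s := by rw [map_add, ha t s, hb t s]
  algebraMap_mem' c t s := by rw [AlgHom.commutes]

/-- Forms of form degree `p` and Grassmann parity `a`. -/
def OmegaPiece (p : ℕ) (a : ZMod 2) : Submodule ℂ Omega where
  carrier := {w | (∀ c : ℂ, degScale c w.1 = c ^ p • w.1) ∧ parityInv w.1 = (-1 : ℂ) ^ a.val • w.1}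
  add_mem' {v w} hv hw := by
    constructor
    · intro c; simp [hv.1 c, hw.1 c]
    · simp [hv.2, hw.2]
  zero_mem' := by simp
  smul_mem' r w hw := by
    constructor
    · intro c; simp [hw.1 c, smul_comm r]
    · simp [hw.2, smul_comm r]

/-- Superfunctions: the superforms of form degree zero (of any homogeneity). -/
def IsSuperFn (f : FormAlg) : Prop := ∀ c : ℂ, degScale c f = f
/-! ### The CR differentials respect homogeneity -/

theorem dirDeriv_add (v w : Amb) : dirDeriv (v + w) = dirDeriv v + dirDeriv w := by
  ext f p; simp [dirDeriv, mkSmooth]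

theorem dirDeriv_real_smul (r : ℝ) (v : Amb) : dirDeriv (r • v) = (r : ℂ) • dirDeriv v := by
  ext f p; simp [dirDeriv, mkSmooth]

theorem dirDeriv_smul (c : ℂ) (v : Amb) :
    dirDeriv (c • v) = (c.re : ℂ) • dirDeriv v + (c.im : ℂ) • dirDeriv (Complex.I • v) := by
  rw [← dirDeriv_real_smul, ← dirDeriv_real_smul, ← dirDeriv_add]
  congr 1
  have h : c • v = ((c.re : ℂ) + (c.im : ℂ) * Complex.I) • v := by rw [Complex.re_add_im]
  rw [h, add_smul, mul_smul, Complex.coe_smul, Complex.coe_smul]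

theorem dAnti_smul (c : ℂ) (v : Amb) : dAnti (c • v) = starRingEnd ℂ c • dAnti v := by
  have h1 : Complex.I • c • v = (Complex.I * c) • v := smul_smul _ _ _
  have h2 : starRingEnd ℂ c = (c.re : ℂ) - (c.im : ℂ) * Complex.I := by
    apply Complex.ext <;> simp
  rw [dAnti, dAnti, h1, dirDeriv_smul c v, dirDeriv_smul (Complex.I * c) v, h2]
  generalize dirDeriv v = A
  generalize dirDeriv (Complex.I • v) = B
  simp only [Complex.mul_re, Complex.mul_im, Complex.I_re, Complex.I_im]
  push_cast
  match_scalars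
  · ring
  · linear_combination (1 / 2 * (c.im : ℂ)) * Complex.I_mul_I

theorem dirDeriv_pullScale (t s : ℂˣ) (v : Amb) (f : SmoothFn) :
    dirDeriv v (pullScale t s f) = pullScale t s (dirDeriv (scalePt t s v) f) := by
  let S : Amb →L[ℝ] Amb :=
    { toFun := scalePt t s
      map_add' := fun p q => by simp [scalePt]
      map_smul' := fun r p => by simp [scalePt, smul_comm r]
      cont := (contDiff_scalePt t s).continuous }
  have h : extendZero (pullScale t s f).1 = extendZero f.1 ∘ S := by
    ext p
    by_cases hp : p ∈ bodySet
    · rw [extendZero_of_mem _ hp, Function.comp_apply]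
      exact (extendZero_of_mem f.1 (scalePt_mem t s hp)).symm
    · have hp' : ¬ (scalePt t s p ∈ bodySet) := by
        intro h'
        apply hp
        exact ⟨fun h0 => h'.1 (by simp [scalePt, h0]), fun h0 => h'.2 (by simp [scalePt, h0])⟩
      rw [Function.comp_apply, extendZero, dif_neg hp]
      exact (show extendZero f.1 (S p) = 0 from dif_neg hp').symm
  ext p
  have hd := (smooth_differentiableAt f ⟨scalePt t s p, scalePt_mem t s p.2⟩)
  change fderiv ℝ (extendZero (pullScale t s f).1) p v
    = fderiv ℝ (extendZero f.1) (scalePt t s p) (scalePt t s v)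
  rw [h, fderiv_comp p.1 (show DifferentiableAt ℝ (extendZero f.1) (S p.1) from hd)
    S.differentiableAt, ContinuousLinearMap.fderiv]
  rfl

theorem scalePt_smul (t s : ℂˣ) (c : ℂ) (v : Amb) : scalePt t s (c • v) = c • scalePt t s v := by
  simp [scalePt, smul_comm c]

theorem dAnti_pullScale (t s : ℂˣ) (v : Amb) (f : SmoothFn) :
    dAnti v (pullScale t s f) = pullScale t s (dAnti (scalePt t s v) f) := by
  simp [dAnti, dirDeriv_pullScale, scalePt_smul]

theorem dHol_pullScale (t s : ℂˣ) (v : Amb) (f : SmoothFn) :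
    dHol v (pullScale t s f) = pullScale t s (dHol (scalePt t s v) f) := by
  simp [dHol, dirDeriv_pullScale, scalePt_smul]

theorem pullScale_dX (t s : ℂˣ) (a b : Fin 2) (f : SmoothFn) :
    pullScale t s (dX a b f) = dX a b (pullScale t s f) := by
  have h (k) : scalePt t s (xVec k) = xVec k := by simp [scalePt, xVec]
  fin_cases a <;> fin_cases b <;> simp [dX, dHol_pullScale, dAnti_pullScale, h]

theorem pullScale_dLamHat (t s : ℂˣ) (b : Fin 2) (f : SmoothFn) :
    pullScale t s (dLamHat b f) = (starRingEnd ℂ (t : ℂ))⁻¹ • dLamHat b (pullScale t s f) := by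
  have h (k) : scalePt t s (lamVec k) = (t : ℂ) • lamVec k := by simp [scalePt, lamVec]
  have ht : starRingEnd ℂ (t : ℂ) ≠ 0 := by simp
  fin_cases b <;> simp [dLamHat, dAnti_pullScale, h, dAnti_smul, smul_smul, ht]

theorem pullScale_dMuHat (t s : ℂˣ) (b : Fin 2) (f : SmoothFn) :
    pullScale t s (dMuHat b f) = (starRingEnd ℂ (s : ℂ))⁻¹ • dMuHat b (pullScale t s f) := by
  have h (k) : scalePt t s (muVec k) = (s : ℂ) • muVec k := by simp [scalePt, muVec]
  have hs : starRingEnd ℂ (s : ℂ) ≠ 0 := by simp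
  fin_cases b <;> simp [dMuHat, dAnti_pullScale, h, dAnti_smul, smul_smul, hs]

theorem spinorNorm_smul (c : ℂ) (v : Fin 2 → ℂ) :
    spinorNorm (c • v) = c * starRingEnd ℂ c * spinorNorm v := by
  simp [spinorNorm_eq]; ring

section Weight

variable {t s : ℂˣ}

/-- `T` has weight `c` under the rescaling by `(t, s)`. -/
def HasWt (t s : ℂˣ) (c : ℂ) (T : Op) : Prop :=
  ∀ w, projScale t s (T w) = c • T (projScale t s w)

def EltWt (t s : ℂˣ) (c : ℂ) (x : FormAlg) : Prop := projScale t s x = c • x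

theorem HasWt.add {c : ℂ} {T U : Op} (hT : HasWt t s c T) (hU : HasWt t s c U) :
    HasWt t s c (T + U) := fun w => by simp [hT w, hU w]

theorem HasWt.sub {c : ℂ} {T U : Op} (hT : HasWt t s c T) (hU : HasWt t s c U) :
    HasWt t s c (T - U) := fun w => by simp [hT w, hU w, smul_sub]

theorem HasWt.neg {c : ℂ} {T : Op} (hT : HasWt t s c T) : HasWt t s c (-T) :=
  fun w => by simp [hT w]

theorem HasWt.smul {c : ℂ} {T : Op} (r : ℂ) (hT : HasWt t s c T) : HasWt t s c (r • T) :=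
  fun w => by simp [hT w, smul_comm r]

theorem HasWt.mul {c d : ℂ} {T U : Op} (hT : HasWt t s c T) (hU : HasWt t s d U) :
    HasWt t s (c * d) (T * U) := fun w => by
  simp [Module.End.mul_apply, hT (U w), hU w, smul_smul]

theorem HasWt.sum {ι : Type} {S : Finset ι} {c : ℂ} {T : ι → Op}
    (h : ∀ i, HasWt t s c (T i)) : HasWt t s c (∑ i ∈ S, T i) := fun w => by
  simp [LinearMap.sum_apply, fun i => h i w, Finset.smul_sum]

theorem EltWt.add {c : ℂ} {x y : FormAlg} (hx : EltWt t s c x) (hy : EltWt t s c y) :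
    EltWt t s c (x + y) := by
  unfold EltWt at *; rw [map_add, hx, hy, smul_add]

theorem EltWt.neg {c : ℂ} {x : FormAlg} (hx : EltWt t s c x) : EltWt t s c (-x) := by
  unfold EltWt at *; rw [map_neg, hx, smul_neg]

theorem EltWt.zero {c : ℂ} : EltWt t s c 0 := by simp [EltWt]

theorem EltWt.ofNat_two : EltWt t s 1 2 := by
  unfold EltWt; rw [map_ofNat, one_smul]

theorem EltWt.mul {c d : ℂ} {x y : FormAlg} (hx : EltWt t s c x) (hy : EltWt t s d y) :
    EltWt t s (c * d) (x * y) := by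
  unfold EltWt at *; rw [map_mul, hx, hy, smul_mul_smul_comm]

theorem EltWt.sum {ι : Type} {S : Finset ι} {c : ℂ} {x : ι → FormAlg}
    (h : ∀ i, EltWt t s c (x i)) : EltWt t s c (∑ i ∈ S, x i) := by
  unfold EltWt at *; rw [map_sum, Finset.smul_sum]; exact Finset.sum_congr rfl fun i _ => h i

theorem EltWt.mulBy {c : ℂ} {x : FormAlg} (hx : EltWt t s c x) : HasWt t s c (mulBy x) :=
  fun w => by
    unfold EltWt at hx
    simp [CRAmbitwistor.mulBy, LinearMap.mulLeft_apply, map_mul, hx]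

theorem rescale_elem (φ : SmoothFn →ₐ[ℂ] SmoothFn) (a : OddGen → ℂ) (b : EvenGen → ℂ)
    (f : SmoothFn) (x : ExteriorAlgebra ℂ (OddGen → ℂ)) (y : MvPolynomial EvenGen ℂ) :
    rescale φ a b (elem f x y) = elem (φ f)
      (ExteriorAlgebra.map (LinearMap.pi fun k => a k • LinearMap.proj k) x)
      (MvPolynomial.aeval (fun k => b k • MvPolynomial.X k) y) := rfl

theorem elem_smul_left (c : ℂ) (f : SmoothFn) (x : ExteriorAlgebra ℂ (OddGen → ℂ))
    (y : MvPolynomial EvenGen ℂ) : elem (c • f) x y = c • elem f x y := rfl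

theorem elem_smul_mid (c : ℂ) (f : SmoothFn) (x : ExteriorAlgebra ℂ (OddGen → ℂ))
    (y : MvPolynomial EvenGen ℂ) : elem f (c • x) y = c • elem f x y :=
  (congrArg (fun z => (f ⊗ₜ z : FormAlgRaw)) (TensorProduct.smul_tmul' c x y).symm).trans
    (TensorProduct.tmul_smul c f (x ⊗ₜ y))

theorem elem_smul_right (c : ℂ) (f : SmoothFn) (x : ExteriorAlgebra ℂ (OddGen → ℂ))
    (y : MvPolynomial EvenGen ℂ) : elem f x (c • y) = c • elem f x y :=
  (congrArg (fun z => (f ⊗ₜ z : FormAlgRaw)) (TensorProduct.tmul_smul c x y)).trans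
    (TensorProduct.tmul_smul c f (x ⊗ₜ y))

theorem formAlg_induction {P : FormAlg → Prop} (w : FormAlg)
    (add : ∀ u v, P u → P v → P (u + v)) (elem : ∀ f x y, P (elem f x y)) : P w := by
  have zero : P 0 := by
    have := elem 0 0 0
    rwa [show CRAmbitwistor.elem 0 0 0 = (0 : FormAlg) from TensorProduct.zero_tmul _ _] at this
  refine TensorProduct.induction_on (motive := P) w zero (fun f z => ?_) add
  refine TensorProduct.induction_on (motive := fun z => P (f ⊗ₜ z : FormAlgRaw)) z ?_
    (fun x y => elem f x y) (fun u v hu hv => ?_)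
  · rw [TensorProduct.tmul_zero]; exact zero
  · rw [TensorProduct.tmul_add]; exact add _ _ hu hv

theorem bodyOp_elem (D : SmoothFn →ₗ[ℂ] SmoothFn) (f : SmoothFn)
    (x : ExteriorAlgebra ℂ (OddGen → ℂ)) (y : MvPolynomial EvenGen ℂ) :
    bodyOp D (elem f x y) = elem (D f) x y := rfl

theorem oddDer_elem (k : OddGen) (f : SmoothFn)
    (x : ExteriorAlgebra ℂ (OddGen → ℂ)) (y : MvPolynomial EvenGen ℂ) :
    oddDer k (elem f x y) = elem f (CliffordAlgebra.contractLeft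
      (Q := (0 : QuadraticForm ℂ (OddGen → ℂ))) (LinearMap.proj k) x) y := rfl

theorem evenDer_elem (k : EvenGen) (f : SmoothFn)
    (x : ExteriorAlgebra ℂ (OddGen → ℂ)) (y : MvPolynomial EvenGen ℂ) :
    evenDer k (elem f x y) = elem f x (MvPolynomial.pderiv k y) := rfl

theorem hasWt_bodyOp {c : ℂ} {D : SmoothFn →ₗ[ℂ] SmoothFn}
    (h : ∀ f, pullScale t s (D f) = c • D (pullScale t s f)) : HasWt t s c (bodyOp D) := by
  intro w
  induction w using formAlg_induction with
  | add u v hu hv => simp only [map_add, hu, hv, smul_add]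
  | elem f x y =>
    rw [bodyOp_elem, projScale, rescale_elem, rescale_elem, bodyOp_elem, h, elem_smul_left]

theorem contractLeft_map (a : OddGen → ℂ) (k : OddGen) (x : ExteriorAlgebra ℂ (OddGen → ℂ)) :
    a k • ExteriorAlgebra.map (LinearMap.pi fun j => a j • LinearMap.proj j)
        (CliffordAlgebra.contractLeft (Q := (0 : QuadraticForm ℂ (OddGen → ℂ)))
          (LinearMap.proj k) x) =
      CliffordAlgebra.contractLeft (Q := (0 : QuadraticForm ℂ (OddGen → ℂ)))
        (LinearMap.proj k)
        (ExteriorAlgebra.map (LinearMap.pi fun j => a j • LinearMap.proj j) x) := by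
  induction x using CliffordAlgebra.left_induction with
  | algebraMap r =>
    rw [CliffordAlgebra.contractLeft_algebraMap, map_zero, smul_zero, AlgHom.commutes,
      CliffordAlgebra.contractLeft_algebraMap]
  | add x y hx hy => simp only [map_add, smul_add, hx, hy]
  | ι_mul x m hx =>
    have h1 : ∀ m : OddGen → ℂ,
        ExteriorAlgebra.map (LinearMap.pi fun j => a j • LinearMap.proj j)
          (CliffordAlgebra.ι (0 : QuadraticForm ℂ (OddGen → ℂ)) m) =
        CliffordAlgebra.ι (0 : QuadraticForm ℂ (OddGen → ℂ)) (fun j => a j * m j) := fun m =>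
      ExteriorAlgebra.map_apply_ι _ _
    rw [CliffordAlgebra.contractLeft_ι_mul, map_sub, map_mul, h1, map_mul, h1,
      CliffordAlgebra.contractLeft_ι_mul, map_smul, smul_sub, ← hx, smul_smul, mul_smul_comm]
    rfl

theorem oddWeight_ne_zero (k : OddGen) : oddWeight t s k ≠ 0 := by
  cases k <;> simp [oddWeight, dirWeight]

theorem evenWeight_ne_zero (k : EvenGen) : evenWeight t s k ≠ 0 := by
  cases k <;> simp [evenWeight, dirWeight]

theorem hasWt_oddDer (k : OddGen) : HasWt t s (oddWeight t s k)⁻¹ (oddDer k) := by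
  intro w
  induction w using formAlg_induction with
  | add u v hu hv => simp only [map_add, hu, hv, smul_add]
  | elem f x y =>
    rw [oddDer_elem, projScale, rescale_elem, rescale_elem, oddDer_elem, ← contractLeft_map,
      elem_smul_mid, inv_smul_smul₀ (oddWeight_ne_zero k)]

theorem pderiv_aeval (b : EvenGen → ℂ) (k : EvenGen) (y : MvPolynomial EvenGen ℂ) :
    b k • MvPolynomial.aeval (fun j => b j • (MvPolynomial.X j : MvPolynomial EvenGen ℂ))
        (MvPolynomial.pderiv k y) =
      MvPolynomial.pderiv k
        (MvPolynomial.aeval (fun j => b j • (MvPolynomial.X j : MvPolynomial EvenGen ℂ)) y) := by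
  induction y using MvPolynomial.induction_on with
  | C r => simp
  | add p q hp hq => simp only [map_add, smul_add, hp, hq]
  | mul_X p j hp =>
    rw [Derivation.leibniz, map_mul, Derivation.leibniz, ← hp]
    by_cases hj : j = k
    · subst hj; simp
    · simp [MvPolynomial.pderiv_X_of_ne hj]

theorem hasWt_evenDer (k : EvenGen) : HasWt t s (evenWeight t s k)⁻¹ (evenDer k) := by
  intro w
  induction w using formAlg_induction with
  | add u v hu hv => simp only [map_add, hu, hv, smul_add]
  | elem f x y =>
    rw [evenDer_elem, projScale, rescale_elem, rescale_elem, evenDer_elem, ← pderiv_aeval,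
      elem_smul_right, inv_smul_smul₀ (evenWeight_ne_zero k)]

theorem HasWt.congr {c d : ℂ} {T : Op} (hT : HasWt t s c T) (h : c = d) : HasWt t s d T := h ▸ hT

theorem EltWt.congr {c d : ℂ} {x : FormAlg} (hx : EltWt t s c x) (h : c = d) : EltWt t s d x :=
  h ▸ hx

theorem eltWt_ofFn {c : ℂ} {f : SmoothFn} (h : pullScale t s f = c • f) : EltWt t s c (ofFn f) := by
  rw [EltWt, projScale, ofFn, rescale_elem, h, map_one, map_one, elem_smul_left]

theorem eltWt_oddVar (k : OddGen) : EltWt t s (oddWeight t s k) (oddVar k) := by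
  have h1 : (LinearMap.pi fun j => oddWeight t s j • LinearMap.proj j :
      (OddGen → ℂ) →ₗ[ℂ] (OddGen → ℂ)) (Pi.single k 1) = oddWeight t s k • Pi.single k 1 := by
    ext j
    by_cases hj : j = k
    · subst hj; simp
    · simp [hj]
  rw [EltWt, projScale, oddVar, rescale_elem, ExteriorAlgebra.map_apply_ι, h1, map_smul, map_one,
    map_one, elem_smul_mid]

theorem eltWt_evenVar (k : EvenGen) : EltWt t s (evenWeight t s k) (evenVar k) := by
  rw [EltWt, projScale, evenVar, rescale_elem, MvPolynomial.aeval_X, map_one, map_one,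
    elem_smul_right]

theorem eltWt_eta (a : Fin 2) (i : Fin 3) : EltWt t s 1 (eta a i) :=
  eltWt_oddVar (.eta a i)

theorem eltWt_theta (i : Fin 3) (a : Fin 2) : EltWt t s 1 (theta i a) :=
  eltWt_oddVar (.theta i a)

theorem pullScale_lam (b : Fin 2) : pullScale t s (lam b) = (t : ℂ) • lam b := rfl

theorem pullScale_mu (b : Fin 2) : pullScale t s (mu b) = (s : ℂ) • mu b := rfl

theorem pullScale_lamHat (b : Fin 2) :
    pullScale t s (lamHat b) = starRingEnd ℂ (t : ℂ) • lamHat b := by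
  ext p
  fin_cases b <;> simp [pullScale, lamHat, mkSmooth, scalePt, quat]

theorem pullScale_muHat (b : Fin 2) :
    pullScale t s (muHat b) = starRingEnd ℂ (s : ℂ) • muHat b := by
  ext p
  fin_cases b <;> simp [pullScale, muHat, mkSmooth, scalePt, quat]

theorem pullScale_normLam :
    pullScale t s normLam = ((t : ℂ) * starRingEnd ℂ (t : ℂ)) • normLam := by
  ext p
  simp [pullScale, normLam, mkSmooth, scalePt, spinorNorm_smul]

theorem pullScale_normMu :
    pullScale t s normMu = ((s : ℂ) * starRingEnd ℂ (s : ℂ)) • normMu := by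
  ext p
  simp [pullScale, normMu, mkSmooth, scalePt, spinorNorm_smul]

theorem pullScale_normLamInv :
    pullScale t s normLamInv = ((t : ℂ) * starRingEnd ℂ (t : ℂ))⁻¹ • normLamInv := by
  ext p
  change (spinorNorm ((t : ℂ) • p.1.2.1))⁻¹ = ((t : ℂ) * starRingEnd ℂ (t : ℂ))⁻¹ * (spinorNorm p.1.2.1)⁻¹
  rw [spinorNorm_smul, mul_inv]

theorem pullScale_normMuInv :
    pullScale t s normMuInv = ((s : ℂ) * starRingEnd ℂ (s : ℂ))⁻¹ • normMuInv := by
  ext p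
  change (spinorNorm ((s : ℂ) • p.1.2.2))⁻¹ = ((s : ℂ) * starRingEnd ℂ (s : ℂ))⁻¹ * (spinorNorm p.1.2.2)⁻¹
  rw [spinorNorm_smul, mul_inv]

theorem pullScale_raise {c : ℂ} {f : Fin 2 → SmoothFn} (h : ∀ b, pullScale t s (f b) = c • f b)
    (b : Fin 2) : pullScale t s (raiseFn f b) = c • raiseFn f b := by
  fin_cases b <;> simp [raiseFn, h]

theorem pullScale_mul {c d : ℂ} {f g : SmoothFn} (hf : pullScale t s f = c • f)
    (hg : pullScale t s g = d • g) : pullScale t s (f * g) = (c * d) • (f * g) := by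
  rw [map_mul, hf, hg, smul_mul_smul_comm]

theorem conj_unit_ne_zero (u : ℂˣ) : starRingEnd ℂ (u : ℂ) ≠ 0 := by simp

theorem hasWt_pX (a b : Fin 2) : HasWt t s 1 (pX a b) :=
  hasWt_bodyOp fun f => by rw [pullScale_dX, one_smul]

theorem hasWt_covEta (i : Fin 3) (b : Fin 2) : HasWt t s 1 (covEta i b) := by
  refine HasWt.add ((hasWt_oddDer (.eta b i)).congr (show (1 : ℂ)⁻¹ = 1 from inv_one)) ?_
  exact HasWt.sum fun a => ((eltWt_theta i a).mulBy.mul (hasWt_pX a b)).congr (one_mul 1)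

theorem hasWt_covTheta (i : Fin 3) (a : Fin 2) : HasWt t s 1 (covTheta i a) := by
  refine HasWt.add ((hasWt_oddDer (.theta i a)).congr (show (1 : ℂ)⁻¹ = 1 from inv_one)) ?_
  exact HasWt.sum fun b => ((eltWt_eta b i).mulBy.mul (hasWt_pX a b)).congr (one_mul 1)

theorem eltWt_etaC (i : Fin 3) : EltWt t s t (etaC i) :=
  EltWt.sum fun b => ((eltWt_eta b i).mul (eltWt_ofFn (pullScale_lam b))).congr (one_mul _)

theorem eltWt_thetaC (i : Fin 3) : EltWt t s s (thetaC i) :=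
  EltWt.sum fun a => ((eltWt_theta i a).mul (eltWt_ofFn (pullScale_mu a))).congr (one_mul _)

theorem eltWt_etaT (i : Fin 3) : EltWt t s (t : ℂ)⁻¹ (etaT i) :=
  EltWt.neg <| EltWt.sum fun b => ((eltWt_eta b i).mul
    (eltWt_ofFn (pullScale_mul (pullScale_lamHat b) pullScale_normLamInv))).congr <| by
      have := conj_unit_ne_zero t; have := t.ne_zero; field_simp

theorem eltWt_thetaT (i : Fin 3) : EltWt t s (s : ℂ)⁻¹ (thetaT i) :=
  EltWt.neg <| EltWt.sum fun a => ((eltWt_theta i a).mul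
    (eltWt_ofFn (pullScale_mul (pullScale_muHat a) pullScale_normMuInv))).congr <| by
      have := conj_unit_ne_zero s; have := s.ne_zero; field_simp

theorem hasWt_hatEF : HasWt t s (t * s) hatEF :=
  HasWt.sum fun a => HasWt.sum fun b => ((eltWt_ofFn (pullScale_mul
    (pullScale_raise pullScale_mu a) (pullScale_raise pullScale_lam b))).mulBy.mul
      (hasWt_pX a b)).congr (by ring)

theorem hasWt_hatEL : HasWt t s ((t : ℂ) ^ 2) hatEL :=
  HasWt.sum fun b => ((eltWt_ofFn (pullScale_mul pullScale_normLam (pullScale_lam b))).mulBy.mul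
    (hasWt_bodyOp (pullScale_dLamHat t s b))).congr <| by
      have := conj_unit_ne_zero t; field_simp

theorem hasWt_hatER : HasWt t s ((s : ℂ) ^ 2) hatER :=
  HasWt.sum fun b => ((eltWt_ofFn (pullScale_mul pullScale_normMu (pullScale_mu b))).mulBy.mul
    (hasWt_bodyOp (pullScale_dMuHat t s b))).congr <| by
      have := conj_unit_ne_zero s; field_simp

theorem hasWt_fieldW : HasWt t s (s * (t : ℂ)⁻¹) fieldW :=
  HasWt.sum fun a => HasWt.sum fun b => ((eltWt_ofFn (pullScale_mul (pullScale_mul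
    (pullScale_raise pullScale_mu a) (pullScale_raise pullScale_lamHat b))
      pullScale_normLamInv)).mulBy.mul (hasWt_pX a b)).congr <| by
        have := conj_unit_ne_zero t; have := t.ne_zero; field_simp

theorem hasWt_fieldWHat : HasWt t s (t * (s : ℂ)⁻¹) fieldWHat :=
  HasWt.neg <| HasWt.sum fun a => HasWt.sum fun b => ((eltWt_ofFn (pullScale_mul (pullScale_mul
    (pullScale_raise pullScale_muHat a) (pullScale_raise pullScale_lam b))
      pullScale_normMuInv)).mulBy.mul (hasWt_pX a b)).congr <| by
        have := conj_unit_ne_zero s; have := s.ne_zero; field_simp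

theorem hasWt_frameCR (A : Dir) : HasWt t s (dirWeight t s A) (frameCR A) := by
  cases A with
  | F => exact hasWt_hatEF
  | L => exact hasWt_hatEL
  | R => exact hasWt_hatER
  | up i =>
    exact HasWt.sum fun b => ((eltWt_ofFn (pullScale_raise pullScale_lam b)).mulBy.mul
      (hasWt_covEta i b)).congr (mul_one _)
  | dn i =>
    exact HasWt.sum fun a => ((eltWt_ofFn (pullScale_raise pullScale_mu a)).mulBy.mul
      (hasWt_covTheta i a)).congr (mul_one _)

theorem eltWt_thetaC_etaC : EltWt t s (s * t) (∑ i, thetaC i * etaC i) :=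
  EltWt.sum fun i => (eltWt_thetaC i).mul (eltWt_etaC i)

theorem hasWt_frameTw (A : Dir) : HasWt t s (dirWeight t s A) (frameTw A) := by
  have ht := t.ne_zero
  have hs := s.ne_zero
  cases A with
  | F => exact hasWt_hatEF
  | L =>
    refine hasWt_hatEL.add ((eltWt_thetaC_etaC.mulBy.mul hasWt_fieldWHat).congr ?_)
    field_simp
  | R =>
    refine hasWt_hatER.add ((eltWt_thetaC_etaC.mulBy.mul hasWt_fieldW).congr ?_)
    field_simp
  | up i =>
    exact HasWt.sum fun b => ((eltWt_ofFn (pullScale_raise pullScale_lam b)).mulBy.mul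
      (hasWt_oddDer (.eta b i))).congr
        (show (t : ℂ) * (1 : ℂ)⁻¹ = t by simp)
  | dn i =>
    exact HasWt.sum fun a => ((eltWt_ofFn (pullScale_raise pullScale_mu a)).mulBy.mul
      (hasWt_oddDer (.theta i a))).congr
        (show (s : ℂ) * (1 : ℂ)⁻¹ = s by simp)

theorem dirWeight_ne_zero (A : Dir) : dirWeight t s A ≠ 0 := by
  cases A <;> simp [dirWeight]

theorem eltWt_structCR (A B D : Dir) :
    EltWt t s (dirWeight t s A * dirWeight t s B * (dirWeight t s D)⁻¹) (structCR A B D) := by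
  have ht := t.ne_zero
  have hs := s.ne_zero
  unfold structCR
  split
  · split
    · exact EltWt.ofNat_two.congr (by simp only [dirWeight]; field_simp)
    · exact EltWt.zero
  · split
    · exact EltWt.ofNat_two.congr (by simp only [dirWeight]; field_simp)
    · exact EltWt.zero
  · exact EltWt.zero

theorem eltWt_structTw (A B D : Dir) :
    EltWt t s (dirWeight t s A * dirWeight t s B * (dirWeight t s D)⁻¹) (structTw A B D) := by
  have ht := t.ne_zero
  have hs := s.ne_zero
  unfold structTw
  split
  · exact (EltWt.ofNat_two.mul eltWt_thetaC_etaC).congr (by simp only [dirWeight]; field_simp)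
  · exact (EltWt.ofNat_two.mul eltWt_thetaC_etaC).neg.congr
      (by simp only [dirWeight]; field_simp)
  · exact EltWt.zero

theorem eltWt_coframe (A : Dir) : EltWt t s (dirWeight t s A)⁻¹ (coframe A) := by
  cases A with
  | F => exact eltWt_oddVar .formF
  | L => exact eltWt_oddVar .formL
  | R => exact eltWt_oddVar .formR
  | up i => exact eltWt_evenVar (.up i)
  | dn i => exact eltWt_evenVar (.dn i)

theorem hasWt_coframeDer (A : Dir) : HasWt t s (dirWeight t s A) (coframeDer A) := by
  rw [← inv_inv (dirWeight t s A)]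
  cases A with
  | F => exact hasWt_oddDer .formF
  | L => exact hasWt_oddDer .formL
  | R => exact hasWt_oddDer .formR
  | up i => exact hasWt_evenDer (.up i)
  | dn i => exact hasWt_evenDer (.dn i)

theorem hasWt_frameDifferential {E : Dir → Op} {C : Dir → Dir → Dir → FormAlg}
    (hE : ∀ A, HasWt t s (dirWeight t s A) (E A))
    (hC : ∀ A B D, EltWt t s (dirWeight t s A * dirWeight t s B * (dirWeight t s D)⁻¹) (C A B D)) :
    HasWt t s 1 (frameDifferential E C) := by
  refine HasWt.sub (HasWt.sum fun A => ?_) (HasWt.smul _ (HasWt.sum fun A => HasWt.sum fun B =>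
    HasWt.sum fun D => HasWt.smul _ ?_))
  · exact ((eltWt_coframe A).mulBy.mul (hE A)).congr (inv_mul_cancel₀ (dirWeight_ne_zero A))
  · refine (((((eltWt_coframe A).mul (eltWt_coframe B)).mul (hC A B D)).mulBy).mul
      (hasWt_coframeDer D)).congr ?_
    have hA := dirWeight_ne_zero (t := t) (s := s) A
    have hB := dirWeight_ne_zero (t := t) (s := s) B
    have hD := dirWeight_ne_zero (t := t) (s := s) D
    field_simp

end Weight

/-- `∂̄_CR` in homogeneous coordinates. -/
def dbarHom : Op := frameDifferential frameCR structCR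

/-- `∂̄_{CR,tw}` in homogeneous coordinates. -/
def dbarTwHom : Op := frameDifferential frameTw structTw

theorem dbarHom_mem (w : FormAlg) (hw : w ∈ Omega) : dbarHom w ∈ Omega := fun t s => by
  rw [dbarHom, hasWt_frameDifferential hasWt_frameCR eltWt_structCR w, hw t s, one_smul]

theorem dbarTwHom_mem (w : FormAlg) (hw : w ∈ Omega) : dbarTwHom w ∈ Omega := fun t s => by
  rw [dbarTwHom, hasWt_frameDifferential hasWt_frameTw eltWt_structTw w, hw t s, one_smul]

/-- `∂̄_CR` on `Ω^{0,•}_CR(F)`. -/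
def dbar : Omega →ₗ[ℂ] Omega :=
  LinearMap.restrict dbarHom (p := Omega.toSubmodule) (q := Omega.toSubmodule) dbarHom_mem

/-- `∂̄_{CR,tw}` on `Ω^{0,•}_{CR,tw}(F)`. -/
def dbarTw : Omega →ₗ[ℂ] Omega :=
  LinearMap.restrict dbarTwHom (p := Omega.toSubmodule) (q := Omega.toSubmodule) dbarTwHom_mem
/-! ### Cochain complexes and differential graded Lie algebras

All objects carry, besides the form degree `p ∈ ℕ`, the Grassmann parity `a ∈ ℤ/2`; the sign rule is
governed by the total parity `p + a`. -/

/-- `M` with the bigraded pieces `piece p a` and the differential `d` is a cochain complex. -/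
structure IsComplex {𝕜 M : Type*} [Field 𝕜] [AddCommGroup M] [Module 𝕜 M]
    (piece : ℕ → ZMod 2 → Submodule 𝕜 M) (d : M →ₗ[𝕜] M) : Prop where
  internal : DirectSum.IsInternal fun k : ℕ × ZMod 2 => piece k.1 k.2
  d_mem : ∀ p a, ∀ x ∈ piece p a, d x ∈ piece (p + 1) a
  d_d : ∀ x, d (d x) = 0

/-- The data of a differential graded Lie algebra on `M`. -/
structure DGLAData (𝕜 M : Type*) [Field 𝕜] [AddCommGroup M] [Module 𝕜 M] where
  piece : ℕ → ZMod 2 → Submodule 𝕜 M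
  d : M →ₗ[𝕜] M
  br : M →ₗ[𝕜] M →ₗ[𝕜] M

/-- The axioms of a differential graded Lie algebra. -/
structure DGLAData.IsDGLA {𝕜 M : Type*} [Field 𝕜] [AddCommGroup M] [Module 𝕜 M]
    (L : DGLAData 𝕜 M) : Prop where
  isComplex : IsComplex L.piece L.d
  br_mem : ∀ p a q b, ∀ x ∈ L.piece p a, ∀ y ∈ L.piece q b, L.br x y ∈ L.piece (p + q) (a + b)
  antisymm : ∀ p a q b, ∀ x ∈ L.piece p a, ∀ y ∈ L.piece q b,
    L.br x y = -((-1 : 𝕜) ^ ((p + a.val) * (q + b.val)) • L.br y x)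
  jacobi : ∀ p a q b, ∀ x ∈ L.piece p a, ∀ y ∈ L.piece q b, ∀ z,
    L.br x (L.br y z) =
      L.br (L.br x y) z + (-1 : 𝕜) ^ ((p + a.val) * (q + b.val)) • L.br y (L.br x z)
  leibniz : ∀ p a, ∀ x ∈ L.piece p a, ∀ y,
    L.d (L.br x y) = L.br (L.d x) y + (-1 : 𝕜) ^ (p + a.val) • L.br x (L.d y)

/-- An isomorphism of differential graded Lie algebras. -/
structure DGLAData.Iso {𝕜 M N : Type*} [Field 𝕜] [AddCommGroup M] [Module 𝕜 M] [AddCommGroup N]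
    [Module 𝕜 N] (L : DGLAData 𝕜 M) (K : DGLAData 𝕜 N) where
  toEquiv : M ≃ₗ[𝕜] N
  map_piece : ∀ p a, (L.piece p a).map toEquiv.toLinearMap = K.piece p a
  map_d : ∀ x, toEquiv (L.d x) = K.d (toEquiv x)
  map_br : ∀ x y, toEquiv (L.br x y) = K.br (toEquiv x) (toEquiv y)

section Tensor

variable (𝕜 𝔤 : Type*) [Field 𝕜] [Algebra 𝕜 ℂ] [LieRing 𝔤] [LieAlgebra 𝕜 𝔤]

/-- `Ω ⊗ 𝔤` with the differential `δ ⊗ id` and `[v ⊗ x, w ⊗ y] = (v ∧ w) ⊗ [x, y]`. -/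
def tensorLie (δ : Omega →ₗ[ℂ] Omega) : DGLAData 𝕜 (Omega ⊗[𝕜] 𝔤) where
  piece p a := LinearMap.range
    (LinearMap.rTensor 𝔤 ((OmegaPiece p a).subtype.restrictScalars 𝕜))
  d := LinearMap.rTensor 𝔤 (δ.restrictScalars 𝕜)
  br := TensorProduct.map₂ (LinearMap.mul 𝕜 Omega)
    (LinearMap.mk₂ 𝕜 (fun x y : 𝔤 => ⁅x, y⁆) add_lie smul_lie lie_add lie_smul)

/-- `𝔏_CR = (Ω^{0,•}_CR(F) ⊗ 𝔤, ∂̄_CR, [-,-])`. -/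
def LCR : DGLAData 𝕜 (Omega ⊗[𝕜] 𝔤) := tensorLie 𝕜 𝔤 dbar

/-- `𝔏_{CR,tw} = (Ω^{0,•}_{CR,tw}(F) ⊗ 𝔤, ∂̄_{CR,tw}, [-,-])`. The coframe generators now stand for
the coframe dual to the twisted frame. -/
def LTw : DGLAData 𝕜 (Omega ⊗[𝕜] 𝔤) := tensorLie 𝕜 𝔤 dbarTw

end Tensor

end

end CRAmbitwistor

open CRAmbitwistor

namespace CRAmbitwistor
noncomputable section

/-! ### Generators and supercommutativity -/

/-! Every member of the three frames has the form `D_A + c_A^{αα'} ∂/∂x^{αα'}`. The superderivation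
`D_A` (`derPart`) is common to `Ê_A`, `Ê'_A` and `V̂_A`, contains no x-derivative and commutes with
all of them; the coefficients `c_A` do not depend on x (`IsSplit`). The `D_A` supercommute with one
another, and so do translations with x-independent coefficients. Hence the supercommutator of two
frame members is the translation with coefficients `D_A c_B - (±) D_B c_A` (`IsSplit.superComm`),
and every frame computation reduces to the action of `D_A` on a handful of coefficients.

The exponent X is itself a translation, with even, nilpotent, x-independent coefficients `coefX`. So
`[X, Ê'_A]` is the translation with coefficients `-D_A(coefX)`, which commutes with X, and the
series for `e^X Ê'_A e^{-X}` stops after the linear term (`exp_mul_eq`). The conjugation formula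
thus becomes the identity of coefficients `coefTw_eq`. Its inputs are that `Ê_L` sends `η̃_i` to
`-η_i` and the coefficients of `E_W` to those of `Ê_F`, the analogous rules for `Ê_R`, and the
expansion of the odd coordinates in the spinor bases `μ, hat μ` and `λ, hat λ` (`theta_decomp`,
`eta_decomp`). The brackets of `V̂_A` are computed; those of `Ê'_A` follow by conjugation, because
the structure functions are x-independent and commute with g.

All brackets point along F. Each differential is therefore `S - q P` with `S = e^A E_A`, `P =
∂/∂e^F` and `-q` the differential of `e^F`. The relations `S² = q E_F`, `P S + S P = E_F`, `P² = 0`,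
together with q commuting with S and P, give square zero (`frameDifferential_mul_self`).

The isomorphism is `Φ = (1 + N) e^{-X}`, where `N = (ê'^F - ê^F) ∂/∂e^F` is an even derivation with
`N² = 0` and `N(x) N(y) = 0`, so both factors are multiplicative. The two composites of Φ with the
differentials obey the same Leibniz rule along Φ and need comparing on generators only
(`untwist_dbarTwHom`). Away from `e^F`, the factor `e^{-X}` turns `e^A V̂_A` into `e^A Ê'_A`, then
`1 + N` replaces `e^F` by `ê'^F`, and `ê'^A Ê'_A = ê^A Ê_A`. On `e^F` the claim is the structure
equation `frameDer_coframeShift`.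

X and N are invariant under the rescaling of the homogeneous coordinates and under both gradings, so
Φ restricts to global forms and preserves the bidegree. Tensoring with the Lie algebra then takes
the signs from the supercommutativity of forms and the Lie identities from the algebra itself. -/

theorem elem_mul_elem (f g : SmoothFn) (x y : ExteriorAlgebra ℂ (OddGen → ℂ))
    (p q : MvPolynomial EvenGen ℂ) :
    elem f x p * elem g y q = elem (f * g) (x * y) (p * q) := by
  change (f ⊗ₜ (x ⊗ₜ p) : FormAlgRaw) * (g ⊗ₜ (y ⊗ₜ q) : FormAlgRaw) =
    (f * g) ⊗ₜ ((x * y) ⊗ₜ (p * q))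
  rw [Algebra.TensorProduct.tmul_mul_tmul, Algebra.TensorProduct.tmul_mul_tmul]

theorem one_eq_elem : (1 : FormAlg) = elem 1 1 1 := rfl

theorem elem_add_left (f g : SmoothFn) (x : ExteriorAlgebra ℂ (OddGen → ℂ))
    (p : MvPolynomial EvenGen ℂ) : elem (f + g) x p = elem f x p + elem g x p :=
  TensorProduct.add_tmul f g (x ⊗ₜ p)

theorem elem_add_mid (f : SmoothFn) (x y : ExteriorAlgebra ℂ (OddGen → ℂ))
    (p : MvPolynomial EvenGen ℂ) : elem f (x + y) p = elem f x p + elem f y p :=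
  (congrArg (fun z => (f ⊗ₜ z : FormAlgRaw)) (TensorProduct.add_tmul x y p)).trans
    (TensorProduct.tmul_add f _ _)

theorem elem_add_right (f : SmoothFn) (x : ExteriorAlgebra ℂ (OddGen → ℂ))
    (p q : MvPolynomial EvenGen ℂ) : elem f x (p + q) = elem f x p + elem f x q :=
  (congrArg (fun z => (f ⊗ₜ z : FormAlgRaw)) (TensorProduct.tmul_add x p q)).trans
    (TensorProduct.tmul_add f _ _)

def ofFnHom : SmoothFn →ₐ[ℂ] FormAlg :=
  (Algebra.TensorProduct.includeLeft : SmoothFn →ₐ[ℂ] FormAlgRaw)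

theorem ofFn_mul (f g : SmoothFn) : ofFn (f * g) = ofFn f * ofFn g := map_mul ofFnHom f g

theorem ofFn_add (f g : SmoothFn) : ofFn (f + g) = ofFn f + ofFn g := map_add ofFnHom f g

theorem ofFn_neg (f : SmoothFn) : ofFn (-f) = -ofFn f := map_neg ofFnHom f

theorem ofFn_smul (c : ℂ) (f : SmoothFn) : ofFn (c • f) = c • ofFn f := map_smul ofFnHom c f

@[simp] theorem ofFn_zero : ofFn 0 = 0 := map_zero ofFnHom

@[simp] theorem ofFn_one : ofFn 1 = 1 := rfl

theorem ofFn_mul_elem (f g : SmoothFn) (x : ExteriorAlgebra ℂ (OddGen → ℂ))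
    (p : MvPolynomial EvenGen ℂ) : ofFn f * elem g x p = elem (f * g) x p := by
  rw [ofFn, elem_mul_elem, one_mul, one_mul]

theorem commute_ofFn (f : SmoothFn) (w : FormAlg) : ofFn f * w = w * ofFn f := by
  induction w using formAlg_induction with
  | add u v hu hv => rw [mul_add, add_mul, hu, hv]
  | elem g x p => rw [ofFn, elem_mul_elem, elem_mul_elem, mul_comm f g]; simp

theorem commute_evenVar (k : EvenGen) (w : FormAlg) : evenVar k * w = w * evenVar k := by
  induction w using formAlg_induction with
  | add u v hu hv => rw [mul_add, add_mul, hu, hv]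
  | elem g x p =>
    rw [evenVar, elem_mul_elem, elem_mul_elem, mul_comm (MvPolynomial.X k) p]; simp

theorem oddVar_anticomm (j k : OddGen) : oddVar j * oddVar k = -(oddVar k * oddVar j) := by
  have h : (ExteriorAlgebra.ι ℂ (Pi.single j (1 : ℂ)) * ExteriorAlgebra.ι ℂ (Pi.single k 1) :
      ExteriorAlgebra ℂ (OddGen → ℂ)) = (-1 : ℂ) •
      (ExteriorAlgebra.ι ℂ (Pi.single k (1 : ℂ)) * ExteriorAlgebra.ι ℂ (Pi.single j 1)) := by
    rw [neg_one_smul, eq_neg_iff_add_eq_zero]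
    exact ExteriorAlgebra.ι_add_mul_swap _ _
  rw [oddVar, oddVar, elem_mul_elem, elem_mul_elem, h, elem_smul_mid, neg_one_smul]

/-- An induction principle: `FormAlg` is generated by functions on the body and the odd and even
generators. -/
theorem formAlg_gen_induction {P : FormAlg → Prop} (w : FormAlg)
    (ofFn : ∀ f, P (ofFn f)) (oddVar : ∀ k, P (oddVar k)) (evenVar : ∀ k, P (evenVar k))
    (add : ∀ u v, P u → P v → P (u + v)) (mul : ∀ u v, P u → P v → P (u * v)) : P w := by
  have scal (c : ℂ) : P (c • (1 : FormAlg)) := by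
    rw [← ofFn_one, ← ofFn_smul]; exact ofFn _
  have smul (c : ℂ) (w) (h : P w) : P (c • w) := by
    rw [← one_mul w, ← smul_mul_assoc]; exact mul _ _ (scal c) h
  have zero : P 0 := by rw [← ofFn_zero]; exact ofFn 0
  -- The odd generators are the basis vectors only; linearity reaches every vector, which is what
  -- left induction on the exterior algebra multiplies by.
  have hodd (v : OddGen → ℂ) : P (elem 1 (ExteriorAlgebra.ι ℂ v) 1) := by
    let L : (OddGen → ℂ) →ₗ[ℂ] FormAlg :=
      { toFun := fun v => elem 1 (ExteriorAlgebra.ι ℂ v) 1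
        map_add' := fun v w => by rw [map_add, elem_add_mid]
        map_smul' := fun c v => by rw [map_smul, elem_smul_mid]; rfl }
    change P (L v)
    rw [LinearMap.pi_apply_eq_sum_univ L v]
    refine Finset.sum_induction _ P add zero fun k _ => smul _ _ ?_
    convert oddVar k using 1
    change elem _ _ _ = elem _ _ _
    congr 3
    ext j
    simp [Pi.single_apply, eq_comm]
  have hext (x : ExteriorAlgebra ℂ (OddGen → ℂ)) : P (elem 1 x 1) := by
    induction x using CliffordAlgebra.left_induction with
    | algebraMap r =>
      rw [Algebra.algebraMap_eq_smul_one, elem_smul_mid, ← one_eq_elem]; exact scal r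
    | add x y hx hy => rw [elem_add_mid]; exact add _ _ hx hy
    | ι_mul x m hx =>
      have := mul _ _ (hodd m) hx
      rwa [elem_mul_elem, one_mul, one_mul] at this
  have hpol (p : MvPolynomial EvenGen ℂ) : P (elem 1 1 p) := by
    induction p using MvPolynomial.induction_on with
    | C r =>
      rw [← MvPolynomial.algebraMap_eq, Algebra.algebraMap_eq_smul_one, elem_smul_right,
        ← one_eq_elem]; exact scal r
    | add p q hp hq => rw [elem_add_right]; exact add _ _ hp hq
    | mul_X p k hp =>
      have := mul _ _ hp (evenVar k)
      rwa [CRAmbitwistor.evenVar, elem_mul_elem, one_mul, one_mul] at this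
  induction w using formAlg_induction with
  | add u v hu hv => exact add _ _ hu hv
  | elem f x p =>
    have := mul _ _ (mul _ _ (ofFn f) (hext x)) (hpol p)
    rwa [ofFn_mul_elem, elem_mul_elem, mul_one, mul_one, mul_one, one_mul] at this

/-! ### Rescaling homomorphisms on generators -/

section Rescale

variable (φ : SmoothFn →ₐ[ℂ] SmoothFn) (a : OddGen → ℂ) (b : EvenGen → ℂ)

theorem rescale_ofFn (f : SmoothFn) : rescale φ a b (ofFn f) = ofFn (φ f) := by
  rw [ofFn, rescale_elem, map_one, map_one, ofFn]

theorem rescale_oddVar (k : OddGen) : rescale φ a b (oddVar k) = a k • oddVar k := by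
  have h1 : (LinearMap.pi fun j => a j • LinearMap.proj j :
      (OddGen → ℂ) →ₗ[ℂ] (OddGen → ℂ)) (Pi.single k 1) = a k • Pi.single k 1 := by
    ext j
    by_cases hj : j = k
    · subst hj; simp
    · simp [hj]
  rw [oddVar, rescale_elem, ExteriorAlgebra.map_apply_ι, h1, map_smul, map_one,
    map_one, elem_smul_mid]

theorem rescale_evenVar (k : EvenGen) : rescale φ a b (evenVar k) = b k • evenVar k := by
  rw [evenVar, rescale_elem, MvPolynomial.aeval_X, map_one, map_one, elem_smul_right]

end Rescale

theorem formAlg_algHom_ext {ρ τ : FormAlg →ₐ[ℂ] FormAlg} (h0 : ∀ f, ρ (ofFn f) = τ (ofFn f))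
    (h1 : ∀ k, ρ (oddVar k) = τ (oddVar k)) (h2 : ∀ k, ρ (evenVar k) = τ (evenVar k)) : ρ = τ := by
  ext w
  induction w using formAlg_gen_induction with
  | ofFn f => exact h0 f
  | oddVar k => exact h1 k
  | evenVar k => exact h2 k
  | add u v hu hv => rw [map_add, map_add, hu, hv]
  | mul u v hu hv => rw [map_mul, map_mul, hu, hv]

/-- The involution given by the total parity. -/
def gradeInv : FormAlg →ₐ[ℂ] FormAlg := rescale (AlgHom.id ℂ _) (fun _ => -1) (fun _ => 1)

@[simp] theorem gradeInv_ofFn (f : SmoothFn) : gradeInv (ofFn f) = ofFn f := rescale_ofFn _ _ _ f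

@[simp] theorem gradeInv_oddVar (k : OddGen) : gradeInv (oddVar k) = -oddVar k := by
  rw [gradeInv, rescale_oddVar, neg_one_smul]

@[simp] theorem gradeInv_evenVar (k : EvenGen) : gradeInv (evenVar k) = evenVar k := by
  rw [gradeInv, rescale_evenVar, one_smul]

theorem gradeInv_comp_self : gradeInv.comp gradeInv = AlgHom.id ℂ _ :=
  formAlg_algHom_ext (by simp) (by simp) (by simp)

@[simp] theorem gradeInv_gradeInv (w : FormAlg) : gradeInv (gradeInv w) = w :=
  DFunLike.congr_fun gradeInv_comp_self w

theorem oddVar_mul (k : OddGen) (w : FormAlg) : oddVar k * w = gradeInv w * oddVar k := by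
  induction w using formAlg_gen_induction with
  | ofFn f => rw [gradeInv_ofFn, commute_ofFn]
  | oddVar j => rw [gradeInv_oddVar, oddVar_anticomm, neg_mul]
  | evenVar j => rw [gradeInv_evenVar, commute_evenVar]
  | add u v hu hv => rw [map_add, mul_add, add_mul, hu, hv]
  | mul u v hu hv => rw [map_mul, ← mul_assoc, hu, mul_assoc, hv, mul_assoc]

/-- Commutation rules are known on generators only. Carrying them along with the splitting into even
and odd parts lets the induction pass through products, and so extends supercommutativity to the
whole algebra. -/
theorem exists_even_add_odd (w : FormAlg) : ∃ u v, w = u + v ∧ gradeInv u = u ∧ gradeInv v = -v ∧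
    (∀ y, u * y = y * u) ∧ ∀ y, v * y = gradeInv y * v := by
  induction w using formAlg_gen_induction with
  | ofFn f => exact ⟨_, 0, (add_zero _).symm, by simp, by simp, commute_ofFn f, by simp⟩
  | oddVar k => exact ⟨0, _, (zero_add _).symm, by simp, by simp, by simp, oddVar_mul k⟩
  | evenVar k => exact ⟨_, 0, (add_zero _).symm, by simp, by simp, commute_evenVar k, by simp⟩
  | add x y hx hy =>
    obtain ⟨u, v, rfl, h1, h2, h3, h4⟩ := hx
    obtain ⟨u', v', rfl, h1', h2', h3', h4'⟩ := hy
    refine ⟨u + u', v + v', by abel, by rw [map_add, h1, h1'], by rw [map_add, h2, h2', neg_add],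
      fun y => by rw [add_mul, mul_add, h3, h3'], fun y => by rw [add_mul, mul_add, h4, h4']⟩
  | mul x y hx hy =>
    obtain ⟨u, v, rfl, h1, h2, h3, h4⟩ := hx
    obtain ⟨u', v', rfl, h1', h2', h3', h4'⟩ := hy
    refine ⟨u * u' + v * v', u * v' + v * u', by noncomm_ring, by simp [h1, h1', h2, h2'],
      by simp [h1, h1', h2, h2', add_comm], fun y => ?_, fun y => ?_⟩
    · rw [add_mul, mul_add, mul_assoc, h3' y, ← mul_assoc, h3 y, mul_assoc v, h4', ← mul_assoc v,
        h4, gradeInv_gradeInv]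
      simp only [mul_assoc]
    · rw [add_mul, mul_add, mul_assoc, h4' y, ← mul_assoc u, h3 (gradeInv y), mul_assoc v, h3',
        ← mul_assoc v, h4]
      simp only [mul_assoc]

/-- `x` has total parity `n`. -/
def HasPar (n : ℕ) (x : FormAlg) : Prop := gradeInv x = (-1 : ℂ) ^ n • x

theorem eq_zero_of_eq_neg {M : Type*} [AddCommGroup M] [Module ℂ M] {x : M} (h : x = -x) :
    x = 0 := by
  have h2 : (2 : ℂ) • x = 0 := by
    rw [two_smul]; nth_rw 1 [h]; exact neg_add_cancel x
  exact (smul_eq_zero.1 h2).resolve_left two_ne_zero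

/-- Comparing the splitting of `x` with its image under `gradeInv` makes the odd part equal to its
own negative, so only the central part survives. -/
theorem HasPar.central {x : FormAlg} (hx : HasPar 0 x) (y : FormAlg) : x * y = y * x := by
  obtain ⟨u, v, rfl, h1, h2, h3, h4⟩ := exists_even_add_odd x
  have hx' : u + -v = u + v := by
    have := hx; rw [HasPar, map_add, h1, h2, pow_zero, one_smul] at this; exact this
  have hv : v = 0 := eq_zero_of_eq_neg (add_left_cancel hx').symm
  rw [hv, add_zero, h3]

theorem HasPar.odd_mul {x : FormAlg} (hx : HasPar 1 x) (y : FormAlg) :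
    x * y = gradeInv y * x := by
  obtain ⟨u, v, rfl, h1, h2, h3, h4⟩ := exists_even_add_odd x
  have hx' : u + -v = -u + -v := by
    have := hx; rw [HasPar, map_add, h1, h2, pow_one, neg_one_smul, neg_add] at this; exact this
  have hu : u = 0 := eq_zero_of_eq_neg (add_right_cancel hx')
  rw [hu, zero_add, h4]

theorem HasPar.congr {n m : ℕ} {x : FormAlg} (hx : HasPar n x)
    (h : (-1 : ℂ) ^ n = (-1) ^ m) : HasPar m x := by
  rw [HasPar, ← h]; exact hx

theorem HasPar.mul {n m : ℕ} {x y : FormAlg} (hx : HasPar n x) (hy : HasPar m y) :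
    HasPar (n + m) (x * y) := by
  unfold HasPar at *; rw [map_mul, hx, hy, smul_mul_smul_comm, pow_add]

theorem HasPar.add {n : ℕ} {x y : FormAlg} (hx : HasPar n x) (hy : HasPar n y) :
    HasPar n (x + y) := by
  unfold HasPar at *; rw [map_add, hx, hy, smul_add]

theorem HasPar.neg {n : ℕ} {x : FormAlg} (hx : HasPar n x) : HasPar n (-x) := by
  unfold HasPar at *; rw [map_neg, hx, smul_neg]

theorem HasPar.smul {n : ℕ} {x : FormAlg} (c : ℂ) (hx : HasPar n x) : HasPar n (c • x) := by
  unfold HasPar at *; rw [map_smul, hx, smul_comm]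

theorem HasPar.sub {n : ℕ} {x y : FormAlg} (hx : HasPar n x) (hy : HasPar n y) :
    HasPar n (x - y) := by
  rw [sub_eq_add_neg]; exact hx.add hy.neg

theorem HasPar.zero (n : ℕ) : HasPar n 0 := by simp [HasPar]

theorem HasPar.sum {ι : Type} {S : Finset ι} {n : ℕ} {x : ι → FormAlg}
    (h : ∀ i, HasPar n (x i)) : HasPar n (∑ i ∈ S, x i) :=
  Finset.sum_induction _ (HasPar n) (fun _ _ => HasPar.add) (HasPar.zero n) fun i _ => h i

theorem hasPar_ofFn (f : SmoothFn) : HasPar 0 (ofFn f) := by simp [HasPar]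

theorem hasPar_oddVar (k : OddGen) : HasPar 1 (oddVar k) := by simp [HasPar]

theorem hasPar_evenVar (k : EvenGen) : HasPar 0 (evenVar k) := by simp [HasPar]

/-- The power of the grading involution by which an operator of parity `n` twists the Leibniz
rule. -/
def gradePow (n : ℕ) : FormAlg →ₐ[ℂ] FormAlg := gradeInv ^ n

@[simp] theorem gradePow_zero (w : FormAlg) : gradePow 0 w = w := rfl

@[simp] theorem gradePow_one (w : FormAlg) : gradePow 1 w = gradeInv w := by
  rw [gradePow, pow_one]

theorem gradePow_add (n m : ℕ) (w : FormAlg) :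
    gradePow (n + m) w = gradePow n (gradePow m w) := by
  rw [gradePow, pow_add]; rfl

theorem gradePow_two_mul (n : ℕ) : gradePow (2 * n) = AlgHom.id ℂ _ := by
  rw [gradePow, pow_mul, pow_two]
  change (gradeInv.comp gradeInv) ^ n = 1
  rw [gradeInv_comp_self]; exact one_pow n

/-- Parities are natural numbers, added freely. Since `gradeInv` is an involution, only their class
modulo 2 matters, and this reduces every claim to parity 0 or 1. -/
theorem gradePow_eq_or (n : ℕ) : ((-1 : ℂ) ^ n = 1 ∧ gradePow n = gradePow 0) ∨
    ((-1 : ℂ) ^ n = -1 ∧ gradePow n = gradePow 1) := by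
  rcases Nat.even_or_odd' n with ⟨k, rfl | rfl⟩
  · left
    exact ⟨by simp, gradePow_two_mul k⟩
  · right
    refine ⟨by simp [pow_add], AlgHom.ext fun w => ?_⟩
    rw [add_comm, gradePow_add, gradePow_two_mul]; rfl

theorem HasPar.gradePow {n : ℕ} {x : FormAlg} (hx : HasPar n x) (m : ℕ) :
    gradePow m x = (-1 : ℂ) ^ (m * n) • x := by
  induction m with
  | zero => simp
  | succ m ih =>
    rw [gradePow_add, gradePow_one, hx, map_smul, ih, smul_smul, ← pow_add, Nat.succ_mul, add_comm]

/-- Supercommutativity. -/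
theorem HasPar.mul_eq {n : ℕ} {x : FormAlg} (hx : HasPar n x) (y : FormAlg) :
    x * y = CRAmbitwistor.gradePow n y * x := by
  rcases gradePow_eq_or n with ⟨h1, h2⟩ | ⟨h1, h2⟩
  · rw [h2, gradePow_zero]; exact (hx.congr (m := 0) (by simpa using h1)).central y
  · rw [h2, gradePow_one]; exact (hx.congr (m := 1) (by simpa using h1)).odd_mul y

theorem HasPar.mul_comm {n m : ℕ} {x y : FormAlg} (hx : HasPar n x) (hy : HasPar m y) :
    x * y = (-1 : ℂ) ^ (n * m) • (y * x) := by
  rw [hx.mul_eq, hy.gradePow, smul_mul_assoc]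

theorem HasPar.mul_self_odd {x : FormAlg} (hx : HasPar 1 x) : x * x = 0 := by
  apply eq_zero_of_eq_neg
  have := hx.mul_comm hx
  rwa [mul_one, pow_one, neg_one_smul] at this

/-! ### Superderivations -/

/-- `D` is a left superderivation of total parity `n`. -/
def IsSuperDer (n : ℕ) (D : Op) : Prop := ∀ x y, D (x * y) = D x * y + gradePow n x * D y

theorem IsSuperDer.add {n : ℕ} {D E : Op} (hD : IsSuperDer n D) (hE : IsSuperDer n E) :
    IsSuperDer n (D + E) := fun x y => by
  simp only [LinearMap.add_apply, hD x y, hE x y, mul_add, add_mul]; abel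

theorem IsSuperDer.zero (n : ℕ) : IsSuperDer n 0 := fun x y => by simp

theorem IsSuperDer.neg {n : ℕ} {D : Op} (hD : IsSuperDer n D) : IsSuperDer n (-D) := fun x y => by
  simp only [LinearMap.neg_apply, hD x y, neg_add, mul_neg, neg_mul]

theorem IsSuperDer.sub {n : ℕ} {D E : Op} (hD : IsSuperDer n D) (hE : IsSuperDer n E) :
    IsSuperDer n (D - E) := by rw [sub_eq_add_neg]; exact hD.add hE.neg

theorem IsSuperDer.sum {ι : Type} {S : Finset ι} {n : ℕ} {D : ι → Op}
    (h : ∀ i, IsSuperDer n (D i)) : IsSuperDer n (∑ i ∈ S, D i) :=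
  Finset.sum_induction _ (IsSuperDer n) (fun _ _ => IsSuperDer.add) (IsSuperDer.zero n)
    fun i _ => h i

theorem mulBy_apply (x w : FormAlg) : mulBy x w = x * w := rfl

/-- In the second Leibniz term `x` has to move past `gradePow m y`; by supercommutativity this costs
exactly `n` further powers of the involution. -/
theorem IsSuperDer.mulBy_mul {n m : ℕ} {x : FormAlg} {D : Op} (hx : HasPar n x)
    (hD : IsSuperDer m D) : IsSuperDer (n + m) (mulBy x * D) := fun y z => by
  simp only [Module.End.mul_apply, mulBy_apply, hD y z, gradePow_add, mul_add, ← mul_assoc,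
    hx.mul_eq (gradePow m y)]

theorem IsSuperDer.congr {n m : ℕ} {D : Op} (hD : IsSuperDer n D)
    (h : gradePow n = gradePow m) : IsSuperDer m D := fun x y => by rw [← h]; exact hD x y

theorem IsSuperDer.map_one {n : ℕ} {D : Op} (hD : IsSuperDer n D) : D 1 = 0 := by
  have := hD 1 1
  simpa using this

/-- The Leibniz rule as an identity in the ring `Op`, so that commutators can be computed without
evaluating on forms. -/
theorem IsSuperDer.mul_mulBy {n : ℕ} {D : Op} (hD : IsSuperDer n D) (x : FormAlg) :
    D * mulBy x = mulBy (D x) + mulBy (gradePow n x) * D :=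
  LinearMap.ext fun y => hD x y

theorem IsSuperDer.mul_mulBy_of_hasPar {n m : ℕ} {D : Op} (hD : IsSuperDer n D) {x : FormAlg}
    (hx : HasPar m x) : D * mulBy x = mulBy (D x) + (-1 : ℂ) ^ (n * m) • (mulBy x * D) := by
  rw [hD.mul_mulBy, hx.gradePow]
  congr 1
  ext y
  simp [mulBy_apply]

theorem IsSuperDer.map_mul_even {n : ℕ} {D : Op} (hD : IsSuperDer n D) {x : FormAlg}
    (hx : HasPar 0 x) (y : FormAlg) : D (x * y) = D x * y + x * D y := by
  rw [hD, hx.gradePow, mul_zero, pow_zero, one_smul]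

theorem mulBy_mul_mulBy (x y : FormAlg) : mulBy x * mulBy y = mulBy (x * y) :=
  LinearMap.ext fun w => (mul_assoc x y w).symm

theorem mulBy_add (x y : FormAlg) : mulBy (x + y) = mulBy x + mulBy y :=
  LinearMap.ext fun w => add_mul x y w

theorem mulBy_neg (x : FormAlg) : mulBy (-x) = -mulBy x :=
  LinearMap.ext fun w => neg_mul x w

theorem mulBy_sub (x y : FormAlg) : mulBy (x - y) = mulBy x - mulBy y :=
  LinearMap.ext fun w => sub_mul x y w

theorem mulBy_smul (c : ℂ) (x : FormAlg) : mulBy (c • x) = c • mulBy x :=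
  LinearMap.ext fun w => smul_mul_assoc c x w

@[simp] theorem mulBy_zero : mulBy 0 = 0 := LinearMap.ext fun w => zero_mul w

@[simp] theorem mulBy_one : mulBy 1 = 1 := LinearMap.ext fun w => one_mul w

theorem mulBy_sum {ι : Type*} (S : Finset ι) (x : ι → FormAlg) :
    mulBy (∑ i ∈ S, x i) = ∑ i ∈ S, mulBy (x i) :=
  LinearMap.ext fun w => by simp [mulBy_apply, Finset.sum_mul, LinearMap.sum_apply]

/-! ### The basic derivations -/

theorem bodyOp_ofFn (D : SmoothFn →ₗ[ℂ] SmoothFn) (f : SmoothFn) :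
    bodyOp D (ofFn f) = ofFn (D f) := rfl

theorem isSuperDer_bodyOp {D : SmoothFn →ₗ[ℂ] SmoothFn}
    (h : ∀ f g, D (f * g) = D f * g + f * D g) : IsSuperDer 0 (bodyOp D) := fun u v => by
  rw [gradePow_zero]
  induction u using formAlg_induction with
  | add u u' hu hu' => simp only [add_mul, map_add, hu, hu']; abel
  | elem f x p =>
    induction v using formAlg_induction with
    | add v v' hv hv' => simp only [mul_add, map_add, hv, hv']; abel
    | elem g y q =>
      simp only [elem_mul_elem, bodyOp_elem, h, elem_add_left]

theorem bodyOp_oddVar {D : SmoothFn →ₗ[ℂ] SmoothFn} (h : D 1 = 0) (k : OddGen) :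
    bodyOp D (oddVar k) = 0 := by
  rw [oddVar, bodyOp_elem, h]; exact TensorProduct.zero_tmul _ _

theorem bodyOp_evenVar {D : SmoothFn →ₗ[ℂ] SmoothFn} (h : D 1 = 0) (k : EvenGen) :
    bodyOp D (evenVar k) = 0 := by
  rw [evenVar, bodyOp_elem, h]; exact TensorProduct.zero_tmul _ _

/-- Left induction leaves only the passage of the contraction past one vector, which produces the
sign. The sign is expressed by the map of weight -1 because this is how `gradeInv` acts on the
exterior factor. -/
theorem contractLeft_mul (d : Module.Dual ℂ (OddGen → ℂ)) (x y : ExteriorAlgebra ℂ (OddGen → ℂ)) :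
    CliffordAlgebra.contractLeft (Q := (0 : QuadraticForm ℂ (OddGen → ℂ))) d (x * y) =
      CliffordAlgebra.contractLeft (Q := (0 : QuadraticForm ℂ (OddGen → ℂ))) d x * y +
      ExteriorAlgebra.map (LinearMap.pi fun j => (-1 : ℂ) • LinearMap.proj j) x *
        CliffordAlgebra.contractLeft (Q := (0 : QuadraticForm ℂ (OddGen → ℂ))) d y := by
  induction x using CliffordAlgebra.left_induction with
  | algebraMap r =>
    rw [CliffordAlgebra.contractLeft_algebraMap_mul, CliffordAlgebra.contractLeft_algebraMap,
      zero_mul, zero_add, AlgHom.commutes]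
  | add x x' hx hx' => simp only [map_add, add_mul, hx, hx']; abel
  | ι_mul x m hx =>
    have h1 : ExteriorAlgebra.map (LinearMap.pi fun j => (-1 : ℂ) • LinearMap.proj j)
          (CliffordAlgebra.ι (0 : QuadraticForm ℂ (OddGen → ℂ)) m) =
        -CliffordAlgebra.ι (0 : QuadraticForm ℂ (OddGen → ℂ)) m := by
      rw [← map_neg]
      refine (ExteriorAlgebra.map_apply_ι _ _).trans ?_
      congr 1
      ext j; simp
    rw [mul_assoc, CliffordAlgebra.contractLeft_ι_mul, hx, CliffordAlgebra.contractLeft_ι_mul,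
      map_mul, h1, sub_mul, mul_add, smul_mul_assoc]
    simp only [neg_mul, mul_assoc]
    abel

theorem gradeInv_elem (f : SmoothFn) (x : ExteriorAlgebra ℂ (OddGen → ℂ))
    (p : MvPolynomial EvenGen ℂ) : gradeInv (elem f x p) =
      elem f (ExteriorAlgebra.map (LinearMap.pi fun j => (-1 : ℂ) • LinearMap.proj j) x) p := by
  rw [gradeInv, rescale_elem]
  simp only [one_smul, MvPolynomial.aeval_X_left]
  rfl

theorem isSuperDer_oddDer (k : OddGen) : IsSuperDer 1 (oddDer k) := fun u v => by
  rw [gradePow_one]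
  induction u using formAlg_induction with
  | add u u' hu hu' => simp only [add_mul, map_add, hu, hu']; abel
  | elem f x p =>
    induction v using formAlg_induction with
    | add v v' hv hv' => simp only [mul_add, map_add, hv, hv']; abel
    | elem g y q =>
      simp only [elem_mul_elem, oddDer_elem, contractLeft_mul, elem_add_mid, gradeInv_elem]

@[simp] theorem oddDer_ofFn (k : OddGen) (f : SmoothFn) : oddDer k (ofFn f) = 0 := by
  rw [ofFn, oddDer_elem, CliffordAlgebra.contractLeft_one, ← zero_smul ℂ (1 : ExteriorAlgebra ℂ _),
    elem_smul_mid, zero_smul]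

@[simp] theorem oddDer_evenVar (k : OddGen) (j : EvenGen) : oddDer k (evenVar j) = 0 := by
  rw [evenVar, oddDer_elem, CliffordAlgebra.contractLeft_one,
    ← zero_smul ℂ (1 : ExteriorAlgebra ℂ _), elem_smul_mid, zero_smul]

theorem oddDer_oddVar (k j : OddGen) : oddDer k (oddVar j) = if k = j then 1 else 0 := by
  rw [oddVar, oddDer_elem]
  have h : CliffordAlgebra.contractLeft (Q := (0 : QuadraticForm ℂ (OddGen → ℂ)))
      (LinearMap.proj k) (ExteriorAlgebra.ι ℂ (Pi.single j (1 : ℂ))) =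
      (if k = j then (1 : ℂ) else 0) • 1 := by
    refine (CliffordAlgebra.contractLeft_ι _ _ _).trans ?_
    rw [Algebra.algebraMap_eq_smul_one, LinearMap.proj_apply, Pi.single_apply]
  rw [h, elem_smul_mid, ← one_eq_elem]
  split <;> simp

theorem oddDer_comm_bodyOp (k : OddGen) (D : SmoothFn →ₗ[ℂ] SmoothFn) :
    oddDer k * bodyOp D = bodyOp D * oddDer k := by
  ext w
  induction w using formAlg_induction with
  | add u v hu hv => rw [map_add, map_add, hu, hv]
  | elem f x p => rfl

theorem bodyOp_mul (D E : SmoothFn →ₗ[ℂ] SmoothFn) :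
    bodyOp D * bodyOp E = bodyOp (D ∘ₗ E) := by
  ext w
  induction w using formAlg_induction with
  | add u v hu hv => rw [map_add, map_add, hu, hv]
  | elem f x p => rfl

theorem oddDer_anticomm (j k : OddGen) : oddDer j * oddDer k = -(oddDer k * oddDer j) := by
  ext w
  induction w using formAlg_induction with
  | add u v hu hv => rw [map_add, map_add, hu, hv]
  | elem f x p =>
    rw [Module.End.mul_apply, LinearMap.neg_apply, Module.End.mul_apply, oddDer_elem, oddDer_elem,
      oddDer_elem, oddDer_elem, CliffordAlgebra.contractLeft_comm, ← neg_one_smul ℂ, elem_smul_mid,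
      neg_one_smul]

theorem oddDer_mul_self (k : OddGen) : oddDer k * oddDer k = 0 :=
  eq_zero_of_eq_neg (oddDer_anticomm k k)

/-! ### Derivations of the smooth functions -/

theorem dirDeriv_apply (v : Amb) (f : SmoothFn) (p : Body) :
    (dirDeriv v f).1 p = fderiv ℝ (extendZero f.1) p.1 v := rfl

/-- The body is open, so derivatives at its points do not see the extension by zero and can be
computed from any ambient formula. -/
theorem extendZero_mkSmooth_eventuallyEq (F : Amb → ℂ) (hF : ContDiffOn ℝ ∞ F bodySet)
    (p : Body) : extendZero (mkSmooth F hF).1 =ᶠ[nhds p.1] F := by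
  filter_upwards [isOpen_bodySet.mem_nhds p.2] with q hq
  rw [extendZero_of_mem _ hq]; rfl

theorem dirDeriv_mkSmooth (v : Amb) (F : Amb → ℂ) (hF : ContDiffOn ℝ ∞ F bodySet) (p : Body) :
    (dirDeriv v (mkSmooth F hF)).1 p = fderiv ℝ F p.1 v := by
  rw [dirDeriv_apply, (extendZero_mkSmooth_eventuallyEq F hF p).fderiv_eq]

theorem dirDeriv_mul (v : Amb) (f g : SmoothFn) :
    dirDeriv v (f * g) = dirDeriv v f * g + f * dirDeriv v g := by
  ext p
  have : extendZero (f * g).1 = extendZero f.1 * extendZero g.1 := by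
    ext q; by_cases h : q ∈ bodySet <;> simp [extendZero, h]
  change (dirDeriv v (f * g)).1 p = (dirDeriv v f).1 p * g.1 p + f.1 p * (dirDeriv v g).1 p
  rw [dirDeriv_apply, this, fderiv_mul (smooth_differentiableAt f p) (smooth_differentiableAt g p),
    dirDeriv_apply, dirDeriv_apply]
  simp [extendZero_of_mem _ p.2]
  ring

/-- Both sides are values of the second Fréchet derivative of a function smooth near the point, and
that derivative is symmetric. -/
theorem dirDeriv_comm (v w : Amb) (f : SmoothFn) :
    dirDeriv v (dirDeriv w f) = dirDeriv w (dirDeriv v f) := by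
  ext p
  have hf : ContDiffAt ℝ ∞ (extendZero f.1) p.1 :=
    (smooth_contDiffOn f).contDiffAt (isOpen_bodySet.mem_nhds p.2)
  have hd : DifferentiableAt ℝ (fderiv ℝ (extendZero f.1)) p.1 :=
    (hf.fderiv_right (m := 1) (by rw [one_add_one_eq_two]; exact ENat.LEInfty.out)).differentiableAt (by simp)
  have key (v w : Amb) : (dirDeriv v (dirDeriv w f)).1 p =
      fderiv ℝ (fderiv ℝ (extendZero f.1)) p.1 v w := by
    refine (dirDeriv_mkSmooth v _ _ p).trans ?_
    rw [fderiv_clm_apply hd (differentiableAt_const w)]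
    simp
  rw [key, key]
  exact (hf.isSymmSndFDerivAt (by rw [minSmoothness_of_isRCLikeNormedField]; exact ENat.LEInfty.out)).eq v w

/-- `D` satisfies the Leibniz rule. -/
def IsDer (D : SmoothFn →ₗ[ℂ] SmoothFn) : Prop := ∀ f g, D (f * g) = D f * g + f * D g

theorem IsDer.add {D E : SmoothFn →ₗ[ℂ] SmoothFn} (hD : IsDer D) (hE : IsDer E) :
    IsDer (D + E) := fun f g => by
  simp only [LinearMap.add_apply, hD f g, hE f g]; ring

theorem IsDer.smul {D : SmoothFn →ₗ[ℂ] SmoothFn} (c : ℂ) (hD : IsDer D) : IsDer (c • D) :=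
  fun f g => by
    simp only [LinearMap.smul_apply, hD f g, smul_add, smul_mul_assoc, mul_smul_comm]

theorem IsDer.neg {D : SmoothFn →ₗ[ℂ] SmoothFn} (hD : IsDer D) : IsDer (-D) := fun f g => by
  simp only [LinearMap.neg_apply, hD f g]; ring

theorem IsDer.sub {D E : SmoothFn →ₗ[ℂ] SmoothFn} (hD : IsDer D) (hE : IsDer E) :
    IsDer (D - E) := fun f g => by
  simp only [LinearMap.sub_apply, hD f g, hE f g]; ring

theorem IsDer.map_one {D : SmoothFn →ₗ[ℂ] SmoothFn} (hD : IsDer D) : D 1 = 0 := by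
  have := hD 1 1
  simpa using this

theorem isDer_dirDeriv (v : Amb) : IsDer (dirDeriv v) := dirDeriv_mul v

theorem isDer_dHol (v : Amb) : IsDer (dHol v) :=
  ((isDer_dirDeriv _).sub ((isDer_dirDeriv _).smul _)).smul _

theorem isDer_dAnti (v : Amb) : IsDer (dAnti v) :=
  ((isDer_dirDeriv _).add ((isDer_dirDeriv _).smul _)).smul _

theorem isDer_dX (a b : Fin 2) : IsDer (dX a b) := by
  fin_cases a <;> fin_cases b
  · exact isDer_dHol _
  · exact isDer_dHol _
  · exact (isDer_dAnti _).neg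
  · exact isDer_dAnti _

theorem isDer_dLamHat (b : Fin 2) : IsDer (dLamHat b) := by
  fin_cases b
  · exact (isDer_dAnti _).neg
  · exact isDer_dAnti _

theorem isDer_dMuHat (b : Fin 2) : IsDer (dMuHat b) := by
  fin_cases b
  · exact (isDer_dAnti _).neg
  · exact isDer_dAnti _

/-- `D` and `E` commute. -/
def CommFn (D E : SmoothFn →ₗ[ℂ] SmoothFn) : Prop := ∀ f, D (E f) = E (D f)

theorem CommFn.symm {D E : SmoothFn →ₗ[ℂ] SmoothFn} (h : CommFn D E) : CommFn E D :=
  fun f => (h f).symm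

theorem commute_dirDeriv (v w : Amb) : CommFn (dirDeriv v) (dirDeriv w) := dirDeriv_comm v w

theorem CommFn.neg_left {D E : SmoothFn →ₗ[ℂ] SmoothFn} (h : CommFn D E) : CommFn (-D) E :=
  fun f => by simp [h f]

/-- All coordinate derivatives are constant-coefficient combinations of directional ones, so
commuting with the latter suffices. Leaving `T` arbitrary allows a second application, through
symmetry, in the other slot. -/
theorem commute_dHol_left {v : Amb} {T : SmoothFn →ₗ[ℂ] SmoothFn}
    (h : ∀ w, CommFn (dirDeriv w) T) : CommFn (dHol v) T := fun f => by
  simp [dHol, h _ f]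

theorem commute_dAnti_left {v : Amb} {T : SmoothFn →ₗ[ℂ] SmoothFn}
    (h : ∀ w, CommFn (dirDeriv w) T) : CommFn (dAnti v) T := fun f => by
  simp [dAnti, h _ f]

theorem commute_dX_left {a b : Fin 2} {T : SmoothFn →ₗ[ℂ] SmoothFn}
    (h : ∀ w, CommFn (dirDeriv w) T) : CommFn (dX a b) T := by
  fin_cases a <;> fin_cases b
  · exact commute_dHol_left h
  · exact commute_dHol_left h
  · exact (commute_dAnti_left h).neg_left
  · exact commute_dAnti_left h

theorem commute_dLamHat_left {b : Fin 2} {T : SmoothFn →ₗ[ℂ] SmoothFn}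
    (h : ∀ w, CommFn (dirDeriv w) T) : CommFn (dLamHat b) T := by
  fin_cases b
  · exact (commute_dAnti_left h).neg_left
  · exact commute_dAnti_left h

theorem commute_dMuHat_left {b : Fin 2} {T : SmoothFn →ₗ[ℂ] SmoothFn}
    (h : ∀ w, CommFn (dirDeriv w) T) : CommFn (dMuHat b) T := by
  fin_cases b
  · exact (commute_dAnti_left h).neg_left
  · exact commute_dAnti_left h

theorem commute_dX (a b c d : Fin 2) : CommFn (dX a b) (dX c d) :=
  commute_dX_left fun _ => (commute_dX_left fun _ => commute_dirDeriv _ _).symm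

theorem commute_dLamHat_dX (a b c : Fin 2) : CommFn (dLamHat c) (dX a b) :=
  commute_dLamHat_left fun _ => (commute_dX_left fun _ => commute_dirDeriv _ _).symm

theorem commute_dMuHat_dX (a b c : Fin 2) : CommFn (dMuHat c) (dX a b) :=
  commute_dMuHat_left fun _ => (commute_dX_left fun _ => commute_dirDeriv _ _).symm

theorem commute_dLamHat_dMuHat (b c : Fin 2) : CommFn (dLamHat b) (dMuHat c) :=
  commute_dLamHat_left fun _ => (commute_dMuHat_left fun _ => commute_dirDeriv _ _).symm

/-! ### Derivatives of the spinor coordinates -/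

/-- The spinor coordinates and their conjugates are real-linear functions of the point, so their
derivatives are constants. -/
theorem dirDeriv_clm (v : Amb) (L : Amb →L[ℝ] ℂ) (F : Amb → ℂ) (hF : ContDiffOn ℝ ∞ F bodySet)
    (h : F = L) : dirDeriv v (mkSmooth F hF) = algebraMap ℂ SmoothFn (L v) := by
  ext p
  rw [dirDeriv_mkSmooth, h, ContinuousLinearMap.fderiv]; rfl

theorem dAnti_clm (v : Amb) (L : Amb →L[ℝ] ℂ) (F : Amb → ℂ) (hF : ContDiffOn ℝ ∞ F bodySet)
    (h : F = L) : dAnti v (mkSmooth F hF) =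
      algebraMap ℂ SmoothFn (1 / 2 * (L v + Complex.I * L (Complex.I • v))) := by
  rw [dAnti, LinearMap.smul_apply, LinearMap.add_apply, LinearMap.smul_apply,
    dirDeriv_clm v L F hF h, dirDeriv_clm (Complex.I • v) L F hF h]
  simp only [Algebra.algebraMap_eq_smul_one, smul_smul, ← add_smul]

theorem dHol_clm (v : Amb) (L : Amb →L[ℝ] ℂ) (F : Amb → ℂ) (hF : ContDiffOn ℝ ∞ F bodySet)
    (h : F = L) : dHol v (mkSmooth F hF) =
      algebraMap ℂ SmoothFn (1 / 2 * (L v - Complex.I * L (Complex.I • v))) := by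
  rw [dHol, LinearMap.smul_apply, LinearMap.sub_apply, LinearMap.smul_apply,
    dirDeriv_clm v L F hF h, dirDeriv_clm (Complex.I • v) L F hF h]
  simp only [Algebra.algebraMap_eq_smul_one, smul_smul, ← sub_smul]

def lamL (k : Fin 2) : Amb →L[ℝ] ℂ :=
  (ContinuousLinearMap.proj k).comp ((ContinuousLinearMap.fst ℝ _ _).comp
    (ContinuousLinearMap.snd ℝ (Fin 2 → ℂ) ((Fin 2 → ℂ) × (Fin 2 → ℂ))))

def muL (k : Fin 2) : Amb →L[ℝ] ℂ :=
  (ContinuousLinearMap.proj k).comp ((ContinuousLinearMap.snd ℝ _ _).comp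
    (ContinuousLinearMap.snd ℝ (Fin 2 → ℂ) ((Fin 2 → ℂ) × (Fin 2 → ℂ))))

def lamHatL : Fin 2 → Amb →L[ℝ] ℂ :=
  ![-(Complex.conjCLE : ℂ →L[ℝ] ℂ).comp (lamL 1), (Complex.conjCLE : ℂ →L[ℝ] ℂ).comp (lamL 0)]

def muHatL : Fin 2 → Amb →L[ℝ] ℂ :=
  ![-(Complex.conjCLE : ℂ →L[ℝ] ℂ).comp (muL 1), (Complex.conjCLE : ℂ →L[ℝ] ℂ).comp (muL 0)]

theorem lamL_eq (k : Fin 2) : (fun p : Amb => p.2.1 k) = lamL k := rfl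

theorem muL_eq (k : Fin 2) : (fun p : Amb => p.2.2 k) = muL k := rfl

theorem lamHatL_eq (k : Fin 2) : (fun p : Amb => quat p.2.1 k) = lamHatL k := by
  fin_cases k <;> rfl

theorem muHatL_eq (k : Fin 2) : (fun p : Amb => quat p.2.2 k) = muHatL k := by
  fin_cases k <;> rfl

theorem dAnti_lam (v : Amb) (k : Fin 2) : dAnti v (lam k) = 0 := by
  rw [lam, dAnti_clm v (lamL k) _ _ (lamL_eq k)]
  simp [lamL, ← mul_assoc]

theorem dAnti_mu (v : Amb) (k : Fin 2) : dAnti v (mu k) = 0 := by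
  rw [mu, dAnti_clm v (muL k) _ _ (muL_eq k)]
  simp [muL, ← mul_assoc]

theorem dAnti_lamHat (v : Amb) (k : Fin 2) :
    dAnti v (lamHat k) = algebraMap ℂ SmoothFn (quat v.2.1 k) := by
  rw [lamHat, dAnti_clm v (lamHatL k) _ _ (lamHatL_eq k)]
  congr 1
  fin_cases k <;> simp [lamHatL, lamL, quat, ← mul_assoc] <;> ring

theorem dAnti_muHat (v : Amb) (k : Fin 2) :
    dAnti v (muHat k) = algebraMap ℂ SmoothFn (quat v.2.2 k) := by
  rw [muHat, dAnti_clm v (muHatL k) _ _ (muHatL_eq k)]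
  congr 1
  fin_cases k <;> simp [muHatL, muL, quat, ← mul_assoc] <;> ring

@[simp] theorem dX_lam (a b k : Fin 2) : dX a b (lam k) = 0 := by
  rw [lam]
  fin_cases a <;> fin_cases b <;>
    simp [dX, dAnti_clm _ (lamL k) _ _ (lamL_eq k), dHol_clm _ (lamL k) _ _ (lamL_eq k), lamL, xVec]

@[simp] theorem dX_mu (a b k : Fin 2) : dX a b (mu k) = 0 := by
  rw [mu]
  fin_cases a <;> fin_cases b <;>
    simp [dX, dAnti_clm _ (muL k) _ _ (muL_eq k), dHol_clm _ (muL k) _ _ (muL_eq k), muL, xVec]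

@[simp] theorem dX_lamHat (a b k : Fin 2) : dX a b (lamHat k) = 0 := by
  rw [lamHat]
  fin_cases a <;> fin_cases b <;>
    simp [dX, dAnti_clm _ (lamHatL k) _ _ (lamHatL_eq k), dHol_clm _ (lamHatL k) _ _ (lamHatL_eq k),
      xVec] <;> fin_cases k <;> simp [lamHatL, lamL]

@[simp] theorem dX_muHat (a b k : Fin 2) : dX a b (muHat k) = 0 := by
  rw [muHat]
  fin_cases a <;> fin_cases b <;>
    simp [dX, dAnti_clm _ (muHatL k) _ _ (muHatL_eq k), dHol_clm _ (muHatL k) _ _ (muHatL_eq k),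
      xVec] <;> fin_cases k <;> simp [muHatL, muL]

@[simp] theorem dLamHat_lam (b k : Fin 2) : dLamHat b (lam k) = 0 := by
  fin_cases b <;> simp [dLamHat, dAnti_lam]

@[simp] theorem dLamHat_mu (b k : Fin 2) : dLamHat b (mu k) = 0 := by
  fin_cases b <;> simp [dLamHat, dAnti_mu]

@[simp] theorem dLamHat_muHat (b k : Fin 2) : dLamHat b (muHat k) = 0 := by
  fin_cases b <;> fin_cases k <;> simp [dLamHat, dAnti_muHat, lamVec, quat]

theorem dLamHat_lamHat (b k : Fin 2) : dLamHat b (lamHat k) = if b = k then 1 else 0 := by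
  fin_cases b <;> fin_cases k <;> simp [dLamHat, dAnti_lamHat, lamVec, quat]

@[simp] theorem dMuHat_mu (b k : Fin 2) : dMuHat b (mu k) = 0 := by
  fin_cases b <;> simp [dMuHat, dAnti_mu]

@[simp] theorem dMuHat_lam (b k : Fin 2) : dMuHat b (lam k) = 0 := by
  fin_cases b <;> simp [dMuHat, dAnti_lam]

@[simp] theorem dMuHat_lamHat (b k : Fin 2) : dMuHat b (lamHat k) = 0 := by
  fin_cases b <;> fin_cases k <;> simp [dMuHat, dAnti_lamHat, muVec, quat]

theorem dMuHat_muHat (b k : Fin 2) : dMuHat b (muHat k) = if b = k then 1 else 0 := by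
  fin_cases b <;> fin_cases k <;> simp [dMuHat, dAnti_muHat, muVec, quat]

/-- Writing the norm as the determinant of `λ` and `hat λ` brings it within reach of the Leibniz
rule. -/
theorem normLam_eq : normLam = lam 1 * lamHat 0 - lam 0 * lamHat 1 := by
  ext p
  change spinorNorm p.1.2.1 = p.1.2.1 1 * quat p.1.2.1 0 - p.1.2.1 0 * quat p.1.2.1 1
  simp [spinorNorm_eq, quat]; ring

theorem normMu_eq : normMu = mu 1 * muHat 0 - mu 0 * muHat 1 := by
  ext p
  change spinorNorm p.1.2.2 = p.1.2.2 1 * quat p.1.2.2 0 - p.1.2.2 0 * quat p.1.2.2 1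
  simp [spinorNorm_eq, quat]; ring

theorem normLam_mul_inv : normLam * normLamInv = 1 := by
  ext p
  exact mul_inv_cancel₀ (spinorNorm_ne_zero p.2.1)

theorem normMu_mul_inv : normMu * normMuInv = 1 := by
  ext p
  exact mul_inv_cancel₀ (spinorNorm_ne_zero p.2.2)

/-- Differentiating `f * g = 1` handles the inverse norms without differentiating an inverse. -/
theorem IsDer.eq_zero_of_mul_eq_one {D : SmoothFn →ₗ[ℂ] SmoothFn} (hD : IsDer D) {f g : SmoothFn}
    (hf : D f = 0) (h : f * g = 1) : D g = 0 := by
  have h1 : f * D g = 0 := by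
    have := hD f g
    rw [h, hD.map_one, hf, zero_mul, zero_add] at this
    exact this.symm
  calc D g = (f * g) * D g := by rw [h, one_mul]
    _ = g * (f * D g) := by ring
    _ = 0 := by rw [h1, mul_zero]

@[simp] theorem dX_normLam (a b : Fin 2) : dX a b normLam = 0 := by
  simp [normLam_eq, isDer_dX a b _ _]

@[simp] theorem dX_normMu (a b : Fin 2) : dX a b normMu = 0 := by
  simp [normMu_eq, isDer_dX a b _ _]

@[simp] theorem dX_normLamInv (a b : Fin 2) : dX a b normLamInv = 0 :=
  (isDer_dX a b).eq_zero_of_mul_eq_one (dX_normLam a b) normLam_mul_inv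

@[simp] theorem dX_normMuInv (a b : Fin 2) : dX a b normMuInv = 0 :=
  (isDer_dX a b).eq_zero_of_mul_eq_one (dX_normMu a b) normMu_mul_inv

@[simp] theorem dLamHat_normMu (b : Fin 2) : dLamHat b normMu = 0 := by
  simp [normMu_eq, isDer_dLamHat b _ _]

@[simp] theorem dLamHat_normMuInv (b : Fin 2) : dLamHat b normMuInv = 0 :=
  (isDer_dLamHat b).eq_zero_of_mul_eq_one (dLamHat_normMu b) normMu_mul_inv

@[simp] theorem dMuHat_normLam (b : Fin 2) : dMuHat b normLam = 0 := by
  simp [normLam_eq, isDer_dMuHat b _ _]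

@[simp] theorem dMuHat_normLamInv (b : Fin 2) : dMuHat b normLamInv = 0 :=
  (isDer_dMuHat b).eq_zero_of_mul_eq_one (dMuHat_normLam b) normLam_mul_inv

/-- The antiholomorphic field `|λ|² λ_{α'} ∂/∂(hat λ)_{α'}` on functions. -/
def derL : SmoothFn →ₗ[ℂ] SmoothFn := ∑ b, LinearMap.mulLeft ℂ (normLam * lam b) ∘ₗ dLamHat b

/-- The antiholomorphic field `|μ|² μ_α ∂/∂(hat μ)_α` on functions. -/
def derR : SmoothFn →ₗ[ℂ] SmoothFn := ∑ b, LinearMap.mulLeft ℂ (normMu * mu b) ∘ₗ dMuHat b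

theorem derL_apply (f : SmoothFn) :
    derL f = normLam * lam 0 * dLamHat 0 f + normLam * lam 1 * dLamHat 1 f := by
  simp [derL, mul_assoc]

theorem derR_apply (f : SmoothFn) :
    derR f = normMu * mu 0 * dMuHat 0 f + normMu * mu 1 * dMuHat 1 f := by
  simp [derR, mul_assoc]

theorem isDer_derL : IsDer derL := fun f g => by
  rw [derL_apply, derL_apply, derL_apply, isDer_dLamHat, isDer_dLamHat]; ring

theorem isDer_derR : IsDer derR := fun f g => by
  rw [derR_apply, derR_apply, derR_apply, isDer_dMuHat, isDer_dMuHat]; ring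

@[simp] theorem derL_lam (k : Fin 2) : derL (lam k) = 0 := by simp [derL_apply]
@[simp] theorem derL_mu (k : Fin 2) : derL (mu k) = 0 := by simp [derL_apply]
@[simp] theorem derL_muHat (k : Fin 2) : derL (muHat k) = 0 := by simp [derL_apply]
@[simp] theorem derL_normMuInv : derL normMuInv = 0 := by simp [derL_apply]
@[simp] theorem derL_lamHat (k : Fin 2) : derL (lamHat k) = normLam * lam k := by
  fin_cases k <;> simp [derL_apply, dLamHat_lamHat]
-- The field moves `hat λ` in the direction of `λ`, and the determinant of `λ` with itself vanishes.
-- Hence the norm behaves as a constant for this field, although it depends on `hat λ`.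
@[simp] theorem derL_normLam : derL normLam = 0 := by
  conv_lhs => rw [normLam_eq]
  simp only [map_sub, isDer_derL _ _, derL_lam, derL_lamHat]
  ring
@[simp] theorem derL_normLamInv : derL normLamInv = 0 :=
  isDer_derL.eq_zero_of_mul_eq_one derL_normLam normLam_mul_inv

@[simp] theorem derR_lam (k : Fin 2) : derR (lam k) = 0 := by simp [derR_apply]
@[simp] theorem derR_mu (k : Fin 2) : derR (mu k) = 0 := by simp [derR_apply]
@[simp] theorem derR_lamHat (k : Fin 2) : derR (lamHat k) = 0 := by simp [derR_apply]
@[simp] theorem derR_normLamInv : derR normLamInv = 0 := by simp [derR_apply]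
@[simp] theorem derR_muHat (k : Fin 2) : derR (muHat k) = normMu * mu k := by
  fin_cases k <;> simp [derR_apply, dMuHat_muHat]
@[simp] theorem derR_normMu : derR normMu = 0 := by
  conv_lhs => rw [normMu_eq]
  simp only [map_sub, isDer_derR _ _, derR_mu, derR_muHat]
  ring
@[simp] theorem derR_normMuInv : derR normMuInv = 0 :=
  isDer_derR.eq_zero_of_mul_eq_one derR_normMu normMu_mul_inv

theorem commute_derL_dX (a b : Fin 2) : CommFn derL (dX a b) := by
  intro f
  have h (c) : dX a b (dLamHat c f) = dLamHat c (dX a b f) :=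
    (commute_dLamHat_dX a b c f).symm
  simp only [derL_apply, map_add, isDer_dX a b _ _, h, dX_normLam, dX_lam]
  ring

theorem commute_derR_dX (a b : Fin 2) : CommFn derR (dX a b) := by
  intro f
  have h (c) : dX a b (dMuHat c f) = dMuHat c (dX a b f) :=
    (commute_dMuHat_dX a b c f).symm
  simp only [derR_apply, map_add, isDer_dX a b _ _, h, dX_normMu, dX_mu]
  ring

theorem commute_derL_derR : CommFn derL derR := by
  intro f
  have h (b c) : dMuHat b (dLamHat c f) = dLamHat c (dMuHat b f) :=
    (commute_dLamHat_dMuHat c b f).symm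
  simp only [derL_apply, derR_apply, map_add, isDer_dLamHat _ _ _,
    isDer_dMuHat _ _ _, h, dLamHat_normMu, dLamHat_mu, dMuHat_normLam, dMuHat_lam]
  ring

/-- Absorbing the coefficients into one derivation of the functions makes the Leibniz and
commutation lemmas for `bodyOp` available. -/
theorem hatEL_eq : hatEL = bodyOp derL := by
  ext w
  induction w using formAlg_induction with
  | add u v hu hv => rw [map_add, map_add, hu, hv]
  | elem f x p =>
    rw [bodyOp_elem, derL_apply, elem_add_left, hatEL]
    simp only [Fin.sum_univ_two, LinearMap.add_apply, Module.End.mul_apply, bodyOp_elem,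
      mulBy_apply, ofFn_mul_elem]

theorem hatER_eq : hatER = bodyOp derR := by
  ext w
  induction w using formAlg_induction with
  | add u v hu hv => rw [map_add, map_add, hu, hv]
  | elem f x p =>
    rw [bodyOp_elem, derR_apply, elem_add_left, hatER]
    simp only [Fin.sum_univ_two, LinearMap.add_apply, Module.End.mul_apply, bodyOp_elem,
      mulBy_apply, ofFn_mul_elem]

theorem op_neg_mul (S T : Op) : -S * T = -(S * T) := neg_mul S T

theorem op_mul_neg (S T : Op) : S * -T = -(S * T) := mul_neg S T

/-! ### Translations with constant coefficients -/

theorem isSuperDer_pX (a b : Fin 2) : IsSuperDer 0 (pX a b) := isSuperDer_bodyOp (isDer_dX a b)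

theorem pX_ofFn (a b : Fin 2) (f : SmoothFn) : pX a b (ofFn f) = ofFn (dX a b f) := rfl

@[simp] theorem pX_oddVar (a b : Fin 2) (k : OddGen) : pX a b (oddVar k) = 0 :=
  bodyOp_oddVar (isDer_dX a b).map_one k

@[simp] theorem pX_evenVar (a b : Fin 2) (k : EvenGen) : pX a b (evenVar k) = 0 :=
  bodyOp_evenVar (isDer_dX a b).map_one k

/-- `x` does not depend on the coordinates `x^{α α'}`. -/
def IsConst (x : FormAlg) : Prop := ∀ a b, pX a b x = 0

theorem IsConst.add {x y : FormAlg} (hx : IsConst x) (hy : IsConst y) : IsConst (x + y) :=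
  fun a b => by rw [map_add, hx, hy, add_zero]

theorem IsConst.zero : IsConst 0 := fun _ _ => map_zero _

theorem IsConst.neg {x : FormAlg} (hx : IsConst x) : IsConst (-x) :=
  fun a b => by rw [map_neg, hx, neg_zero]

theorem IsConst.sub {x y : FormAlg} (hx : IsConst x) (hy : IsConst y) : IsConst (x - y) :=
  fun a b => by rw [map_sub, hx, hy, sub_zero]

theorem IsConst.smul {x : FormAlg} (c : ℂ) (hx : IsConst x) : IsConst (c • x) :=
  fun a b => by rw [map_smul, hx, smul_zero]

theorem IsConst.mul {x y : FormAlg} (hx : IsConst x) (hy : IsConst y) : IsConst (x * y) :=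
  fun a b => by rw [isSuperDer_pX a b, hx, hy, zero_mul, mul_zero, add_zero]

theorem IsConst.sum {ι : Type} {S : Finset ι} {x : ι → FormAlg}
    (h : ∀ i, IsConst (x i)) : IsConst (∑ i ∈ S, x i) :=
  Finset.sum_induction _ IsConst (fun _ _ => IsConst.add) IsConst.zero fun i _ => h i

theorem isConst_oddVar (k : OddGen) : IsConst (oddVar k) := fun _ _ => pX_oddVar _ _ k

theorem isConst_evenVar (k : EvenGen) : IsConst (evenVar k) := fun _ _ => pX_evenVar _ _ k

theorem isConst_ofFn {f : SmoothFn} (h : ∀ a b, dX a b f = 0) : IsConst (ofFn f) :=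
  fun a b => by rw [pX_ofFn, h, ofFn_zero]

theorem commute_pX (a b c d : Fin 2) : Commute (pX a b) (pX c d) := by
  change bodyOp _ * bodyOp _ = bodyOp _ * bodyOp _
  rw [bodyOp_mul, bodyOp_mul]
  congr 1
  exact LinearMap.ext (commute_dX a b c d)

/-- The vector field `c^{α α'} ∂/∂x^{α α'}`. -/
def transOp (c : Fin 2 → Fin 2 → FormAlg) : Op := ∑ a, ∑ b, mulBy (c a b) * pX a b

theorem transOp_add (c d : Fin 2 → Fin 2 → FormAlg) :
    transOp (fun a b => c a b + d a b) = transOp c + transOp d := by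
  simp only [transOp, mulBy_add, add_mul, Finset.sum_add_distrib]

theorem transOp_sub (c d : Fin 2 → Fin 2 → FormAlg) :
    transOp (fun a b => c a b - d a b) = transOp c - transOp d := by
  simp only [transOp, mulBy_sub, sub_mul, Finset.sum_sub_distrib]

theorem transOp_smul (r : ℂ) (c : Fin 2 → Fin 2 → FormAlg) :
    transOp (fun a b => r • c a b) = r • transOp c := by
  simp only [transOp, mulBy_smul, smul_mul_assoc, Finset.smul_sum]

theorem transOp_zero : transOp (fun _ _ => 0) = 0 := by simp [transOp]

theorem transOp_neg (c : Fin 2 → Fin 2 → FormAlg) :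
    transOp (fun a b => -c a b) = -transOp c := by
  have h := transOp_sub (fun _ _ => 0) c
  simp only [zero_sub, transOp_zero] at h
  exact h

theorem mulBy_mul_transOp (x : FormAlg) (c : Fin 2 → Fin 2 → FormAlg) :
    mulBy x * transOp c = transOp fun a b => x * c a b := by
  simp only [transOp, Finset.mul_sum, ← mul_assoc, mulBy_mul_mulBy]

theorem transOp_apply_of_isConst (c : Fin 2 → Fin 2 → FormAlg) {x : FormAlg} (hx : IsConst x) :
    transOp c x = 0 := by
  simp [transOp, hx _ _]

theorem isSuperDer_transOp {n : ℕ} {c : Fin 2 → Fin 2 → FormAlg} (hc : ∀ a b, HasPar n (c a b)) :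
    IsSuperDer n (transOp c) :=
  IsSuperDer.sum fun a => IsSuperDer.sum fun b => IsSuperDer.mulBy_mul (hc a b) (isSuperDer_pX a b)

theorem IsConst.commute_mulBy {x : FormAlg} (hx : IsConst x) (a b : Fin 2) :
    Commute (mulBy x) (pX a b) := by
  have := (isSuperDer_pX a b).mul_mulBy x
  rw [hx, mulBy_zero, zero_add, gradePow_zero] at this
  exact this.symm

theorem commute_transOp_pX {c : Fin 2 → Fin 2 → FormAlg} (hc : ∀ a b, IsConst (c a b))
    (a b : Fin 2) : Commute (transOp c) (pX a b) :=
  Commute.sum_left _ _ _ fun i _ => Commute.sum_left _ _ _ fun j _ =>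
    ((hc i j).commute_mulBy a b).mul_left (commute_pX i j a b)

/-- `D` passes the x-derivatives freely, so the only correction is its action on the coefficients.
-/
theorem IsSuperDer.mul_transOp {n m : ℕ} {D : Op} (hD : IsSuperDer n D)
    (hX : ∀ a b, Commute D (pX a b)) {c : Fin 2 → Fin 2 → FormAlg}
    (hc : ∀ a b, HasPar m (c a b)) :
    D * transOp c = transOp (fun a b => D (c a b)) + (-1 : ℂ) ^ (n * m) • (transOp c * D) := by
  simp only [transOp, Finset.mul_sum, Finset.sum_mul, Finset.smul_sum, ← Finset.sum_add_distrib]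
  refine Finset.sum_congr rfl fun a _ => Finset.sum_congr rfl fun b _ => ?_
  rw [← mul_assoc, hD.mul_mulBy_of_hasPar (hc a b), add_mul, smul_mul_assoc, mul_assoc, mul_assoc,
    (hX a b).eq]

/-- Each translation annihilates the coefficients of the other, which leaves only the sign from
exchanging the coefficients. -/
theorem transOp_mul_transOp {n m : ℕ} {c d : Fin 2 → Fin 2 → FormAlg}
    (hc : ∀ a b, HasPar n (c a b)) (hc' : ∀ a b, IsConst (c a b))
    (hd : ∀ a b, HasPar m (d a b)) (hd' : ∀ a b, IsConst (d a b)) :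
    transOp c * transOp d = (-1 : ℂ) ^ (n * m) • (transOp d * transOp c) := by
  rw [(isSuperDer_transOp hc).mul_transOp (commute_transOp_pX hc') hd]
  simp only [fun a b => transOp_apply_of_isConst c (hd' a b), transOp_zero, zero_add]

/-- `E` is the sum of the superderivation `D`, which commutes with translations, and of a
translation with constant coefficients `c`; both have parity `n`. -/
structure IsSplit (n : ℕ) (E D : Op) (c : Fin 2 → Fin 2 → FormAlg) : Prop where
  eq : E = D + transOp c
  der : IsSuperDer n D
  comm : ∀ a b, Commute D (pX a b)
  par : ∀ a b, HasPar n (c a b)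
  const : ∀ a b, IsConst (c a b)

theorem IsSplit.isSuperDer {n : ℕ} {E D : Op} {c : Fin 2 → Fin 2 → FormAlg}
    (h : IsSplit n E D c) : IsSuperDer n E := by
  rw [h.eq]; exact h.der.add (isSuperDer_transOp h.par)

theorem IsSplit.apply {n : ℕ} {E D : Op} {c : Fin 2 → Fin 2 → FormAlg}
    (h : IsSplit n E D c) {x : FormAlg} (hx : IsConst x) : E x = D x := by
  rw [h.eq, LinearMap.add_apply, transOp_apply_of_isConst c hx, add_zero]

/-- Of the four kinds of terms, derivation against derivation cancels by hypothesis and translation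
against translation by x-independence. The two mixed kinds each leave a derivation applied to
coefficients. This is the single formula behind all brackets of frame fields and behind the bracket
with the twist exponent. -/
theorem IsSplit.superComm {n m : ℕ} {E D E' D' : Op} {c c' : Fin 2 → Fin 2 → FormAlg}
    (h : IsSplit n E D c) (h' : IsSplit m E' D' c')
    (hD : D * D' = (-1 : ℂ) ^ (n * m) • (D' * D)) :
    E * E' - (-1 : ℂ) ^ (n * m) • (E' * E) =
      transOp fun a b => D (c' a b) - (-1 : ℂ) ^ (n * m) • D' (c a b) := by
  have h1 := h.der.mul_transOp h.comm h'.par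
  have h2 := h'.der.mul_transOp h'.comm h.par
  have h3 := transOp_mul_transOp h.par h.const h'.par h'.const
  rw [transOp_sub, transOp_smul, h.eq, h'.eq]
  simp only [mul_add, add_mul]
  rw [hD, h1, h2, h3, Nat.mul_comm m n]
  have hs : (-1 : ℂ) ^ (n * m) * (-1) ^ (n * m) = 1 := by
    rw [← mul_pow]; norm_num
  simp only [smul_add, smul_smul, hs, one_smul]
  abel

/-! ### The frames -/

def coefF (a b : Fin 2) : FormAlg := ofFn (muUp a * lamUp b)

def coefW (a b : Fin 2) : FormAlg := ofFn (muUp a * lamHatUp b * normLamInv)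

def coefWHat (a b : Fin 2) : FormAlg := -ofFn (muHatUp a * lamUp b * normMuInv)

theorem hatEF_eq : hatEF = transOp coefF := rfl

theorem fieldW_eq : fieldW = transOp coefW := rfl

theorem fieldWHat_eq : fieldWHat = transOp coefWHat := by
  rw [show coefWHat = fun a b => -ofFn (muHatUp a * lamUp b * normMuInv) from rfl, transOp_neg]; rfl

/-- The part of the frame field without `∂/∂x^{α α'}`. -/
def derPart : Dir → Op
  | .F => 0
  | .L => hatEL
  | .R => hatER
  | .up i => ∑ b, mulBy (ofFn (lamUp b)) * oddDer (.eta b i)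
  | .dn i => ∑ a, mulBy (ofFn (muUp a)) * oddDer (.theta i a)

/-- The coefficients of `∂/∂x^{α α'}` that complement `derPart` in the CR frame; `coefTw` plays the
same role for the twisted frame. -/
def coefCR : Dir → Fin 2 → Fin 2 → FormAlg
  | .F => coefF
  | .L => fun _ _ => 0
  | .R => fun _ _ => 0
  | .up i => fun a b => ofFn (lamUp b) * theta i a
  | .dn i => fun a b => ofFn (muUp a) * eta b i

/-- `Ê'_A - Ê_A` divided by `Ê_F`. -/
def coefShift : Dir → FormAlg
  | .F => 0
  | .L => ∑ i, thetaT i * etaC i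
  | .R => -∑ i, thetaC i * etaT i
  | .up i => -thetaT i
  | .dn i => -etaT i

def coefTw : Dir → Fin 2 → Fin 2 → FormAlg
  | .F => coefF
  | .L => fun a b => (∑ i, thetaC i * etaC i) * coefWHat a b
  | .R => fun a b => (∑ i, thetaC i * etaC i) * coefW a b
  | .up _ => fun _ _ => 0
  | .dn _ => fun _ _ => 0

/-- Coefficients of the twist exponent. That they are even, x-independent and nilpotent is what
makes the exponential tractable. -/
def coefX (a b : Fin 2) : FormAlg :=
  (∑ i, thetaT i * etaC i) * coefW a b + (∑ i, thetaC i * etaT i) * coefWHat a b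

theorem twistField_eq : twistField = transOp coefX := by
  rw [show coefX = fun a b => (∑ i, thetaT i * etaC i) * coefW a b +
    (∑ i, thetaC i * etaT i) * coefWHat a b from rfl, transOp_add, ← mulBy_mul_transOp,
    ← mulBy_mul_transOp, twistField, fieldW_eq, fieldWHat_eq]

theorem frameCR_eq (A : Dir) : frameCR A = derPart A + transOp (coefCR A) := by
  cases A with
  | F => exact (zero_add _).symm
  | L => change hatEL = hatEL + transOp fun _ _ => 0; rw [transOp_zero, add_zero]
  | R => change hatER = hatER + transOp fun _ _ => 0; rw [transOp_zero, add_zero]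
  | up i =>
    simp only [frameCR, derPart, coefCR, covEta, mul_add, Finset.sum_add_distrib, Finset.mul_sum,
      transOp, ← mul_assoc, mulBy_mul_mulBy]
    rw [Finset.sum_comm (f := fun b a => mulBy (ofFn (lamUp b) * theta i a) * pX a b)]
  | dn i =>
    simp only [frameCR, derPart, coefCR, covTheta, mul_add, Finset.sum_add_distrib, Finset.mul_sum,
      transOp, ← mul_assoc, mulBy_mul_mulBy]

theorem framePrime_eq_add (A : Dir) : framePrime A = frameCR A + mulBy (coefShift A) * hatEF := by
  cases A <;> simp [framePrime, coefShift, frameCR, mulBy_neg, op_neg_mul, sub_eq_add_neg]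

theorem framePrime_eq (A : Dir) :
    framePrime A = derPart A + transOp fun a b => coefCR A a b + coefShift A * coefF a b := by
  rw [framePrime_eq_add, frameCR_eq, transOp_add, ← mulBy_mul_transOp, hatEF_eq, add_assoc]

theorem frameTw_eq (A : Dir) : frameTw A = derPart A + transOp (coefTw A) := by
  cases A with
  | F => exact (zero_add _).symm
  | L =>
    change _ = hatEL + transOp fun a b => (∑ i, thetaC i * etaC i) * coefWHat a b
    rw [← mulBy_mul_transOp, ← fieldWHat_eq]; rfl
  | R =>
    change _ = hatER + transOp fun a b => (∑ i, thetaC i * etaC i) * coefW a b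
    rw [← mulBy_mul_transOp, ← fieldW_eq]; rfl
  | up i => change _ = derPart _ + transOp fun _ _ => 0; rw [transOp_zero, add_zero]; rfl
  | dn i => change _ = derPart _ + transOp fun _ _ => 0; rw [transOp_zero, add_zero]; rfl

/-! ### Parity and constancy of the coefficients -/

theorem HasPar.mul_even {n : ℕ} {x y : FormAlg} (hx : HasPar n x) (hy : HasPar 0 y) :
    HasPar n (x * y) := (hx.mul hy).congr (by rw [add_zero])

theorem HasPar.even_mul {n : ℕ} {x y : FormAlg} (hx : HasPar 0 x) (hy : HasPar n y) :
    HasPar n (x * y) := (hx.mul hy).congr (by rw [zero_add])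

theorem hasPar_eta (b : Fin 2) (i : Fin 3) : HasPar 1 (eta b i) := hasPar_oddVar _

theorem hasPar_theta (i : Fin 3) (a : Fin 2) : HasPar 1 (theta i a) := hasPar_oddVar _

theorem hasPar_etaC (i : Fin 3) : HasPar 1 (etaC i) :=
  HasPar.sum fun b => (hasPar_eta b i).mul_even (hasPar_ofFn _)

theorem hasPar_thetaC (i : Fin 3) : HasPar 1 (thetaC i) :=
  HasPar.sum fun a => (hasPar_theta i a).mul_even (hasPar_ofFn _)

theorem hasPar_etaT (i : Fin 3) : HasPar 1 (etaT i) :=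
  (HasPar.sum fun b => (hasPar_eta b i).mul_even (hasPar_ofFn _)).neg

theorem hasPar_thetaT (i : Fin 3) : HasPar 1 (thetaT i) :=
  (HasPar.sum fun a => (hasPar_theta i a).mul_even (hasPar_ofFn _)).neg

theorem HasPar.odd_mul_odd {x y : FormAlg} (hx : HasPar 1 x) (hy : HasPar 1 y) :
    HasPar 0 (x * y) := (hx.mul hy).congr (by norm_num)

theorem HasPar.sum_odd_mul_odd {x y : Fin 3 → FormAlg} (hx : ∀ i, HasPar 1 (x i))
    (hy : ∀ i, HasPar 1 (y i)) : HasPar 0 (∑ i, x i * y i) :=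
  HasPar.sum fun i => (hx i).odd_mul_odd (hy i)

theorem hasPar_coefF (a b : Fin 2) : HasPar 0 (coefF a b) := hasPar_ofFn _

theorem hasPar_coefW (a b : Fin 2) : HasPar 0 (coefW a b) := hasPar_ofFn _

theorem hasPar_coefWHat (a b : Fin 2) : HasPar 0 (coefWHat a b) := (hasPar_ofFn _).neg

theorem hasPar_coefCR (A : Dir) (a b : Fin 2) : HasPar A.par (coefCR A a b) := by
  cases A with
  | F => exact hasPar_coefF a b
  | L => exact HasPar.zero _
  | R => exact HasPar.zero _
  | up i => exact (hasPar_ofFn _).even_mul (hasPar_theta i a)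
  | dn i => exact (hasPar_ofFn _).even_mul (hasPar_eta b i)

theorem hasPar_coefShift (A : Dir) : HasPar A.par (coefShift A) := by
  cases A with
  | F => exact HasPar.zero _
  | L => exact HasPar.sum_odd_mul_odd hasPar_thetaT hasPar_etaC
  | R => exact (HasPar.sum_odd_mul_odd hasPar_thetaC hasPar_etaT).neg
  | up i => exact (hasPar_thetaT i).neg
  | dn i => exact (hasPar_etaT i).neg

theorem hasPar_coefTw (A : Dir) (a b : Fin 2) : HasPar A.par (coefTw A a b) := by
  cases A with
  | F => exact hasPar_coefF a b
  | L => exact (HasPar.sum_odd_mul_odd hasPar_thetaC hasPar_etaC).mul_even (hasPar_coefWHat a b)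
  | R => exact (HasPar.sum_odd_mul_odd hasPar_thetaC hasPar_etaC).mul_even (hasPar_coefW a b)
  | up i => exact HasPar.zero _
  | dn i => exact HasPar.zero _

theorem hasPar_coefX (a b : Fin 2) : HasPar 0 (coefX a b) :=
  ((HasPar.sum_odd_mul_odd hasPar_thetaT hasPar_etaC).mul_even (hasPar_coefW a b)).add
    ((HasPar.sum_odd_mul_odd hasPar_thetaC hasPar_etaT).mul_even (hasPar_coefWHat a b))

/-! ### Independence of the coefficients from x -/

theorem dX_mul_eq_zero {a b : Fin 2} {f g : SmoothFn} (hf : dX a b f = 0) (hg : dX a b g = 0) :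
    dX a b (f * g) = 0 := by rw [isDer_dX, hf, hg, zero_mul, mul_zero, add_zero]

theorem dX_raiseFn {a b : Fin 2} {f : Fin 2 → SmoothFn} (h : ∀ c, dX a b (f c) = 0) (c : Fin 2) :
    dX a b (raiseFn f c) = 0 := by
  fin_cases c <;> simp [raiseFn, h]

@[simp] theorem dX_lamUp (a b c : Fin 2) : dX a b (lamUp c) = 0 := dX_raiseFn (dX_lam a b) c

@[simp] theorem dX_muUp (a b c : Fin 2) : dX a b (muUp c) = 0 := dX_raiseFn (dX_mu a b) c

@[simp] theorem dX_lamHatUp (a b c : Fin 2) : dX a b (lamHatUp c) = 0 :=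
  dX_raiseFn (dX_lamHat a b) c

@[simp] theorem dX_muHatUp (a b c : Fin 2) : dX a b (muHatUp c) = 0 :=
  dX_raiseFn (dX_muHat a b) c

theorem isConst_eta (b : Fin 2) (i : Fin 3) : IsConst (eta b i) := isConst_oddVar _

theorem isConst_theta (i : Fin 3) (a : Fin 2) : IsConst (theta i a) := isConst_oddVar _

theorem isConst_etaC (i : Fin 3) : IsConst (etaC i) :=
  IsConst.sum fun b => (isConst_eta b i).mul (isConst_ofFn (by simp))

theorem isConst_thetaC (i : Fin 3) : IsConst (thetaC i) :=
  IsConst.sum fun a => (isConst_theta i a).mul (isConst_ofFn (by simp))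

theorem isConst_etaT (i : Fin 3) : IsConst (etaT i) :=
  (IsConst.sum fun b => (isConst_eta b i).mul
    (isConst_ofFn fun _ _ => dX_mul_eq_zero (by simp) (by simp))).neg

theorem isConst_thetaT (i : Fin 3) : IsConst (thetaT i) :=
  (IsConst.sum fun a => (isConst_theta i a).mul
    (isConst_ofFn fun _ _ => dX_mul_eq_zero (by simp) (by simp))).neg

theorem IsConst.sum_mul {x y : Fin 3 → FormAlg} (hx : ∀ i, IsConst (x i))
    (hy : ∀ i, IsConst (y i)) : IsConst (∑ i, x i * y i) :=
  IsConst.sum fun i => (hx i).mul (hy i)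

theorem isConst_thetaC_etaC : IsConst (∑ i, thetaC i * etaC i) :=
  IsConst.sum_mul isConst_thetaC isConst_etaC

theorem isConst_coefF (a b : Fin 2) : IsConst (coefF a b) :=
  isConst_ofFn fun _ _ => dX_mul_eq_zero (by simp) (by simp)

theorem isConst_coefW (a b : Fin 2) : IsConst (coefW a b) :=
  isConst_ofFn fun _ _ => dX_mul_eq_zero (dX_mul_eq_zero (by simp) (by simp)) (by simp)

theorem isConst_coefWHat (a b : Fin 2) : IsConst (coefWHat a b) :=
  (isConst_ofFn fun _ _ => dX_mul_eq_zero (dX_mul_eq_zero (by simp) (by simp)) (by simp)).neg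

theorem isConst_coefCR (A : Dir) (a b : Fin 2) : IsConst (coefCR A a b) := by
  cases A with
  | F => exact isConst_coefF a b
  | L => exact IsConst.zero
  | R => exact IsConst.zero
  | up i => exact (isConst_ofFn (by simp)).mul (isConst_theta i a)
  | dn i => exact (isConst_ofFn (by simp)).mul (isConst_eta b i)

theorem isConst_coefShift (A : Dir) : IsConst (coefShift A) := by
  cases A with
  | F => exact IsConst.zero
  | L => exact IsConst.sum_mul isConst_thetaT isConst_etaC
  | R => exact (IsConst.sum_mul isConst_thetaC isConst_etaT).neg
  | up i => exact (isConst_thetaT i).neg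
  | dn i => exact (isConst_etaT i).neg

theorem isConst_coefTw (A : Dir) (a b : Fin 2) : IsConst (coefTw A a b) := by
  cases A with
  | F => exact isConst_coefF a b
  | L => exact isConst_thetaC_etaC.mul (isConst_coefWHat a b)
  | R => exact isConst_thetaC_etaC.mul (isConst_coefW a b)
  | up i => exact IsConst.zero
  | dn i => exact IsConst.zero

theorem isConst_coefX (a b : Fin 2) : IsConst (coefX a b) :=
  ((IsConst.sum_mul isConst_thetaT isConst_etaC).mul (isConst_coefW a b)).add
    ((IsConst.sum_mul isConst_thetaC isConst_etaT).mul (isConst_coefWHat a b))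

theorem isSuperDer_derPart (A : Dir) : IsSuperDer A.par (derPart A) := by
  cases A with
  | F => exact IsSuperDer.zero _
  | L => change IsSuperDer 0 hatEL; rw [hatEL_eq]; exact isSuperDer_bodyOp isDer_derL
  | R => change IsSuperDer 0 hatER; rw [hatER_eq]; exact isSuperDer_bodyOp isDer_derR
  | up i => exact IsSuperDer.sum fun b => ((isSuperDer_oddDer _).mulBy_mul (hasPar_ofFn _)).congr rfl
  | dn i => exact IsSuperDer.sum fun b => ((isSuperDer_oddDer _).mulBy_mul (hasPar_ofFn _)).congr rfl

theorem commute_oddDer_pX (k : OddGen) (a b : Fin 2) : Commute (oddDer k) (pX a b) :=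
  oddDer_comm_bodyOp k _

theorem commute_bodyOp {D E : SmoothFn →ₗ[ℂ] SmoothFn} (h : CommFn D E) :
    Commute (bodyOp D) (bodyOp E) := by
  change _ * _ = _ * _
  rw [bodyOp_mul, bodyOp_mul]
  congr 1
  exact LinearMap.ext h

theorem commute_derPart_pX (A : Dir) (a b : Fin 2) : Commute (derPart A) (pX a b) := by
  cases A with
  | F => exact Commute.zero_left _
  | L => change Commute hatEL _; rw [hatEL_eq]; exact commute_bodyOp (commute_derL_dX a b)
  | R => change Commute hatER _; rw [hatER_eq]; exact commute_bodyOp (commute_derR_dX a b)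
  | up i =>
    exact Commute.sum_left _ _ _ fun c _ =>
      ((isConst_ofFn (by simp)).commute_mulBy a b).mul_left (commute_oddDer_pX _ a b)
  | dn i =>
    exact Commute.sum_left _ _ _ fun c _ =>
      ((isConst_ofFn (by simp)).commute_mulBy a b).mul_left (commute_oddDer_pX _ a b)

theorem isSplit_frameCR (A : Dir) : IsSplit A.par (frameCR A) (derPart A) (coefCR A) :=
  ⟨frameCR_eq A, isSuperDer_derPart A, commute_derPart_pX A, hasPar_coefCR A, isConst_coefCR A⟩

theorem isSplit_framePrime (A : Dir) : IsSplit A.par (framePrime A) (derPart A)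
    (fun a b => coefCR A a b + coefShift A * coefF a b) :=
  ⟨framePrime_eq A, isSuperDer_derPart A, commute_derPart_pX A,
    fun a b => (hasPar_coefCR A a b).add ((hasPar_coefShift A).mul_even (hasPar_coefF a b)),
    fun a b => (isConst_coefCR A a b).add ((isConst_coefShift A).mul (isConst_coefF a b))⟩

theorem isSplit_frameTw (A : Dir) : IsSplit A.par (frameTw A) (derPart A) (coefTw A) :=
  ⟨frameTw_eq A, isSuperDer_derPart A, commute_derPart_pX A, hasPar_coefTw A, isConst_coefTw A⟩

theorem isSplit_twistField : IsSplit 0 twistField 0 coefX :=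
  ⟨by rw [zero_add, twistField_eq], IsSuperDer.zero 0, fun _ _ => Commute.zero_left _,
    hasPar_coefX, isConst_coefX⟩

/-! ### Derivatives of the coefficients -/

theorem derPart_L : derPart .L = bodyOp derL := hatEL_eq

theorem derPart_R : derPart .R = bodyOp derR := hatER_eq

@[simp] theorem derPart_F_apply (w : FormAlg) : derPart .F w = 0 := rfl

@[simp] theorem derPart_L_ofFn (f : SmoothFn) : derPart .L (ofFn f) = ofFn (derL f) := by
  rw [derPart_L, bodyOp_ofFn]

@[simp] theorem derPart_R_ofFn (f : SmoothFn) : derPart .R (ofFn f) = ofFn (derR f) := by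
  rw [derPart_R, bodyOp_ofFn]

@[simp] theorem derPart_L_oddVar (k : OddGen) : derPart .L (oddVar k) = 0 := by
  rw [derPart_L]; exact bodyOp_oddVar isDer_derL.map_one k

@[simp] theorem derPart_R_oddVar (k : OddGen) : derPart .R (oddVar k) = 0 := by
  rw [derPart_R]; exact bodyOp_oddVar isDer_derR.map_one k

theorem derPart_up_apply (i : Fin 3) (w : FormAlg) :
    derPart (.up i) w = ∑ b, ofFn (lamUp b) * oddDer (.eta b i) w := by
  simp [derPart, mulBy_apply]

theorem derPart_dn_apply (i : Fin 3) (w : FormAlg) :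
    derPart (.dn i) w = ∑ a, ofFn (muUp a) * oddDer (.theta i a) w := by
  simp [derPart, mulBy_apply]

@[simp] theorem derPart_up_ofFn (i : Fin 3) (f : SmoothFn) : derPart (.up i) (ofFn f) = 0 := by
  simp [derPart_up_apply]

@[simp] theorem derPart_dn_ofFn (i : Fin 3) (f : SmoothFn) : derPart (.dn i) (ofFn f) = 0 := by
  simp [derPart_dn_apply]

@[simp] theorem derPart_L_eta (b : Fin 2) (i : Fin 3) : derPart .L (eta b i) = 0 :=
  derPart_L_oddVar _

@[simp] theorem derPart_R_eta (b : Fin 2) (i : Fin 3) : derPart .R (eta b i) = 0 :=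
  derPart_R_oddVar _

@[simp] theorem derPart_L_theta (i : Fin 3) (a : Fin 2) : derPart .L (theta i a) = 0 :=
  derPart_L_oddVar _

@[simp] theorem derPart_R_theta (i : Fin 3) (a : Fin 2) : derPart .R (theta i a) = 0 :=
  derPart_R_oddVar _

@[simp] theorem derPart_up_eta (i j : Fin 3) (b : Fin 2) :
    derPart (.up i) (eta b j) = if i = j then ofFn (lamUp b) else 0 := by
  fin_cases b <;> by_cases h : i = j <;> simp [derPart_up_apply, eta, oddDer_oddVar, h]

@[simp] theorem derPart_up_theta (i j : Fin 3) (a : Fin 2) : derPart (.up i) (theta j a) = 0 := by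
  simp [derPart_up_apply, theta, oddDer_oddVar]

@[simp] theorem derPart_dn_theta (i j : Fin 3) (a : Fin 2) :
    derPart (.dn i) (theta j a) = if i = j then ofFn (muUp a) else 0 := by
  fin_cases a <;> by_cases h : i = j <;> simp [derPart_dn_apply, theta, oddDer_oddVar, h]

@[simp] theorem derPart_dn_eta (i j : Fin 3) (b : Fin 2) : derPart (.dn i) (eta b j) = 0 := by
  simp [derPart_dn_apply, eta, oddDer_oddVar]

@[simp] theorem derPart_evenVar (A : Dir) (k : EvenGen) : derPart A (evenVar k) = 0 := by
  cases A with
  | F => rfl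
  | L => rw [derPart_L]; exact bodyOp_evenVar isDer_derL.map_one k
  | R => rw [derPart_R]; exact bodyOp_evenVar isDer_derR.map_one k
  | up i => simp [derPart_up_apply]
  | dn i => simp [derPart_dn_apply]

/-- The four contracted odd coordinates are sums of products with a function on the right, and only
the directions L and R differentiate that function. -/
theorem derPart_mul_ofFn (A : Dir) {x : FormAlg} (f : SmoothFn) :
    derPart A (x * ofFn f) = derPart A x * ofFn f + ofFn (match A with
      | .L => derL f
      | .R => derR f
      | _ => 0) * x := by
  rw [← commute_ofFn, (isSuperDer_derPart A).map_mul_even (hasPar_ofFn f), add_comm,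
    ← commute_ofFn f (derPart A x)]
  cases A <;> simp

/-! ### Spinor contractions and the contracted odd coordinates -/

theorem lam_mul_lamUp : lam 0 * lamUp 0 + lam 1 * lamUp 1 = 0 := by
  simp [lamUp, raiseFn]; ring

theorem mu_mul_muUp : mu 0 * muUp 0 + mu 1 * muUp 1 = 0 := by
  simp [muUp, raiseFn]; ring

/-- The minus sign is the antisymmetry of ε: the norm contracts `λ` with the raised `hat λ`, here
the roles are exchanged. The same sign in the definition of `etaT` makes its fermionic derivative
+1. -/
theorem lamHat_mul_lamUp : lamHat 0 * lamUp 0 + lamHat 1 * lamUp 1 = -normLam := by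
  simp [lamUp, raiseFn, normLam_eq]; ring

theorem muHat_mul_muUp : muHat 0 * muUp 0 + muHat 1 * muUp 1 = -normMu := by
  simp [muUp, raiseFn, normMu_eq]; ring

/-- The coefficients `λ_{α'}` are holomorphic, so L and R do not see them, and the fermionic
direction yields the contraction of `λ` with itself. -/
theorem derPart_etaC (A : Dir) (i : Fin 3) : derPart A (etaC i) = 0 := by
  rw [etaC, Fin.sum_univ_two, map_add, derPart_mul_ofFn, derPart_mul_ofFn]
  cases A with
  | up j =>
    by_cases h : j = i
    · simp only [derPart_up_eta, h, if_true, ofFn_zero, zero_mul, add_zero, ← ofFn_mul, ← ofFn_add]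
      rw [mul_comm, mul_comm (lamUp 1), lam_mul_lamUp, ofFn_zero]
    · simp [h]
  | _ => simp

theorem derPart_thetaC (A : Dir) (i : Fin 3) : derPart A (thetaC i) = 0 := by
  rw [thetaC, Fin.sum_univ_two, map_add, derPart_mul_ofFn, derPart_mul_ofFn]
  cases A with
  | dn j =>
    by_cases h : j = i
    · simp only [derPart_dn_theta, h, if_true, ofFn_zero, zero_mul, add_zero, ← ofFn_mul,
        ← ofFn_add]
      rw [mul_comm, mul_comm (muUp 1), mu_mul_muUp, ofFn_zero]
    · simp [h]
  | _ => simp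

/-- L replaces `hat λ / |λ|²` by `λ`, keeping the overall minus sign; the fermionic direction gives
the contraction of `hat λ` with `λ`, normalised to 1. -/
theorem derPart_etaT (A : Dir) (i : Fin 3) : derPart A (etaT i) = match A with
    | .L => -etaC i
    | .up j => if j = i then 1 else 0
    | _ => 0 := by
  rw [etaT, Fin.sum_univ_two, map_neg, map_add, derPart_mul_ofFn, derPart_mul_ofFn]
  cases A with
  | L =>
    simp only [derPart_L_eta, zero_mul, zero_add, isDer_derL _ _, derL_lamHat, derL_normLamInv,
      mul_zero, add_zero, etaC, Fin.sum_univ_two, ← commute_ofFn]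
    rw [mul_right_comm, normLam_mul_inv, one_mul, mul_right_comm, normLam_mul_inv, one_mul]
  | up j =>
    by_cases h : j = i
    · simp only [derPart_up_eta, h, if_true, ofFn_zero, zero_mul, add_zero, ← ofFn_mul, ← ofFn_add]
      rw [← ofFn_neg, ← ofFn_one]
      congr 1
      linear_combination (-normLamInv) * lamHat_mul_lamUp + normLam_mul_inv
    · simp [h]
  | _ => simp [isDer_derR _ _]

theorem derPart_thetaT (A : Dir) (i : Fin 3) : derPart A (thetaT i) = match A with
    | .R => -thetaC i
    | .dn j => if j = i then 1 else 0
    | _ => 0 := by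
  rw [thetaT, Fin.sum_univ_two, map_neg, map_add, derPart_mul_ofFn, derPart_mul_ofFn]
  cases A with
  | R =>
    simp only [derPart_R_theta, zero_mul, zero_add, isDer_derR _ _, derR_muHat, derR_normMuInv,
      mul_zero, add_zero, thetaC, Fin.sum_univ_two, ← commute_ofFn]
    rw [mul_right_comm, normMu_mul_inv, one_mul, mul_right_comm, normMu_mul_inv, one_mul]
  | dn j =>
    by_cases h : j = i
    · simp only [derPart_dn_theta, h, if_true, ofFn_zero, zero_mul, add_zero, ← ofFn_mul,
        ← ofFn_add]
      rw [← ofFn_neg, ← ofFn_one]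
      congr 1
      linear_combination (-normMuInv) * muHat_mul_muUp + normMu_mul_inv
    · simp [h]
  | _ => simp [isDer_derL _ _]

theorem derPart_sum_mul (A : Dir) {x y : Fin 3 → FormAlg} (hx : ∀ i, HasPar 1 (x i)) :
    derPart A (∑ i, x i * y i) =
      ∑ i, (derPart A (x i) * y i + (-1 : ℂ) ^ A.par • (x i * derPart A (y i))) := by
  rw [map_sum]
  refine Finset.sum_congr rfl fun i _ => ?_
  rw [isSuperDer_derPart A, (hx i).gradePow, mul_one, smul_mul_assoc]

/-- The scalar that enters the twisted brackets is constant along the whole distribution. This keeps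
the twisted coefficients easy to differentiate and makes the twisted curvature closed. -/
theorem derPart_thetaC_etaC (A : Dir) : derPart A (∑ i, thetaC i * etaC i) = 0 := by
  simp [derPart_sum_mul A hasPar_thetaC, derPart_thetaC, derPart_etaC]

theorem derPart_thetaT_etaC (A : Dir) : derPart A (∑ i, thetaT i * etaC i) = match A with
    | .R => -∑ i, thetaC i * etaC i
    | .dn j => etaC j
    | _ => 0 := by
  rw [derPart_sum_mul A hasPar_thetaT]
  cases A <;> simp [derPart_thetaT, derPart_etaC]

theorem derPart_thetaC_etaT (A : Dir) : derPart A (∑ i, thetaC i * etaT i) = match A with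
    | .L => -∑ i, thetaC i * etaC i
    | .up j => -thetaC j
    | _ => 0 := by
  rw [derPart_sum_mul A hasPar_thetaC]
  cases A <;> simp [derPart_etaT, derPart_thetaC, Dir.par]

theorem derPart_ofFn (A : Dir) (f : SmoothFn) : derPart A (ofFn f) = ofFn (match A with
      | .L => derL f
      | .R => derR f
      | _ => 0) := by
  cases A <;> simp

@[simp] theorem derL_lamUp (a : Fin 2) : derL (lamUp a) = 0 := by
  fin_cases a <;> simp [lamUp, raiseFn]

@[simp] theorem derL_muUp (a : Fin 2) : derL (muUp a) = 0 := by
  fin_cases a <;> simp [muUp, raiseFn]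

@[simp] theorem derL_muHatUp (a : Fin 2) : derL (muHatUp a) = 0 := by
  fin_cases a <;> simp [muHatUp, raiseFn]

@[simp] theorem derL_lamHatUp (a : Fin 2) : derL (lamHatUp a) = normLam * lamUp a := by
  fin_cases a <;> simp [lamUp, lamHatUp, raiseFn]
  ring

@[simp] theorem derR_lamUp (a : Fin 2) : derR (lamUp a) = 0 := by
  fin_cases a <;> simp [lamUp, raiseFn]

@[simp] theorem derR_muUp (a : Fin 2) : derR (muUp a) = 0 := by
  fin_cases a <;> simp [muUp, raiseFn]

@[simp] theorem derR_lamHatUp (a : Fin 2) : derR (lamHatUp a) = 0 := by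
  fin_cases a <;> simp [lamHatUp, raiseFn]

@[simp] theorem derR_muHatUp (a : Fin 2) : derR (muHatUp a) = normMu * muUp a := by
  fin_cases a <;> simp [muUp, muHatUp, raiseFn]
  ring

theorem derPart_coefF (A : Dir) (a b : Fin 2) : derPart A (coefF a b) = 0 := by
  rw [coefF, derPart_ofFn]
  cases A <;> simp [isDer_derL _ _, isDer_derR _ _]

/-- L moves `hat λ` to `|λ|² λ`, and the norm cancels against its inverse: in terms of fields,
`[Ê_L, E_W] = Ê_F`. The analogue for R carries the sign in the definition of `E_Ŵ`. -/
theorem derPart_coefW (A : Dir) (a b : Fin 2) : derPart A (coefW a b) = match A with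
    | .L => coefF a b
    | _ => 0 := by
  rw [coefW, derPart_ofFn]
  cases A with
  | L =>
    simp only [isDer_derL _ _, coefF, derL_muUp, derL_lamHatUp, derL_normLamInv]
    congr 1
    linear_combination muUp a * lamUp b * normLam_mul_inv
  | _ => simp [isDer_derR _ _]

theorem derPart_coefWHat (A : Dir) (a b : Fin 2) : derPart A (coefWHat a b) = match A with
    | .R => -coefF a b
    | _ => 0 := by
  rw [coefWHat, map_neg, derPart_ofFn]
  cases A with
  | R =>
    simp only [isDer_derR _ _, coefF, derR_muHatUp, derR_lamUp, derR_normMuInv]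
    congr 2
    linear_combination muUp a * lamUp b * normMu_mul_inv
  | _ => simp [isDer_derL _ _]

/-- Completeness of the basis `μ, hat μ` of spinors: the determinant of the two, divided by the
norm, is 1, and the raised spinors provide the dual basis. The contracted coordinates are the
components in this basis. -/
theorem theta_decomp (i : Fin 3) (a : Fin 2) : theta i a =
    thetaT i * ofFn (muUp a) + thetaC i * ofFn (muHatUp a * normMuInv) := by
  have h : thetaT i * ofFn (muUp a) + thetaC i * ofFn (muHatUp a * normMuInv) =
      theta i 0 * ofFn (mu 0 * (muHatUp a * normMuInv) - muHat 0 * normMuInv * muUp a) +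
      theta i 1 * ofFn (mu 1 * (muHatUp a * normMuInv) - muHat 1 * normMuInv * muUp a) := by
    simp only [thetaT, thetaC, Fin.sum_univ_two, sub_eq_add_neg, ofFn_add, ofFn_neg, ofFn_mul,
      mul_add, add_mul, neg_mul, mul_neg, mul_assoc, neg_add]
    abel
  have h2 := normMu_mul_inv
  rw [normMu_eq] at h2
  rw [h]
  fin_cases a
  · have e1 : mu 0 * (muHatUp 0 * normMuInv) - muHat 0 * normMuInv * muUp 0 = 1 := by
      simp only [muUp, muHatUp, raiseFn, Matrix.cons_val_zero]; linear_combination h2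
    have e2 : mu 1 * (muHatUp 0 * normMuInv) - muHat 1 * normMuInv * muUp 0 = 0 := by
      simp only [muUp, muHatUp, raiseFn, Matrix.cons_val_zero]; ring
    simp only [Fin.zero_eta, e1, e2, ofFn_one, ofFn_zero, mul_one, mul_zero, add_zero]
  · have e1 : mu 0 * (muHatUp 1 * normMuInv) - muHat 0 * normMuInv * muUp 1 = 0 := by
      simp only [muUp, muHatUp, raiseFn, Matrix.cons_val_one, Matrix.cons_val_fin_one]; ring
    have e2 : mu 1 * (muHatUp 1 * normMuInv) - muHat 1 * normMuInv * muUp 1 = 1 := by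
      simp only [muUp, muHatUp, raiseFn, Matrix.cons_val_one, Matrix.cons_val_fin_one]
      linear_combination h2
    simp only [Fin.mk_one, e1, e2, ofFn_one, ofFn_zero, mul_one, mul_zero, zero_add]

theorem eta_decomp (b : Fin 2) (i : Fin 3) : eta b i =
    etaT i * ofFn (lamUp b) + etaC i * ofFn (lamHatUp b * normLamInv) := by
  have h : etaT i * ofFn (lamUp b) + etaC i * ofFn (lamHatUp b * normLamInv) =
      eta 0 i * ofFn (lam 0 * (lamHatUp b * normLamInv) - lamHat 0 * normLamInv * lamUp b) +
      eta 1 i * ofFn (lam 1 * (lamHatUp b * normLamInv) - lamHat 1 * normLamInv * lamUp b) := by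
    simp only [etaT, etaC, Fin.sum_univ_two, sub_eq_add_neg, ofFn_add, ofFn_neg, ofFn_mul,
      mul_add, add_mul, neg_mul, mul_neg, mul_assoc, neg_add]
    abel
  have h2 := normLam_mul_inv
  rw [normLam_eq] at h2
  rw [h]
  fin_cases b
  · have e1 : lam 0 * (lamHatUp 0 * normLamInv) - lamHat 0 * normLamInv * lamUp 0 = 1 := by
      simp only [lamUp, lamHatUp, raiseFn, Matrix.cons_val_zero]; linear_combination h2
    have e2 : lam 1 * (lamHatUp 0 * normLamInv) - lamHat 1 * normLamInv * lamUp 0 = 0 := by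
      simp only [lamUp, lamHatUp, raiseFn, Matrix.cons_val_zero]; ring
    simp only [Fin.zero_eta, e1, e2, ofFn_one, ofFn_zero, mul_one, mul_zero, add_zero]
  · have e1 : lam 0 * (lamHatUp 1 * normLamInv) - lamHat 0 * normLamInv * lamUp 1 = 0 := by
      simp only [lamUp, lamHatUp, raiseFn, Matrix.cons_val_one, Matrix.cons_val_fin_one]; ring
    have e2 : lam 1 * (lamHatUp 1 * normLamInv) - lamHat 1 * normLamInv * lamUp 1 = 1 := by
      simp only [lamUp, lamHatUp, raiseFn, Matrix.cons_val_one, Matrix.cons_val_fin_one]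
      linear_combination h2
    simp only [Fin.mk_one, e1, e2, ofFn_one, ofFn_zero, mul_one, mul_zero, zero_add]

theorem derPart_coefX (A : Dir) (a b : Fin 2) : derPart A (coefX a b) = match A with
    | .L => (∑ i, thetaT i * etaC i) * coefF a b - (∑ i, thetaC i * etaC i) * coefWHat a b
    | .R => -((∑ i, thetaC i * etaC i) * coefW a b) - (∑ i, thetaC i * etaT i) * coefF a b
    | .up i => -(thetaC i * coefWHat a b)
    | .dn i => etaC i * coefW a b
    | .F => 0 := by
  rw [coefX, map_add,
    (isSuperDer_derPart A).map_mul_even (HasPar.sum_odd_mul_odd hasPar_thetaT hasPar_etaC),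
    (isSuperDer_derPart A).map_mul_even (HasPar.sum_odd_mul_odd hasPar_thetaC hasPar_etaT),
    derPart_thetaT_etaC, derPart_thetaC_etaT, derPart_coefW, derPart_coefWHat]
  cases A <;> simp [sub_eq_add_neg]

/-- The heart of the conjugation formula: subtracting `D_A(coefX)` adds the bracket with the twist
exponent to `Ê'_A`. For L and R the multiples of `Ê_F` cancel and those of `E_Ŵ`, `E_W` remain. For
the fermionic directions the completeness relation splits the coefficient of the CR field into the
two terms that the shift and the bracket remove. -/
theorem coefTw_eq (A : Dir) (a b : Fin 2) :
    coefTw A a b = coefCR A a b + coefShift A * coefF a b - derPart A (coefX a b) := by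
  rw [derPart_coefX]
  cases A with
  | F => simp [coefTw, coefCR, coefShift]
  | L => simp [coefTw, coefCR, coefShift]
  | R => simp [coefTw, coefCR, coefShift]; abel
  | up i =>
    simp only [coefTw, coefCR, coefShift, coefF, coefWHat]
    rw [theta_decomp i a]
    simp only [commute_ofFn (lamUp b), add_mul, mul_assoc, ← ofFn_mul, neg_mul, mul_neg,
      mul_right_comm (muHatUp a), sub_neg_eq_add]
    abel
  | dn i =>
    simp only [coefTw, coefCR, coefShift, coefF, coefW]
    rw [eta_decomp b i]
    simp only [commute_ofFn (muUp a), add_mul, mul_assoc, ← ofFn_mul, neg_mul]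
    rw [mul_comm (lamUp b), show lamHatUp b * (normLamInv * muUp a) =
      muUp a * (lamHatUp b * normLamInv) by ring]
    abel

/-! ### The supercommutators -/

theorem ofFn_oddDer_anticomm (f g : SmoothFn) (j k : OddGen) :
    mulBy (ofFn f) * oddDer j * (mulBy (ofFn g) * oddDer k) =
      -(mulBy (ofFn g) * oddDer k * (mulBy (ofFn f) * oddDer j)) := by
  have h (k : OddGen) (f : SmoothFn) : oddDer k * mulBy (ofFn f) = mulBy (ofFn f) * oddDer k := by
    rw [(isSuperDer_oddDer k).mul_mulBy_of_hasPar (hasPar_ofFn f), oddDer_ofFn, mulBy_zero]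
    simp
  calc _ = mulBy (ofFn f) * (oddDer j * mulBy (ofFn g)) * oddDer k := by simp only [mul_assoc]
    _ = mulBy (ofFn f * ofFn g) * (oddDer j * oddDer k) := by
      rw [h, ← mulBy_mul_mulBy]; simp only [mul_assoc]
    _ = -(mulBy (ofFn g) * (mulBy (ofFn f) * oddDer k) * oddDer j) := by
      rw [oddDer_anticomm, commute_ofFn, op_mul_neg, ← mulBy_mul_mulBy]; simp only [mul_assoc]
    _ = _ := by rw [← h]; simp only [mul_assoc]

theorem commute_bodyOp_ofFn_oddDer {D : SmoothFn →ₗ[ℂ] SmoothFn} (hD : IsDer D) {f : SmoothFn}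
    (h : D f = 0) (k : OddGen) : Commute (bodyOp D) (mulBy (ofFn f) * oddDer k) := by
  have h1 : Commute (bodyOp D) (mulBy (ofFn f)) := by
    change _ * _ = _ * _
    rw [(isSuperDer_bodyOp hD).mul_mulBy, bodyOp_ofFn, h, ofFn_zero, mulBy_zero, zero_add,
      gradePow_zero]
  exact h1.mul_right (oddDer_comm_bodyOp k D).symm

/-- L and R act on different spinors, the coefficients `λ^{α'}` and `μ^α` are constant for both, and
the derivatives along odd coordinates anticommute. The brackets of the frames therefore come from
the translations alone. -/
theorem derPart_superComm (A B : Dir) :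
    derPart A * derPart B = (-1 : ℂ) ^ (A.par * B.par) • (derPart B * derPart A) := by
  have hL (k : Fin 2 → OddGen) (f : Fin 2 → SmoothFn) (hf : ∀ b, derL (f b) = 0) :
      Commute (derPart .L) (∑ b, mulBy (ofFn (f b)) * oddDer (k b)) :=
    derPart_L ▸ Commute.sum_right _ _ _ fun b _ => commute_bodyOp_ofFn_oddDer isDer_derL (hf b) _
  have hR (k : Fin 2 → OddGen) (f : Fin 2 → SmoothFn) (hf : ∀ b, derR (f b) = 0) :
      Commute (derPart .R) (∑ b, mulBy (ofFn (f b)) * oddDer (k b)) :=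
    derPart_R ▸ Commute.sum_right _ _ _ fun b _ => commute_bodyOp_ofFn_oddDer isDer_derR (hf b) _
  have hLR : Commute (derPart .L) (derPart .R) := by
    rw [derPart_L, derPart_R]; exact commute_bodyOp commute_derL_derR
  have hodd (k l : Fin 2 → OddGen) (f g : Fin 2 → SmoothFn) :
      (∑ b, mulBy (ofFn (f b)) * oddDer (k b)) * (∑ b, mulBy (ofFn (g b)) * oddDer (l b)) =
      (-1 : ℂ) • ((∑ b, mulBy (ofFn (g b)) * oddDer (l b)) *
        (∑ b, mulBy (ofFn (f b)) * oddDer (k b))) := by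
    simp only [Finset.sum_mul_sum, ofFn_oddDer_anticomm (f _) _ (k _) _]
    rw [Finset.sum_comm, Finset.smul_sum]
    simp only [Finset.smul_sum, neg_one_smul]
  have h0 (A : Dir) : derPart .F * derPart A = 0 := zero_mul _
  have h0' (A : Dir) : derPart A * derPart .F = 0 := mul_zero _
  cases A <;> cases B <;>
    simp only [Dir.par, mul_zero, mul_one, pow_zero, pow_one, one_smul, h0, h0', smul_zero]
  · exact hLR.eq
  · exact (hL _ _ derL_lamUp).eq
  · exact (hL _ _ derL_muUp).eq
  · exact hLR.eq.symm
  · exact (hR _ _ derR_lamUp).eq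
  · exact (hR _ _ derR_muUp).eq
  · exact (hL _ _ derL_lamUp).eq.symm
  · exact (hR _ _ derR_lamUp).eq.symm
  · exact hodd _ _ _ _
  · exact hodd _ _ _ _
  · exact (hL _ _ derL_muUp).eq.symm
  · exact (hR _ _ derR_muUp).eq.symm
  · exact hodd _ _ _ _
  · exact hodd _ _ _ _

theorem superComm_eq_transOp {E : Dir → Op} {c : Dir → Fin 2 → Fin 2 → FormAlg}
    (h : ∀ A, IsSplit A.par (E A) (derPart A) (c A)) (A B : Dir) : superComm E A B =
      transOp fun a b => derPart A (c B a b) - (-1 : ℂ) ^ (A.par * B.par) • derPart B (c A a b) :=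
  (h A).superComm (h B) (derPart_superComm A B)

theorem sum_dir {M : Type*} [AddCommMonoid M] (f : Dir → M) :
    ∑ A, f A = f .F + f .L + f .R + ∑ i, f (.up i) + ∑ i, f (.dn i) := by
  have h : (Finset.univ : Finset Dir) = {.F, .L, .R} ∪
      (Finset.univ.image Dir.up ∪ Finset.univ.image Dir.dn) := by
    ext A; cases A <;> simp
  rw [h, Finset.sum_union, Finset.sum_union, Finset.sum_image, Finset.sum_image]
  · rw [Finset.sum_insert (by simp), Finset.sum_insert (by simp), Finset.sum_singleton]
    abel
  · intro i _ j _ h; exact Dir.dn.inj h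
  · intro i _ j _ h; exact Dir.up.inj h
  · rw [Finset.disjoint_left]; intro A; cases A <;> simp
  · rw [Finset.disjoint_left]; intro A; cases A <;> simp

theorem sum_struct {C : Dir → Dir → Dir → FormAlg} (h : ∀ A B D, D ≠ .F → C A B D = 0)
    (A B : Dir) (E : Dir → Op) : ∑ D, mulBy (C A B D) * E D = mulBy (C A B .F) * E .F := by
  rw [Finset.sum_eq_single Dir.F]
  · intro D _ hD; rw [h A B D hD, mulBy_zero, zero_mul]
  · intro h; exact absurd (Finset.mem_univ _) h

theorem structCR_of_ne (A B D : Dir) (hD : D ≠ .F) : structCR A B D = 0 := by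
  unfold structCR
  split <;> first | rfl | exact absurd rfl hD

theorem structTw_of_ne (A B D : Dir) (hD : D ≠ .F) : structTw A B D = 0 := by
  unfold structTw
  split <;> first | rfl | exact absurd rfl hD

theorem derPart_coefCR (A B : Dir) (a b : Fin 2) : derPart A (coefCR B a b) = match A, B with
    | .up i, .dn j => if i = j then coefF a b else 0
    | .dn i, .up j => if i = j then coefF a b else 0
    | _, _ => 0 := by
  cases B with
  | F => cases A <;> simp [coefCR, derPart_coefF]
  | L => cases A <;> simp [coefCR]
  | R => cases A <;> simp [coefCR]
  | up j =>
    simp only [coefCR, commute_ofFn, derPart_mul_ofFn]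
    cases A <;> simp [coefF, ofFn_mul]
  | dn j =>
    simp only [coefCR, commute_ofFn, derPart_mul_ofFn]
    cases A <;> simp [coefF, ofFn_mul, commute_ofFn (muUp a) (ofFn (lamUp b))]

/-- For a pair of fermionic fields the sign of the exchange is plus, so both mixed terms contribute
the coefficients of `Ê_F`; this is the factor 2. -/
theorem superComm_frameCR (A B : Dir) :
    superComm frameCR A B = ∑ D, mulBy (structCR A B D) * frameCR D := by
  rw [sum_struct structCR_of_ne, superComm_eq_transOp isSplit_frameCR]
  change _ = _ * transOp coefF
  rw [mulBy_mul_transOp]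
  congr 1
  funext a b
  rw [derPart_coefCR, derPart_coefCR]
  cases A <;> cases B <;> simp [structCR, Dir.par]
  · rename_i i j
    by_cases h : i = j
    · subst h; simp [two_mul]
    · simp [h, Ne.symm h]
  · rename_i i j
    by_cases h : i = j
    · subst h; simp [two_mul]
    · simp [h, Ne.symm h]

theorem derPart_coefTw (A B : Dir) (a b : Fin 2) : derPart A (coefTw B a b) = match A, B with
    | .L, .R => (∑ i, thetaC i * etaC i) * coefF a b
    | .R, .L => -((∑ i, thetaC i * etaC i) * coefF a b)
    | _, _ => 0 := by
  cases B with
  | F => cases A <;> simp [coefTw, derPart_coefF]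
  | L =>
    simp only [coefTw, (isSuperDer_derPart A).map_mul_even
      (HasPar.sum_odd_mul_odd hasPar_thetaC hasPar_etaC), derPart_thetaC_etaC, derPart_coefWHat]
    cases A <;> simp
  | R =>
    simp only [coefTw, (isSuperDer_derPart A).map_mul_even
      (HasPar.sum_odd_mul_odd hasPar_thetaC hasPar_etaC), derPart_thetaC_etaC, derPart_coefW]
    cases A <;> simp
  | up j => cases A <;> simp [coefTw]
  | dn j => cases A <;> simp [coefTw]

/-- L acts on `E_W` and R on `E_Ŵ` with opposite signs, so antisymmetrisation adds the two
contributions, again giving a factor 2. In the fermionic directions there is no translation left and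
every bracket vanishes. -/
theorem superComm_frameTw (A B : Dir) :
    superComm frameTw A B = ∑ D, mulBy (structTw A B D) * frameTw D := by
  rw [sum_struct structTw_of_ne, superComm_eq_transOp isSplit_frameTw]
  change _ = _ * transOp coefF
  rw [mulBy_mul_transOp]
  congr 1
  funext a b
  rw [derPart_coefTw, derPart_coefTw]
  cases A <;> cases B <;> simp [structTw, Dir.par, two_mul, add_mul]
  abel

/-! ### The twist -/

theorem mul_pow_comm_sq_zero {x y : FormAlg} (hx : HasPar 1 x) (hy : HasPar 1 y) :
    (x * y) ^ 2 = 0 := by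
  rw [pow_two, mul_assoc, ← mul_assoc y, hy.mul_comm hx, smul_mul_assoc, mul_smul_comm,
    mul_assoc x y y, ← mul_assoc x x, hx.mul_self_odd, zero_mul, smul_zero]

theorem isNilpotent_sum_odd_mul_odd {x y : Fin 3 → FormAlg} (hx : ∀ i, HasPar 1 (x i))
    (hy : ∀ i, HasPar 1 (y i)) : IsNilpotent (∑ i, x i * y i) :=
  Commute.isNilpotent_sum (fun i _ => ⟨2, mul_pow_comm_sq_zero (hx i) (hy i)⟩)
    fun i _ _ _ => ((hx i).odd_mul_odd (hy i)).central _

/-- A product of two odd elements squares to zero and is central, so finite sums of such products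
are nilpotent and remain so after multiplication by a function. -/
theorem isNilpotent_coefX (a b : Fin 2) : IsNilpotent (coefX a b) := by
  have h1 := HasPar.sum_odd_mul_odd hasPar_thetaT hasPar_etaC
  have h2 := HasPar.sum_odd_mul_odd hasPar_thetaC hasPar_etaT
  refine Commute.isNilpotent_add ((h1.mul_even (hasPar_coefW a b)).central _) ?_ ?_
  · exact Commute.isNilpotent_mul_right (h1.central _)
      (isNilpotent_sum_odd_mul_odd hasPar_thetaT hasPar_etaC)
  · exact Commute.isNilpotent_mul_right (h2.central _)
      (isNilpotent_sum_odd_mul_odd hasPar_thetaC hasPar_etaT)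

theorem mulBy_pow (x : FormAlg) (n : ℕ) : mulBy x ^ n = mulBy (x ^ n) := by
  induction n with
  | zero => rw [pow_zero, pow_zero, mulBy_one]
  | succ n ih => rw [pow_succ, pow_succ, ih, mulBy_mul_mulBy]

theorem commute_mulBy_mul_pX {x y : FormAlg} (hx : IsConst x) (hy : IsConst y) (h : HasPar 0 x)
    (a b c d : Fin 2) : Commute (mulBy x * pX a b) (mulBy y * pX c d) := by
  have h1 : Commute (mulBy x) (mulBy y) := by
    change _ * _ = _ * _
    rw [mulBy_mul_mulBy, mulBy_mul_mulBy, h.central]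
  exact (h1.mul_right (hx.commute_mulBy c d)).mul_left
    ((hy.commute_mulBy a b).symm.mul_right (commute_pX a b c d))

/-- The exponent is a finite sum of commuting terms, each a nilpotent multiplication times an
x-derivative that commutes with it. The x-derivatives themselves are not nilpotent. -/
theorem isNilpotent_twistField : IsNilpotent twistField := by
  rw [twistField_eq, transOp, ← Finset.sum_product']
  refine Commute.isNilpotent_sum (fun p _ => ?_) fun p q _ _ =>
    commute_mulBy_mul_pX (isConst_coefX _ _) (isConst_coefX _ _) (hasPar_coefX _ _) _ _ _ _
  refine Commute.isNilpotent_mul_right ((isConst_coefX p.1 p.2).commute_mulBy p.1 p.2) ?_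
  obtain ⟨n, hn⟩ := isNilpotent_coefX p.1 p.2
  exact ⟨n, by rw [mulBy_pow, hn, mulBy_zero]⟩

theorem isSuperDer_twistField : IsSuperDer 0 twistField := isSplit_twistField.isSuperDer

/-- When the commutator `Y` of `X` with `D` commutes with `X`, the adjoint series `D + [X, D] + ...`
ends at its second term. -/
theorem exp_mul_eq {A : Type*} [Ring A] [Module ℚ A] {X D Y : A} (hX : IsNilpotent X)
    (h : X * D = D * X + Y) (hY : X * Y = Y * X) :
    IsNilpotent.exp X * D = (D + Y) * IsNilpotent.exp X := by
  have hpow (n : ℕ) : X ^ (n + 1) * D = D * X ^ (n + 1) + (n + 1 : ℚ) • (Y * X ^ n) := by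
    induction n with
    | zero => simp [h]
    | succ n ih =>
      have hYn : X * X ^ (n + 1) = X ^ (n + 1) * X := (pow_succ' X _).symm.trans (pow_succ X _)
      rw [pow_succ' X (n + 1), mul_assoc, ih, mul_add, ← mul_assoc, h, add_mul, mul_smul_comm,
        ← mul_assoc X Y, hY, mul_assoc Y X, ← pow_succ', mul_assoc D]
      push_cast
      rw [add_smul (n + 1 : ℚ) 1, one_smul]
      abel
  obtain ⟨k, hk⟩ := hX
  -- In `hpow` the power `n + 1` of `X` pairs with `Y * X ^ n`. The sums with `D` thus run one term
  -- longer than the one with `Y`, and splitting off the zeroth term aligns the ranges.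
  have hk' : X ^ (k + 1) = 0 := by rw [pow_succ, hk, zero_mul]
  have e1 : IsNilpotent.exp X * D = ∑ i ∈ Finset.range (k + 1), (i.factorial : ℚ)⁻¹ • (X ^ i * D) := by
    rw [IsNilpotent.exp_eq_sum hk', Finset.sum_mul]
    simp only [smul_mul_assoc]
  have e2 : D * IsNilpotent.exp X = ∑ i ∈ Finset.range (k + 1), (i.factorial : ℚ)⁻¹ • (D * X ^ i) := by
    rw [IsNilpotent.exp_eq_sum hk', Finset.mul_sum]
    simp only [mul_smul_comm]
  have e3 : Y * IsNilpotent.exp X = ∑ i ∈ Finset.range k, (i.factorial : ℚ)⁻¹ • (Y * X ^ i) := by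
    rw [IsNilpotent.exp_eq_sum hk, Finset.mul_sum]
    simp only [mul_smul_comm]
  rw [add_mul, e1, e2, e3, Finset.sum_range_succ', Finset.sum_range_succ', add_right_comm,
    ← Finset.sum_add_distrib]
  simp only [pow_zero, one_mul, mul_one]
  congr 1
  refine Finset.sum_congr rfl fun i _ => ?_
  rw [hpow, smul_add, smul_smul]
  congr 2
  rw [Nat.factorial_succ]
  push_cast
  have h1 : (i.factorial : ℚ) ≠ 0 := by positivity
  have h2 : (i + 1 : ℚ) ≠ 0 := by positivity
  field_simp

theorem twist_mul_twistInv : twist * twistInv = 1 :=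
  IsNilpotent.exp_mul_exp_neg_self isNilpotent_twistField

theorem twistInv_mul_twist : twistInv * twist = 1 :=
  IsNilpotent.exp_neg_mul_exp_self isNilpotent_twistField

/-- The exponent splits with zero derivation part, so its bracket with `Ê'_A` is the translation by
`-D_A(coefX)`, which `coefTw_eq` identifies with the difference of the frames. -/
theorem twistField_mul_framePrime (A : Dir) :
    twistField * framePrime A = framePrime A * twistField + (frameTw A - framePrime A) := by
  have h := isSplit_twistField.superComm (isSplit_framePrime A) (by simp)
  rw [zero_mul, pow_zero, one_smul, sub_eq_iff_eq_add] at h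
  rw [h, add_comm, frameTw_eq, framePrime_eq, add_sub_add_left_eq_sub, ← transOp_sub]
  congr 2
  funext a b
  rw [coefTw_eq]
  simp

/-- The two frames share `derPart`, so their difference is a translation with x-independent
coefficients, as is the exponent. -/
theorem commute_twistField_sub (A : Dir) :
    twistField * (frameTw A - framePrime A) = (frameTw A - framePrime A) * twistField := by
  have h := transOp_mul_transOp hasPar_coefX isConst_coefX
    (d := fun a b => coefTw A a b - (coefCR A a b + coefShift A * coefF a b)) (m := A.par)
    (fun a b => (hasPar_coefTw A a b).sub ((isSplit_framePrime A).par a b))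
    (fun a b => (isConst_coefTw A a b).sub ((isSplit_framePrime A).const a b))
  rw [zero_mul, pow_zero, one_smul] at h
  rw [frameTw_eq, framePrime_eq, add_sub_add_left_eq_sub, ← transOp_sub, twistField_eq]
  exact h

theorem twist_mul_framePrime (A : Dir) : twist * framePrime A = frameTw A * twist := by
  have h := exp_mul_eq isNilpotent_twistField (twistField_mul_framePrime A)
    (commute_twistField_sub A)
  rwa [add_sub_cancel] at h

theorem frameTw_eq_conj (A : Dir) : frameTw A = twist * framePrime A * twistInv := by
  rw [twist_mul_framePrime, mul_assoc, twist_mul_twistInv, mul_one]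

theorem framePrime_eq_conj (A : Dir) : framePrime A = twistInv * frameTw A * twist := by
  rw [mul_assoc, ← twist_mul_framePrime, ← mul_assoc, twistInv_mul_twist, one_mul]

theorem twistInv_mul_frameTw (A : Dir) : twistInv * frameTw A = framePrime A * twistInv := by
  rw [frameTw_eq_conj, ← mul_assoc, ← mul_assoc, twistInv_mul_twist, one_mul]

theorem exp_mul_comm {A : Type*} [Ring A] [Module ℚ A] {X D : A} (hX : IsNilpotent X)
    (h : X * D = D * X) : IsNilpotent.exp X * D = D * IsNilpotent.exp X := by
  have := exp_mul_eq hX (D := D) (Y := 0) (by rw [h, add_zero]) (by simp)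
  rwa [add_zero] at this

theorem twistField_of_isConst {x : FormAlg} (hx : IsConst x) : twistField x = 0 := by
  rw [twistField_eq, transOp_apply_of_isConst _ hx]

/-- A translation annihilates x-independent elements. Hence g commutes with multiplication by
structure functions and by coframe elements. -/
theorem twistField_mul_mulBy {x : FormAlg} (hx : IsConst x) :
    twistField * mulBy x = mulBy x * twistField := by
  rw [isSuperDer_twistField.mul_mulBy, twistField_of_isConst hx, mulBy_zero, zero_add,
    gradePow_zero]

theorem twist_mul_mulBy {x : FormAlg} (hx : IsConst x) : twist * mulBy x = mulBy x * twist :=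
  exp_mul_comm isNilpotent_twistField (twistField_mul_mulBy hx)

theorem isConst_ofNat_two : IsConst 2 := by
  have h : (2 : FormAlg) = (2 : ℂ) • 1 := by rw [two_smul, one_add_one_eq_two]
  intro a b
  rw [h, map_smul, (isSuperDer_pX a b).map_one, smul_zero]

theorem isConst_structTw (A B D : Dir) : IsConst (structTw A B D) := by
  unfold structTw
  split
  · exact isConst_ofNat_two.mul isConst_thetaC_etaC
  · exact (isConst_ofNat_two.mul isConst_thetaC_etaC).neg
  · exact IsConst.zero

theorem twist_mul_mulBy_structTw (A B D : Dir) :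
    twist * mulBy (structTw A B D) = mulBy (structTw A B D) * twist :=
  twist_mul_mulBy (isConst_structTw A B D)

/-- No new computation is needed: the brackets are those of the twisted frame conjugated by g, and
the structure functions pass through g. -/
theorem superComm_framePrime (A B : Dir) :
    superComm framePrime A B = ∑ D, mulBy (structTw A B D) * framePrime D := by
  have h : superComm framePrime A B = twistInv * superComm frameTw A B * twist := by
    have key (A B : Dir) : framePrime A * framePrime B =
        twistInv * (frameTw A * frameTw B) * twist := by
      rw [framePrime_eq_conj A, framePrime_eq_conj B]
      calc _ = twistInv * frameTw A * (twist * twistInv) * frameTw B * twist := by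
            simp only [mul_assoc]
        _ = _ := by rw [twist_mul_twistInv, mul_one]; simp only [mul_assoc]
    rw [superComm, superComm, key, key, mul_sub, sub_mul, mul_smul_comm, smul_mul_assoc]
  rw [h, superComm_frameTw, Finset.mul_sum, Finset.sum_mul]
  refine Finset.sum_congr rfl fun D _ => ?_
  have hc : twistInv * mulBy (structTw A B D) = mulBy (structTw A B D) * twistInv := by
    calc _ = twistInv * (mulBy (structTw A B D) * twist) * twistInv := by
          rw [mul_assoc, mul_assoc, twist_mul_twistInv, mul_one]
      _ = _ := by
          rw [← twist_mul_mulBy_structTw, ← mul_assoc, twistInv_mul_twist, one_mul]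
  rw [← mul_assoc, hc, framePrime_eq_conj D]
  simp only [mul_assoc]

/-- Passing to `Ê'_A` adds multiples of `Ê_F`. Their total against the coframe is precisely what the
definition of `ê'^F` subtracts. -/
theorem sum_coframePrime_mul_framePrime :
    ∑ A, mulBy (coframePrime A) * framePrime A = ∑ A, mulBy (coframe A) * frameCR A := by
  have h (A : Dir) : mulBy (coframe A) * framePrime A =
      mulBy (coframe A) * frameCR A + mulBy (coframe A * coefShift A) * hatEF := by
    rw [framePrime_eq_add, mul_add, ← mulBy_mul_mulBy, mul_assoc]
  have hF : coframePrime .F = coframe .F - ∑ A, coframe A * coefShift A := by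
    rw [sum_dir]
    simp [coframePrime, coefShift]
    abel
  have hne (A : Dir) : mulBy (coframePrime A) * framePrime A =
      mulBy (coframe A) * framePrime A - (if A = .F then
        mulBy (∑ A, coframe A * coefShift A) * hatEF else 0) := by
    cases A with
    | F => rw [hF, mulBy_sub, sub_mul]; rfl
    | _ => simp [coframePrime]
  simp only [hne, h, Finset.sum_sub_distrib, Finset.sum_add_distrib, Finset.sum_ite_eq',
    Finset.mem_univ, if_true, mulBy_sum, Finset.sum_mul, add_sub_cancel_right]

/-! ### The CR differentials square to zero -/

/-- The part `e^A E_A` of the differential. -/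
def frameDer (E : Dir → Op) : Op := ∑ A, mulBy (coframe A) * E A

/-- `-d e^F`. -/
def curvature (C : Dir → Dir → Dir → FormAlg) : FormAlg :=
  (1 / 2 : ℂ) • ∑ A, ∑ B, (-1 : ℂ) ^ (A.par + A.par * B.par) • (coframe A * coframe B * C A B .F)

/-- All brackets being along F, the coframe part of the differential is nonzero on `e^F` only, which
leaves a single contraction term. -/
theorem frameDifferential_eq {E : Dir → Op} {C : Dir → Dir → Dir → FormAlg}
    (hC : ∀ A B D, D ≠ .F → C A B D = 0) :
    frameDifferential E C = frameDer E - mulBy (curvature C) * oddDer .formF := by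
  rw [frameDifferential, frameDer, curvature, mulBy_smul, smul_mul_assoc, mulBy_sum, Finset.sum_mul]
  congr 2
  refine Finset.sum_congr rfl fun A _ => ?_
  rw [mulBy_sum, Finset.sum_mul]
  refine Finset.sum_congr rfl fun B _ => ?_
  rw [Finset.sum_eq_single Dir.F]
  · rw [mulBy_smul, smul_mul_assoc]; rfl
  · intro D _ hD; rw [hC A B D hD, mul_zero, mulBy_zero, zero_mul, smul_zero]
  · intro h; exact absurd (Finset.mem_univ _) h

theorem hasPar_coframe (A : Dir) : HasPar (1 + A.par) (coframe A) := by
  cases A with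
  | F => exact hasPar_oddVar _
  | L => exact hasPar_oddVar _
  | R => exact hasPar_oddVar _
  | up i => exact (hasPar_evenVar _).congr (by norm_num [Dir.par])
  | dn i => exact (hasPar_evenVar _).congr (by norm_num [Dir.par])

theorem isConst_coframe (A : Dir) : IsConst (coframe A) := by
  cases A with
  | F => exact isConst_oddVar _
  | L => exact isConst_oddVar _
  | R => exact isConst_oddVar _
  | up i => exact isConst_evenVar _
  | dn i => exact isConst_evenVar _

theorem derPart_coframe (A B : Dir) : derPart A (coframe B) = 0 := by
  cases B with
  | up i => exact derPart_evenVar A _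
  | dn i => exact derPart_evenVar A _
  | _ => cases A <;> simp [coframe, derPart_up_apply, derPart_dn_apply, oddDer_oddVar]

theorem gradePow_one_add_self_add (n : ℕ) : gradePow (1 + n + n) = gradePow 1 := by
  ext w
  rw [add_assoc, ← two_mul, gradePow_add, gradePow_two_mul]; rfl

theorem frame_coframe {E : Dir → Op} {c : Dir → Fin 2 → Fin 2 → FormAlg}
    (h : ∀ A, IsSplit A.par (E A) (derPart A) (c A)) (A B : Dir) : E A (coframe B) = 0 := by
  rw [(h A).apply (isConst_coframe B), derPart_coframe]

/-- The total parity of `e^A` is `1 + |A|` and that of `E_A` is `|A|`, so every summand is odd,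
whatever the parity of `A`. -/
theorem isSuperDer_frameDer {E : Dir → Op} {c : Dir → Fin 2 → Fin 2 → FormAlg}
    (h : ∀ A, IsSplit A.par (E A) (derPart A) (c A)) : IsSuperDer 1 (frameDer E) :=
  IsSuperDer.sum fun A => ((h A).isSuperDer.mulBy_mul (hasPar_coframe A)).congr
    (gradePow_one_add_self_add A.par)

/-- The frame annihilates the coframe, so the square is a double sum of `e^A e^B E_A E_B` with
signs. Symmetrising in the two labels replaces the product of fields by half their supercommutator.
-/
theorem frameDer_mul_self {E : Dir → Op} {c : Dir → Fin 2 → Fin 2 → FormAlg}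
    (h : ∀ A, IsSplit A.par (E A) (derPart A) (c A)) {C : Dir → Dir → Dir → FormAlg} (hC : ∀ A B D, D ≠ .F → C A B D = 0)
    (hcomm : ∀ A B, superComm E A B = ∑ D, mulBy (C A B D) * E D) :
    frameDer E * frameDer E = mulBy (curvature C) * E .F := by
  have h1 (A B : Dir) : mulBy (coframe A) * E A * (mulBy (coframe B) * E B) =
      (-1 : ℂ) ^ (A.par + A.par * B.par) • (mulBy (coframe A * coframe B) * (E A * E B)) := by
    rw [mul_assoc, ← mul_assoc (E A), (h A).isSuperDer.mul_mulBy_of_hasPar (hasPar_coframe B),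
      frame_coframe h, mulBy_zero, zero_add, smul_mul_assoc, mul_smul_comm, ← mulBy_mul_mulBy,
      mul_add, mul_one]
    simp only [mul_assoc]
  have h2 (A B : Dir) : (-1 : ℂ) ^ (B.par + B.par * A.par) •
      (mulBy (coframe B * coframe A) * (E B * E A)) =
      (-1 : ℂ) ^ (A.par + A.par * B.par) • (mulBy (coframe A * coframe B) *
        -((-1 : ℂ) ^ (A.par * B.par) • (E B * E A))) := by
    rw [(hasPar_coframe B).mul_comm (hasPar_coframe A), mulBy_smul, smul_mul_assoc, op_mul_neg,
      mul_smul_comm, smul_smul, smul_neg, smul_smul, ← neg_smul]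
    congr 1
    cases A <;> cases B <;> norm_num [Dir.par]
  have h3 : frameDer E * frameDer E = ∑ A, ∑ B, (-1 : ℂ) ^ (A.par + A.par * B.par) •
      (mulBy (coframe A * coframe B) * (E A * E B)) := by
    simp only [frameDer, Finset.sum_mul_sum, h1]
  -- One copy of the square is written with the labels exchanged, so that the two copies combine
  -- into supercommutators.
  have h4 : (2 : ℂ) • (frameDer E * frameDer E) = (2 : ℂ) • (mulBy (curvature C) * E .F) := by
    rw [two_smul]
    nth_rw 2 [h3]
    rw [Finset.sum_comm]
    simp only [h2]
    rw [h3, ← Finset.sum_add_distrib, curvature, mulBy_smul, smul_mul_assoc, smul_smul]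
    norm_num
    rw [mulBy_sum, Finset.sum_mul]
    refine Finset.sum_congr rfl fun A _ => ?_
    rw [mulBy_sum, Finset.sum_mul, ← Finset.sum_add_distrib]
    refine Finset.sum_congr rfl fun B _ => ?_
    have h5 : mulBy (coframe A * coframe B * C A B .F) * E .F =
        mulBy (coframe A * coframe B) * superComm E A B := by
      rw [hcomm, sum_struct hC, ← mul_assoc, mulBy_mul_mulBy]
    rw [← smul_add, ← mul_add, ← sub_eq_add_neg, mulBy_smul, smul_mul_assoc, h5]
    rfl
  exact smul_right_injective _ two_ne_zero h4

theorem oddDer_formF_mul_frame {E : Dir → Op} {c : Dir → Fin 2 → Fin 2 → FormAlg}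
    (h : ∀ A, IsSplit A.par (E A) (derPart A) (c A)) (hc : ∀ A a b, oddDer .formF (c A a b) = 0) (A : Dir) :
    oddDer .formF * E A = (-1 : ℂ) ^ A.par • (E A * oddDer .formF) := by
  have hodd (f : Fin 2 → SmoothFn) (k : Fin 2 → OddGen) :
      oddDer .formF * (∑ b, mulBy (ofFn (f b)) * oddDer (k b)) =
      (-1 : ℂ) • ((∑ b, mulBy (ofFn (f b)) * oddDer (k b)) * oddDer .formF) := by
    rw [Finset.mul_sum, Finset.sum_mul, Finset.smul_sum]
    refine Finset.sum_congr rfl fun b _ => ?_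
    have := ofFn_oddDer_anticomm 1 (f b) .formF (k b)
    rwa [ofFn_one, mulBy_one, one_mul, ← neg_one_smul ℂ] at this
  have h1 : oddDer .formF * derPart A = (-1 : ℂ) ^ A.par • (derPart A * oddDer .formF) := by
    cases A with
    | F => change _ * 0 = _ • (0 * _); rw [mul_zero, zero_mul, smul_zero]
    | L => rw [derPart_L, Dir.par, pow_zero, one_smul]; exact oddDer_comm_bodyOp _ _
    | R => rw [derPart_R, Dir.par, pow_zero, one_smul]; exact oddDer_comm_bodyOp _ _
    | up i => rw [Dir.par, pow_one]; exact hodd _ _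
    | dn i => rw [Dir.par, pow_one]; exact hodd _ _
  rw [(h A).eq, mul_add, add_mul, smul_add, h1,
    (isSuperDer_oddDer .formF).mul_transOp (commute_oddDer_pX _) (h A).par, one_mul]
  simp only [hc, transOp_zero, zero_add]

/-- A Cartan formula: contraction with F removes `e^F` from `e^F E_F` and anticommutes with
everything else. -/
theorem oddDer_formF_mul_frameDer {E : Dir → Op} {c : Dir → Fin 2 → Fin 2 → FormAlg}
    (h : ∀ A, IsSplit A.par (E A) (derPart A) (c A)) (hc : ∀ A a b, oddDer .formF (c A a b) = 0) :
    oddDer .formF * frameDer E = E .F - frameDer E * oddDer .formF := by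
  have h1 (A : Dir) : oddDer .formF * (mulBy (coframe A) * E A) =
      (if A = .F then E .F else 0) - mulBy (coframe A) * E A * oddDer .formF := by
    rw [← mul_assoc, (isSuperDer_oddDer .formF).mul_mulBy_of_hasPar (hasPar_coframe A), add_mul,
      smul_mul_assoc, mul_assoc, oddDer_formF_mul_frame h hc, mul_smul_comm, smul_smul, mul_assoc]
    have hs : (-1 : ℂ) ^ (1 * (1 + A.par)) * (-1) ^ A.par = -1 := by
      cases A <;> norm_num [Dir.par]
    rw [hs, neg_one_smul, ← sub_eq_add_neg]
    congr 1
    cases A <;> simp [coframe, oddDer_oddVar]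
  simp only [frameDer, Finset.mul_sum, Finset.sum_mul, h1, Finset.sum_sub_distrib,
    Finset.sum_ite_eq', Finset.mem_univ, if_true]

/-- With `S`, `q`, `P` as in the proof, the square of `S - q P` is `q E_F - q S P - q (E_F - S P) +
q² P²`, and all terms cancel. -/
theorem frameDifferential_mul_self {E : Dir → Op} {c : Dir → Fin 2 → Fin 2 → FormAlg}
    (h : ∀ A, IsSplit A.par (E A) (derPart A) (c A)) {C : Dir → Dir → Dir → FormAlg}
    (hC : ∀ A B D, D ≠ .F → C A B D = 0)
    (hcomm : ∀ A B, superComm E A B = ∑ D, mulBy (C A B D) * E D)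
    (hc : ∀ A a b, oddDer .formF (c A a b) = 0) (hq : HasPar 0 (curvature C))
    (hSq : frameDer E (curvature C) = 0) (hFq : oddDer .formF (curvature C) = 0) :
    frameDifferential E C * frameDifferential E C = 0 := by
  set q := curvature C with hqdef
  set S := frameDer E with hS
  set P := oddDer .formF with hP
  have e1 : S * S = mulBy q * E .F := frameDer_mul_self h hC hcomm
  have e2 : S * mulBy q = mulBy q * S := by
    rw [(isSuperDer_frameDer h).mul_mulBy_of_hasPar hq, ← hS, hSq]; simp
  have e3 : P * mulBy q = mulBy q * P := by
    rw [(isSuperDer_oddDer .formF).mul_mulBy_of_hasPar hq, ← hP, hFq]; simp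
  have e4 : P * S = E .F - S * P := oddDer_formF_mul_frameDer h hc
  have e5 : P * P = 0 := oddDer_mul_self _
  rw [frameDifferential_eq hC, ← hS, ← hqdef, ← hP, sub_mul, mul_sub, mul_sub, e1, ← mul_assoc S,
    e2, mul_assoc _ P S, e4, mul_assoc _ P, ← mul_assoc P, e3, mul_assoc _ P P, e5, mul_zero,
    mul_zero, sub_zero, mul_sub, mul_assoc, sub_sub, add_sub_cancel, sub_self]

theorem isSuperDer_frameDifferential {E : Dir → Op} {c : Dir → Fin 2 → Fin 2 → FormAlg}
    (h : ∀ A, IsSplit A.par (E A) (derPart A) (c A)) {C : Dir → Dir → Dir → FormAlg}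
    (hC : ∀ A B D, D ≠ .F → C A B D = 0) (hq : HasPar 0 (curvature C)) :
    IsSuperDer 1 (frameDifferential E C) := by
  rw [frameDifferential_eq hC]
  exact (isSuperDer_frameDer h).sub (((isSuperDer_oddDer .formF).mulBy_mul hq).congr rfl)


/-! ### The curvatures of the two frames -/

theorem curvature_structCR : curvature structCR =
    (2 : ℂ) • ∑ i, coframe (.up i) * coframe (.dn i) := by
  have hc (i : Fin 3) : coframe (.dn i) * coframe (.up i) = coframe (.up i) * coframe (.dn i) :=
    commute_evenVar _ _
  -- Both orders of a fermionic pair contribute the same term, because the dual generators commute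
  -- and the sign exponent is 2.
  rw [curvature]
  simp only [sum_dir, structCR, mul_zero, smul_zero, Finset.sum_const_zero, add_zero, zero_add]
  simp only [Dir.par, mul_one, one_smul, one_add_one_eq_two, neg_one_sq, mul_ite, mul_zero,
    smul_ite, smul_zero, Finset.sum_ite_eq, Finset.sum_ite_eq', Finset.mem_univ, if_true, hc, mul_two,
    Finset.sum_add_distrib]
  module

/-- Exchanging L and R changes the sign of both the form and the structure function, so the two
orders add. -/
theorem curvature_structTw : curvature structTw =
    (2 : ℂ) • (coframe .L * coframe .R * ∑ i, thetaC i * etaC i) := by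
  have hc : coframe .R * coframe .L = -(coframe .L * coframe .R) := oddVar_anticomm _ _
  rw [curvature]
  simp only [sum_dir, structTw, mul_zero, smul_zero, Finset.sum_const_zero, add_zero, zero_add]
  simp only [Dir.par, mul_zero, add_zero, pow_zero, one_smul, hc, neg_mul, mul_neg, neg_neg]
  rw [← two_smul ℂ, smul_smul, two_mul, mul_add, ← two_smul ℂ]
  norm_num

theorem hasPar_thetaC_etaC : HasPar 0 (∑ i, thetaC i * etaC i) :=
  HasPar.sum_odd_mul_odd hasPar_thetaC hasPar_etaC

theorem hasPar_curvature_structCR : HasPar 0 (curvature structCR) := by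
  rw [curvature_structCR]
  exact (HasPar.sum fun i => (hasPar_evenVar _).mul_even (hasPar_evenVar _)).smul _

theorem hasPar_curvature_structTw : HasPar 0 (curvature structTw) := by
  rw [curvature_structTw]
  exact (((hasPar_oddVar _).odd_mul_odd (hasPar_oddVar _)).mul_even hasPar_thetaC_etaC).smul _

theorem frameCR_curvature (A : Dir) : frameCR A (curvature structCR) = 0 := by
  have hA (i : Fin 3) : frameCR A (coframe (.up i) * coframe (.dn i)) = 0 := by
    rw [(isSplit_frameCR A).isSuperDer, frame_coframe isSplit_frameCR,
      frame_coframe isSplit_frameCR, zero_mul, mul_zero, add_zero]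
  rw [curvature_structCR, map_smul, map_sum]
  simp [hA]

theorem frameTw_curvature (A : Dir) : frameTw A (curvature structTw) = 0 := by
  rw [curvature_structTw, map_smul, (isSplit_frameTw A).isSuperDer,
    (isSplit_frameTw A).isSuperDer (coframe .L), frame_coframe isSplit_frameTw,
    frame_coframe isSplit_frameTw, (isSplit_frameTw A).apply isConst_thetaC_etaC,
    derPart_thetaC_etaC]
  simp

theorem frameDer_curvature_structCR : frameDer frameCR (curvature structCR) = 0 := by
  simp [frameDer, frameCR_curvature]

theorem frameDer_curvature_structTw : frameDer frameTw (curvature structTw) = 0 := by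
  simp [frameDer, frameTw_curvature]

/-! ### Elements that do not contain `e^F` -/

theorem oddDer_formF_mul {x y : FormAlg} (hx : oddDer .formF x = 0) (hy : oddDer .formF y = 0) :
    oddDer .formF (x * y) = 0 := by
  rw [isSuperDer_oddDer, hx, hy, zero_mul, mul_zero, add_zero]

theorem oddDer_formF_sum {ι : Type} {S : Finset ι} {x : ι → FormAlg}
    (h : ∀ i, oddDer .formF (x i) = 0) : oddDer .formF (∑ i ∈ S, x i) = 0 := by
  simp [map_sum, h]

theorem oddDer_formF_neg {x : FormAlg} (hx : oddDer .formF x = 0) : oddDer .formF (-x) = 0 := by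
  rw [map_neg, hx, neg_zero]

theorem oddDer_formF_eta (b : Fin 2) (i : Fin 3) : oddDer .formF (eta b i) = 0 := by
  simp [eta, oddDer_oddVar]

theorem oddDer_formF_theta (i : Fin 3) (a : Fin 2) : oddDer .formF (theta i a) = 0 := by
  simp [theta, oddDer_oddVar]

theorem oddDer_formF_etaC (i : Fin 3) : oddDer .formF (etaC i) = 0 :=
  oddDer_formF_sum fun b => oddDer_formF_mul (oddDer_formF_eta b i) (oddDer_ofFn _ _)

theorem oddDer_formF_thetaC (i : Fin 3) : oddDer .formF (thetaC i) = 0 :=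
  oddDer_formF_sum fun a => oddDer_formF_mul (oddDer_formF_theta i a) (oddDer_ofFn _ _)

theorem oddDer_formF_etaT (i : Fin 3) : oddDer .formF (etaT i) = 0 :=
  oddDer_formF_neg <| oddDer_formF_sum fun b =>
    oddDer_formF_mul (oddDer_formF_eta b i) (oddDer_ofFn _ _)

theorem oddDer_formF_thetaT (i : Fin 3) : oddDer .formF (thetaT i) = 0 :=
  oddDer_formF_neg <| oddDer_formF_sum fun a =>
    oddDer_formF_mul (oddDer_formF_theta i a) (oddDer_ofFn _ _)

theorem oddDer_formF_thetaC_etaC : oddDer .formF (∑ i, thetaC i * etaC i) = 0 :=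
  oddDer_formF_sum fun i => oddDer_formF_mul (oddDer_formF_thetaC i) (oddDer_formF_etaC i)

theorem oddDer_formF_coefCR (A : Dir) (a b : Fin 2) : oddDer .formF (coefCR A a b) = 0 := by
  cases A with
  | F => exact oddDer_ofFn _ _
  | L => exact map_zero _
  | R => exact map_zero _
  | up i => exact oddDer_formF_mul (oddDer_ofFn _ _) (oddDer_formF_theta i a)
  | dn i => exact oddDer_formF_mul (oddDer_ofFn _ _) (oddDer_formF_eta b i)

theorem oddDer_formF_coefTw (A : Dir) (a b : Fin 2) : oddDer .formF (coefTw A a b) = 0 := by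
  cases A with
  | F => exact oddDer_ofFn _ _
  | L => exact oddDer_formF_mul oddDer_formF_thetaC_etaC (oddDer_formF_neg (oddDer_ofFn _ _))
  | R => exact oddDer_formF_mul oddDer_formF_thetaC_etaC (oddDer_ofFn _ _)
  | up i => exact map_zero _
  | dn i => exact map_zero _

theorem oddDer_formF_coefW (a b : Fin 2) : oddDer .formF (coefW a b) = 0 := oddDer_ofFn _ _

theorem oddDer_formF_coefWHat (a b : Fin 2) : oddDer .formF (coefWHat a b) = 0 :=
  oddDer_formF_neg (oddDer_ofFn _ _)

theorem oddDer_formF_coefX (a b : Fin 2) : oddDer .formF (coefX a b) = 0 := by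
  rw [coefX, map_add,
    oddDer_formF_mul (oddDer_formF_sum fun i =>
      oddDer_formF_mul (oddDer_formF_thetaT i) (oddDer_formF_etaC i)) (oddDer_formF_coefW a b),
    oddDer_formF_mul (oddDer_formF_sum fun i =>
      oddDer_formF_mul (oddDer_formF_thetaC i) (oddDer_formF_etaT i))
        (oddDer_formF_coefWHat a b), add_zero]

theorem oddDer_formF_curvature_structCR : oddDer .formF (curvature structCR) = 0 := by
  rw [curvature_structCR, map_smul, oddDer_formF_sum, smul_zero]
  exact fun i => oddDer_formF_mul (oddDer_evenVar _ _) (oddDer_evenVar _ _)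

theorem oddDer_formF_curvature_structTw : oddDer .formF (curvature structTw) = 0 := by
  rw [curvature_structTw, map_smul, oddDer_formF_mul (oddDer_formF_mul _ _)
    oddDer_formF_thetaC_etaC, smul_zero] <;> simp [coframe, oddDer_oddVar]

theorem dbarHom_eq : dbarHom = frameDer frameCR - mulBy (curvature structCR) * oddDer .formF :=
  frameDifferential_eq structCR_of_ne

theorem dbarTwHom_eq : dbarTwHom = frameDer frameTw - mulBy (curvature structTw) * oddDer .formF :=
  frameDifferential_eq structTw_of_ne

theorem dbarHom_mul_self : dbarHom * dbarHom = 0 :=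
  frameDifferential_mul_self isSplit_frameCR structCR_of_ne superComm_frameCR oddDer_formF_coefCR
    hasPar_curvature_structCR frameDer_curvature_structCR oddDer_formF_curvature_structCR

theorem dbarTwHom_mul_self : dbarTwHom * dbarTwHom = 0 :=
  frameDifferential_mul_self isSplit_frameTw structTw_of_ne superComm_frameTw oddDer_formF_coefTw
    hasPar_curvature_structTw frameDer_curvature_structTw oddDer_formF_curvature_structTw

theorem isSuperDer_dbarHom : IsSuperDer 1 dbarHom :=
  isSuperDer_frameDifferential isSplit_frameCR structCR_of_ne hasPar_curvature_structCR

theorem isSuperDer_dbarTwHom : IsSuperDer 1 dbarTwHom :=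
  isSuperDer_frameDifferential isSplit_frameTw structTw_of_ne hasPar_curvature_structTw

/-! ### Scaling of superforms -/

/-- The weights of the odd generators under `biScale`. -/
def biWeight (u c : ℂ) : OddGen → ℂ
  | .eta _ _ => u
  | .theta _ _ => u
  | .formF => c
  | .formL => c
  | .formR => c

/-- The rescaling of the fermionic coordinates by `u`, of the forms dual to bosonic fields by `c`
and of the forms dual to fermionic fields by `c u`. -/
def biScale (u c : ℂ) : FormAlg →ₐ[ℂ] FormAlg :=
  rescale (AlgHom.id ℂ _) (biWeight u c) (fun _ => c * u)

/-- Form degree and Grassmann parity are the members `(1, c)` and `(-1, 1)` of one family, both with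
`u * u = 1`, so weights are proved once for both gradings. -/
theorem degScale_eq (c : ℂ) : degScale c = biScale 1 c :=
  formAlg_algHom_ext
    (fun f => by simp [degScale, biScale, rescale_ofFn])
    (fun k => by cases k <;> simp [degScale, biScale, biWeight, rescale_oddVar])
    (fun k => by simp [degScale, biScale, rescale_evenVar])

theorem parityInv_eq : parityInv = biScale (-1) 1 :=
  formAlg_algHom_ext
    (fun f => by simp [parityInv, biScale, rescale_ofFn])
    (fun k => by cases k <;> simp [parityInv, biScale, biWeight, rescale_oddVar])
    (fun k => by simp [parityInv, biScale, rescale_evenVar])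

/-- Total parity is form degree plus Grassmann parity: forms dual to fermionic fields receive two
signs. -/
theorem gradeInv_eq : gradeInv = (degScale (-1)).comp parityInv :=
  formAlg_algHom_ext
    (fun f => by simp [degScale, parityInv, rescale_ofFn])
    (fun k => by cases k <;> simp [degScale, parityInv, rescale_oddVar])
    (fun k => by simp [degScale, parityInv, rescale_evenVar])

/-- `T` has weight `r` with respect to `ρ`. -/
def OpScales (ρ : FormAlg →ₐ[ℂ] FormAlg) (r : ℂ) (T : Op) : Prop := ∀ w, ρ (T w) = r • T (ρ w)

/-- `x` has weight `r` with respect to `ρ`. -/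
def EltScales (ρ : FormAlg →ₐ[ℂ] FormAlg) (r : ℂ) (x : FormAlg) : Prop := ρ x = r • x

section Closure

variable {ρ : FormAlg →ₐ[ℂ] FormAlg} {r r' : ℂ}

theorem EltScales.congr {x : FormAlg} (h : EltScales ρ r x) (e : r = r') : EltScales ρ r' x := e ▸ h

theorem EltScales.mul {x y : FormAlg} (hx : EltScales ρ r x) (hy : EltScales ρ r' y) :
    EltScales ρ (r * r') (x * y) := by
  unfold EltScales at *; rw [map_mul, hx, hy, smul_mul_smul_comm]

theorem EltScales.add {x y : FormAlg} (hx : EltScales ρ r x) (hy : EltScales ρ r y) :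
    EltScales ρ r (x + y) := by
  unfold EltScales at *; rw [map_add, hx, hy, smul_add]

theorem EltScales.neg {x : FormAlg} (hx : EltScales ρ r x) : EltScales ρ r (-x) := by
  unfold EltScales at *; rw [map_neg, hx, smul_neg]

theorem EltScales.smul {x : FormAlg} (c : ℂ) (hx : EltScales ρ r x) : EltScales ρ r (c • x) := by
  unfold EltScales at *; rw [map_smul, hx, smul_comm]

theorem EltScales.zero : EltScales ρ r 0 := by simp [EltScales]

theorem EltScales.sum {ι : Type} {S : Finset ι} {x : ι → FormAlg}
    (h : ∀ i, EltScales ρ r (x i)) : EltScales ρ r (∑ i ∈ S, x i) :=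
  Finset.sum_induction _ (EltScales ρ r) (fun _ _ => EltScales.add) EltScales.zero fun i _ => h i

theorem OpScales.congr {T : Op} (h : OpScales ρ r T) (e : r = r') : OpScales ρ r' T := e ▸ h

theorem OpScales.add {T U : Op} (hT : OpScales ρ r T) (hU : OpScales ρ r U) :
    OpScales ρ r (T + U) := fun w => by
  rw [LinearMap.add_apply, map_add, hT, hU, LinearMap.add_apply, smul_add]

theorem OpScales.sub {T U : Op} (hT : OpScales ρ r T) (hU : OpScales ρ r U) :
    OpScales ρ r (T - U) := fun w => by
  rw [LinearMap.sub_apply, map_sub, hT, hU, LinearMap.sub_apply, smul_sub]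

theorem OpScales.zero : OpScales ρ r 0 := fun w => by simp

theorem OpScales.sum {ι : Type} {S : Finset ι} {T : ι → Op}
    (h : ∀ i, OpScales ρ r (T i)) : OpScales ρ r (∑ i ∈ S, T i) :=
  Finset.sum_induction _ (OpScales ρ r) (fun _ _ => OpScales.add) OpScales.zero fun i _ => h i

theorem OpScales.mulBy_mul {x : FormAlg} {T : Op} (hx : EltScales ρ r x) (hT : OpScales ρ r' T) :
    OpScales ρ (r * r') (mulBy x * T) := fun w => by
  unfold EltScales at hx
  rw [Module.End.mul_apply, mulBy_apply, map_mul, hx, hT, smul_mul_smul_comm]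
  rfl

theorem OpScales.mul {T U : Op} (hT : OpScales ρ r T) (hU : OpScales ρ r' U) :
    OpScales ρ (r * r') (T * U) := fun w => by
  rw [Module.End.mul_apply, hT, hU, map_smul, smul_smul]; rfl

theorem OpScales.one : OpScales ρ 1 1 := fun w => by rw [one_smul]; rfl

theorem OpScales.transOp {c : Fin 2 → Fin 2 → FormAlg} (hc : ∀ a b, EltScales ρ r (c a b))
    (hX : ∀ a b, OpScales ρ 1 (pX a b)) : OpScales ρ r (transOp c) :=
  OpScales.sum fun a => OpScales.sum fun b => (OpScales.mulBy_mul (hc a b) (hX a b)).congr (mul_one r)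

/-- A nilpotent operator of weight one has an exponential of weight one. -/
theorem OpScales.exp {T : Op} (hT : OpScales ρ 1 T) (hn : IsNilpotent T) :
    OpScales ρ 1 (IsNilpotent.exp T) := by
  let R : Op := ρ.toLinearMap
  have h : T * R = R * T := LinearMap.ext fun w => by
    have := hT w; rw [one_smul] at this; exact this.symm
  intro w
  rw [one_smul]
  exact (LinearMap.congr_fun (exp_mul_comm hn h) w).symm

end Closure

/-- The weight stands uninverted on the left because it may vanish; the rescaling with weight zero
is what detects superfunctions. -/
theorem rescale_oddDer (φ : SmoothFn →ₐ[ℂ] SmoothFn) (a : OddGen → ℂ) (b : EvenGen → ℂ)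
    (k : OddGen) (w : FormAlg) :
    a k • rescale φ a b (oddDer k w) = oddDer k (rescale φ a b w) := by
  induction w using formAlg_induction with
  | add u v hu hv => simp only [map_add, smul_add, hu, hv]
  | elem f x y =>
    rw [oddDer_elem, rescale_elem, rescale_elem, oddDer_elem, ← contractLeft_map, elem_smul_mid]

section BiScale

variable {u c : ℂ}

theorem eltScales_ofFn (f : SmoothFn) : EltScales (biScale u c) 1 (ofFn f) := by
  rw [EltScales, biScale, rescale_ofFn, one_smul]; rfl

theorem eltScales_eta (b : Fin 2) (i : Fin 3) : EltScales (biScale u c) u (eta b i) :=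
  rescale_oddVar _ _ _ _

theorem eltScales_theta (i : Fin 3) (a : Fin 2) : EltScales (biScale u c) u (theta i a) :=
  rescale_oddVar _ _ _ _

theorem eltScales_coframe (A : Dir) : EltScales (biScale u c) (c * u ^ A.par) (coframe A) := by
  cases A with
  | F => exact (EltScales.congr (rescale_oddVar _ _ _ _) (by simp [biWeight, Dir.par]))
  | L => exact (EltScales.congr (rescale_oddVar _ _ _ _) (by simp [biWeight, Dir.par]))
  | R => exact (EltScales.congr (rescale_oddVar _ _ _ _) (by simp [biWeight, Dir.par]))
  | up i => exact (EltScales.congr (rescale_evenVar _ _ _ _) (by simp [Dir.par]))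
  | dn i => exact (EltScales.congr (rescale_evenVar _ _ _ _) (by simp [Dir.par]))

theorem opScales_bodyOp (D : SmoothFn →ₗ[ℂ] SmoothFn) : OpScales (biScale u c) 1 (bodyOp D) := by
  intro w
  rw [one_smul]
  induction w using formAlg_induction with
  | add u v hu hv => simp only [map_add, hu, hv]
  | elem f x y => rw [bodyOp_elem, biScale, rescale_elem, rescale_elem, bodyOp_elem]; rfl

theorem eltScales_etaC (i : Fin 3) : EltScales (biScale u c) u (etaC i) :=
  EltScales.sum fun b => ((eltScales_eta b i).mul (eltScales_ofFn _)).congr (mul_one u)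

theorem eltScales_thetaC (i : Fin 3) : EltScales (biScale u c) u (thetaC i) :=
  EltScales.sum fun a => ((eltScales_theta i a).mul (eltScales_ofFn _)).congr (mul_one u)

theorem eltScales_etaT (i : Fin 3) : EltScales (biScale u c) u (etaT i) :=
  (EltScales.sum fun b => ((eltScales_eta b i).mul (eltScales_ofFn _)).congr (mul_one u)).neg

theorem eltScales_thetaT (i : Fin 3) : EltScales (biScale u c) u (thetaT i) :=
  (EltScales.sum fun a => ((eltScales_theta i a).mul (eltScales_ofFn _)).congr (mul_one u)).neg

theorem eltScales_coefF (a b : Fin 2) : EltScales (biScale u c) 1 (coefF a b) := eltScales_ofFn _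

theorem eltScales_coefW (a b : Fin 2) : EltScales (biScale u c) 1 (coefW a b) := eltScales_ofFn _

theorem eltScales_coefWHat (a b : Fin 2) : EltScales (biScale u c) 1 (coefWHat a b) :=
  (eltScales_ofFn _).neg

theorem eltScales_sum_mul (hu : u * u = 1) {x y : Fin 3 → FormAlg}
    (hx : ∀ i, EltScales (biScale u c) u (x i)) (hy : ∀ i, EltScales (biScale u c) u (y i)) :
    EltScales (biScale u c) 1 (∑ i, x i * y i) :=
  EltScales.sum fun i => ((hx i).mul (hy i)).congr hu

theorem eltScales_coefCR (A : Dir) (a b : Fin 2) :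
    EltScales (biScale u c) (u ^ A.par) (coefCR A a b) := by
  cases A with
  | F => exact (eltScales_coefF a b).congr (pow_zero u).symm
  | L => exact EltScales.zero
  | R => exact EltScales.zero
  | up i => exact ((eltScales_ofFn _).mul (eltScales_theta i a)).congr (by simp [Dir.par])
  | dn i => exact ((eltScales_ofFn _).mul (eltScales_eta b i)).congr (by simp [Dir.par])

theorem eltScales_coefShift (hu : u * u = 1) (A : Dir) :
    EltScales (biScale u c) (u ^ A.par) (coefShift A) := by
  cases A with
  | F => exact EltScales.zero
  | L => exact (eltScales_sum_mul hu eltScales_thetaT eltScales_etaC).congr (pow_zero u).symm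
  | R => exact (eltScales_sum_mul hu eltScales_thetaC eltScales_etaT).neg.congr (pow_zero u).symm
  | up i => exact (eltScales_thetaT i).neg.congr (pow_one u).symm
  | dn i => exact (eltScales_etaT i).neg.congr (pow_one u).symm

theorem eltScales_coefTw (hu : u * u = 1) (A : Dir) (a b : Fin 2) :
    EltScales (biScale u c) (u ^ A.par) (coefTw A a b) := by
  have h := eltScales_sum_mul (c := c) hu eltScales_thetaC eltScales_etaC
  cases A with
  | F => exact (eltScales_coefF a b).congr (pow_zero u).symm
  | L => exact (h.mul (eltScales_coefWHat a b)).congr (by simp [Dir.par])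
  | R => exact (h.mul (eltScales_coefW a b)).congr (by simp [Dir.par])
  | up i => exact EltScales.zero
  | dn i => exact EltScales.zero

theorem eltScales_coefX (hu : u * u = 1) (a b : Fin 2) :
    EltScales (biScale u c) 1 (coefX a b) :=
  (((eltScales_sum_mul hu eltScales_thetaT eltScales_etaC).mul (eltScales_coefW a b)).congr
    (one_mul 1)).add (((eltScales_sum_mul hu eltScales_thetaC eltScales_etaT).mul
      (eltScales_coefWHat a b)).congr (one_mul 1))

theorem biScale_oddDer (k : OddGen) (w : FormAlg) :
    biWeight u c k • biScale u c (oddDer k w) = oddDer k (biScale u c w) :=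
  rescale_oddDer (AlgHom.id ℂ _) (biWeight u c) (fun _ => c * u) k w

/-- A derivative along an odd coordinate has weight `u⁻¹`, while multiplication by an odd coordinate
has weight `u`. The frame fields mix the two, so only a grading modulo 2 is respected; hence `u * u
= 1`. -/
theorem opScales_derPart (hu : u * u = 1) (A : Dir) :
    OpScales (biScale u c) (u ^ A.par) (derPart A) := by
  have h (k : OddGen) (hk : biWeight u c k = u) : OpScales (biScale u c) u (oddDer k) := fun w => by
    have := biScale_oddDer (u := u) (c := c) k w
    rw [hk] at this
    rw [← this, smul_smul, hu, one_smul]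
  cases A with
  | F => exact OpScales.zero
  | L => rw [derPart_L]; exact (opScales_bodyOp _).congr (pow_zero u).symm
  | R => rw [derPart_R]; exact (opScales_bodyOp _).congr (pow_zero u).symm
  | up i =>
    exact OpScales.sum fun b => (OpScales.mulBy_mul (eltScales_ofFn _)
      (h (.eta b i) rfl)).congr (by simp [Dir.par])
  | dn i =>
    exact OpScales.sum fun a => (OpScales.mulBy_mul (eltScales_ofFn _)
      (h (.theta i a) rfl)).congr (by simp [Dir.par])

theorem opScales_frameDer (hu : u * u = 1) {E : Dir → Op} {d : Dir → Fin 2 → Fin 2 → FormAlg}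
    (h : ∀ A, IsSplit A.par (E A) (derPart A) (d A))
    (hd : ∀ A a b, EltScales (biScale u c) (u ^ A.par) (d A a b)) :
    OpScales (biScale u c) c (frameDer E) := by
  have hE (A : Dir) : OpScales (biScale u c) (u ^ A.par) (E A) := by
    rw [(h A).eq]
    exact (opScales_derPart hu A).add (OpScales.transOp (hd A) fun _ _ => opScales_bodyOp _)
  refine OpScales.sum fun A => (OpScales.mulBy_mul (eltScales_coframe A) (hE A)).congr ?_
  rw [mul_assoc, ← mul_pow, hu, one_pow, mul_one]

/-- The contraction takes away one factor `c`, which the weight of `x` provides. Stating it this way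
avoids dividing by `c`. -/
theorem opScales_mulBy_mul_oddDer_formF {x : FormAlg} {r : ℂ}
    (hx : EltScales (biScale u c) (r * c) x) :
    OpScales (biScale u c) r (mulBy x * oddDer .formF) := fun w => by
  have h : c • biScale u c (oddDer .formF w) = oddDer .formF (biScale u c w) :=
    biScale_oddDer .formF w
  unfold EltScales at hx
  rw [Module.End.mul_apply, mulBy_apply, map_mul, hx, Module.End.mul_apply, mulBy_apply, ← h,
    mul_smul, smul_mul_assoc, smul_mul_assoc, mul_smul_comm]

theorem opScales_dbarHom (hu : u * u = 1) : OpScales (biScale u c) c dbarHom := by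
  rw [dbarHom_eq]
  refine (opScales_frameDer hu isSplit_frameCR eltScales_coefCR).sub
    (opScales_mulBy_mul_oddDer_formF ?_)
  rw [curvature_structCR]
  refine (EltScales.sum fun i => ((eltScales_coframe _).mul (eltScales_coframe _)).congr ?_).smul _
  simp only [Dir.par, pow_one]
  linear_combination c * c * hu

theorem opScales_dbarTwHom (hu : u * u = 1) : OpScales (biScale u c) c dbarTwHom := by
  rw [dbarTwHom_eq]
  refine (opScales_frameDer hu isSplit_frameTw (eltScales_coefTw hu)).sub
    (opScales_mulBy_mul_oddDer_formF ?_)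
  rw [curvature_structTw]
  refine ((((eltScales_coframe _).mul (eltScales_coframe _)).mul
    (eltScales_sum_mul hu eltScales_thetaC eltScales_etaC)).congr ?_).smul _
  simp only [Dir.par, pow_zero, mul_one]

theorem opScales_twistField (hu : u * u = 1) : OpScales (biScale u c) 1 twistField := by
  rw [twistField_eq]
  exact OpScales.transOp (eltScales_coefX hu) fun _ _ => opScales_bodyOp _

end BiScale

/-! ### Bigraded pieces -/

/-- Superforms, of any homogeneity, of form degree `p` and Grassmann parity `a`. -/
def formPiece (p : ℕ) (a : ZMod 2) : Submodule ℂ FormAlg where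
  carrier := {w | (∀ c : ℂ, degScale c w = c ^ p • w) ∧ parityInv w = (-1 : ℂ) ^ a.val • w}
  add_mem' {v w} hv hw :=
    ⟨fun c => by simp [hv.1 c, hw.1 c], by simp [hv.2, hw.2]⟩
  zero_mem' := by simp
  smul_mem' r w hw :=
    ⟨fun c => by simp [hw.1 c, smul_comm r], by simp [hw.2, smul_comm r]⟩

theorem mem_omegaPiece {p : ℕ} {a : ZMod 2} {w : Omega} :
    w ∈ OmegaPiece p a ↔ (w : FormAlg) ∈ formPiece p a := Iff.rfl

theorem neg_one_pow_val_add (a b : ZMod 2) :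
    (-1 : ℂ) ^ (a + b).val = (-1) ^ a.val * (-1) ^ b.val := by
  rw [← pow_add, ZMod.val_add, ← neg_one_pow_eq_pow_mod_two]

theorem formPiece_mul {p q : ℕ} {a b : ZMod 2} {v w : FormAlg} (hv : v ∈ formPiece p a)
    (hw : w ∈ formPiece q b) : v * w ∈ formPiece (p + q) (a + b) :=
  ⟨fun c => by rw [map_mul, hv.1, hw.1, smul_mul_smul_comm, pow_add],
    by rw [map_mul, hv.2, hw.2, smul_mul_smul_comm, neg_one_pow_val_add]⟩

theorem hasPar_of_mem_formPiece {p : ℕ} {a : ZMod 2} {w : FormAlg} (hw : w ∈ formPiece p a) :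
    HasPar (p + a.val) w := by
  rw [HasPar, gradeInv_eq, AlgHom.comp_apply, hw.2, map_smul, hw.1, smul_smul, pow_add, mul_comm]

theorem OpScales.mem_formPiece {T : Op} {n : ℕ} (h1 : ∀ c, OpScales (biScale 1 c) (c ^ n) T)
    (h2 : OpScales (biScale (-1) 1) 1 T) {p : ℕ} {a : ZMod 2} {w : FormAlg}
    (hw : w ∈ formPiece p a) : T w ∈ formPiece (p + n) a := by
  refine ⟨fun c => ?_, ?_⟩
  · rw [degScale_eq, h1, ← degScale_eq, hw.1, map_smul, smul_smul, pow_add, mul_comm]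
  · rw [parityInv_eq, h2, ← parityInv_eq, hw.2, map_smul, one_smul]

theorem dbarHom_mem_formPiece {p : ℕ} {a : ZMod 2} {w : FormAlg} (hw : w ∈ formPiece p a) :
    dbarHom w ∈ formPiece (p + 1) a :=
  OpScales.mem_formPiece (fun c => (opScales_dbarHom (one_mul 1)).congr (pow_one c).symm)
    (opScales_dbarHom (by norm_num)) hw

theorem dbarTwHom_mem_formPiece {p : ℕ} {a : ZMod 2} {w : FormAlg} (hw : w ∈ formPiece p a) :
    dbarTwHom w ∈ formPiece (p + 1) a :=
  OpScales.mem_formPiece (fun c => (opScales_dbarTwHom (one_mul 1)).congr (pow_one c).symm)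
    (opScales_dbarTwHom (by norm_num)) hw

/-- Every generator is homogeneous and the pieces multiply into one another, so their span is closed
under products. -/
theorem iSup_formPiece : ⨆ k : ℕ × ZMod 2, formPiece k.1 k.2 = ⊤ := by
  rw [eq_top_iff]
  rintro w -
  have hle (p a) : formPiece p a ≤ ⨆ k : ℕ × ZMod 2, formPiece k.1 k.2 :=
    le_iSup (fun k : ℕ × ZMod 2 => formPiece k.1 k.2) (p, a)
  induction w using formAlg_gen_induction with
  | ofFn f =>
    refine hle 0 0 ⟨fun c => ?_, ?_⟩
    · rw [degScale, rescale_ofFn, pow_zero, one_smul]; rfl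
    · rw [parityInv, rescale_ofFn, ZMod.val_zero, pow_zero, one_smul]; rfl
  | oddVar k =>
    cases k with
    | eta b i =>
      refine hle 0 1 ⟨fun c => ?_, ?_⟩
      · rw [degScale, rescale_oddVar, pow_zero]
      · rw [parityInv, rescale_oddVar, ZMod.val_one, pow_one]
    | theta i a =>
      refine hle 0 1 ⟨fun c => ?_, ?_⟩
      · rw [degScale, rescale_oddVar, pow_zero]
      · rw [parityInv, rescale_oddVar, ZMod.val_one, pow_one]
    | _ =>
      refine hle 1 0 ⟨fun c => ?_, ?_⟩
      · rw [degScale, rescale_oddVar, pow_one]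
      · rw [parityInv, rescale_oddVar, ZMod.val_zero, pow_zero]
  | evenVar k =>
    refine hle 1 1 ⟨fun c => ?_, ?_⟩
    · rw [degScale, rescale_evenVar, pow_one]
    · rw [parityInv, rescale_evenVar, ZMod.val_one, pow_one]
  | add u v hu hv => exact add_mem hu hv
  | mul u v hu hv =>
    refine Submodule.iSup_induction (fun k : ℕ × ZMod 2 => formPiece k.1 k.2)
      (motive := fun u => u * v ∈ ⨆ k : ℕ × ZMod 2, formPiece k.1 k.2) hu ?_ ?_ ?_
    · intro k u hu
      refine Submodule.iSup_induction (fun k : ℕ × ZMod 2 => formPiece k.1 k.2)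
        (motive := fun v => u * v ∈ ⨆ k : ℕ × ZMod 2, formPiece k.1 k.2) hv ?_ ?_ ?_
      · intro l v hv; exact hle _ _ (formPiece_mul hu hv)
      · rw [mul_zero]; exact zero_mem _
      · intro v v' hv hv'; rw [mul_add]; exact add_mem hv hv'
    · rw [zero_mul]; exact zero_mem _
    · intro u u' hu hu'; rw [add_mul]; exact add_mem hu hu'

/-- Distinct eigenvalues of `parityInv` followed by `degScale 2` on the bigraded pieces. -/
def bidegEigenvalue (K : Type*) [Field K] (k : ℕ × ZMod 2) : K := 2 ^ k.1 * (-1) ^ k.2.val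

/-- The absolute value `2 ^ p` recovers the form degree, and the remaining sign recovers the parity.
-/
theorem bidegEigenvalue_injective : Function.Injective (bidegEigenvalue ℂ) := by
  rintro ⟨p, a⟩ ⟨q, b⟩ h
  have h1 : p = q := by
    have := congrArg (fun z : ℂ => ‖z‖) h
    simp only [bidegEigenvalue, norm_mul, norm_pow, norm_neg, norm_one, one_pow, mul_one,
      Complex.norm_ofNat] at this
    exact pow_right_injective₀ (by norm_num) (by norm_num) this
  subst h1
  have h2 : (-1 : ℂ) ^ a.val = (-1) ^ b.val :=
    mul_left_cancel₀ (pow_ne_zero p (two_ne_zero (α := ℂ))) h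
  have h3 : a = b := by
    fin_cases a <;> fin_cases b
    · rfl
    · exfalso; revert h2; change ¬ ((-1 : ℂ) ^ 0 = (-1) ^ 1); norm_num
    · exfalso; revert h2; change ¬ ((-1 : ℂ) ^ 1 = (-1) ^ 0); norm_num
    · rfl
  rw [h3]

/-- The eigenvalues are the integers `± 2 ^ p`, and their images in ℂ are already distinct. This is
where the embedding of the ground field separates the pieces. -/
theorem bidegEigenvalue_injective_of_algebra (K : Type*) [Field K] [Algebra K ℂ] :
    Function.Injective (bidegEigenvalue K) := by
  intro k l h
  apply bidegEigenvalue_injective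
  have := congrArg (algebraMap K ℂ) h
  simp only [bidegEigenvalue, map_mul, map_pow, map_neg, map_one, map_ofNat] at this ⊢
  exact this

theorem formPiece_eigen {k : ℕ × ZMod 2} {w : FormAlg} (hw : w ∈ formPiece k.1 k.2) :
    degScale 2 (parityInv w) = bidegEigenvalue ℂ k • w := by
  rw [hw.2, map_smul, hw.1, smul_smul, bidegEigenvalue, mul_comm]

/-- The pieces lie in eigenspaces of one operator for distinct eigenvalues. -/
theorem iSupIndep_formPiece : iSupIndep fun k : ℕ × ZMod 2 => formPiece k.1 k.2 :=
  ((Module.End.eigenspaces_iSupIndep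
    ((degScale 2).comp parityInv).toLinearMap).comp bidegEigenvalue_injective).mono
      fun _ _ hw => Module.End.mem_eigenspace_iff.2 (formPiece_eigen hw)

theorem rescale_comm {φ ψ : SmoothFn →ₐ[ℂ] SmoothFn} (h : ∀ f, φ (ψ f) = ψ (φ f))
    (a a' : OddGen → ℂ) (b b' : EvenGen → ℂ) (w : FormAlg) :
    rescale φ a b (rescale ψ a' b' w) = rescale ψ a' b' (rescale φ a b w) := by
  have : (rescale φ a b).comp (rescale ψ a' b') = (rescale ψ a' b').comp (rescale φ a b) :=
    formAlg_algHom_ext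
      (fun f => by simp [rescale_ofFn, h])
      (fun k => by simp [rescale_oddVar, smul_smul, mul_comm])
      (fun k => by simp [rescale_evenVar, smul_smul, mul_comm])
  exact DFunLike.congr_fun this w

theorem projScale_degScale (t s : ℂˣ) (c : ℂ) (w : FormAlg) :
    projScale t s (degScale c w) = degScale c (projScale t s w) :=
  rescale_comm (φ := pullScale t s) (ψ := AlgHom.id ℂ _) (fun _ => rfl) (oddWeight t s) _
    (evenWeight t s) _ w

theorem projScale_parityInv (t s : ℂˣ) (w : FormAlg) :
    projScale t s (parityInv w) = parityInv (projScale t s w) :=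
  rescale_comm (φ := pullScale t s) (ψ := AlgHom.id ℂ _) (fun _ => rfl) (oddWeight t s) _
    (evenWeight t s) _ w

/-- Rescaling the homogeneous coordinates preserves the bigrading, so uniqueness of the
decomposition makes the components of an invariant form invariant. -/
theorem iSup_omegaPiece : ⨆ k : ℕ × ZMod 2, OmegaPiece k.1 k.2 = ⊤ := by
  rw [eq_top_iff]
  rintro w -
  have hw : (w : FormAlg) ∈ ⨆ k : ℕ × ZMod 2, formPiece k.1 k.2 := by
    rw [iSup_formPiece]; trivial
  obtain ⟨f, hf, hsum⟩ := (Submodule.mem_iSup_iff_exists_finsupp _ _).1 hw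
  -- The rescaled components and the original ones lie in the same pieces and have the same sum `w`.
  have hfix (t s : ℂˣ) (k : ℕ × ZMod 2) (hk : k ∈ f.support) : projScale t s (f k) = f k := by
    refine (iSupIndep_iff_finsetSum_eq_imp_eq _).1 iSupIndep_formPiece f.support
      (fun k => projScale t s (f k)) f (fun k _ => ⟨⟨fun c => ?_, ?_⟩, hf k⟩) ?_ k hk
    · rw [← projScale_degScale, (hf k).1, map_smul]
    · rw [← projScale_parityInv, (hf k).2, map_smul]
    · rw [← map_sum]
      change projScale t s (f.sum fun _ x => x) = f.sum fun _ x => x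
      rw [hsum]; exact w.2 t s
  have hmem (k : ℕ × ZMod 2) : f k ∈ Omega := fun t s => by
    by_cases hk : k ∈ f.support
    · exact hfix t s k hk
    · rw [Finsupp.notMem_support_iff.1 hk, map_zero]
  have hw' : w = ∑ k ∈ f.support, (⟨f k, hmem k⟩ : Omega) := by
    apply Subtype.ext
    rw [AddSubmonoidClass.coe_finsetSum, ← hsum]; rfl
  rw [hw']
  exact sum_mem fun k _ => Submodule.mem_iSup_of_mem k (mem_omegaPiece.2 (hf k))

/-- `parityInv` followed by `degScale 2` on invariant forms. -/
def bidegOp : Omega →ₗ[ℂ] Omega :=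
  LinearMap.restrict ((degScale 2).comp parityInv).toLinearMap (p := Omega.toSubmodule)
    (q := Omega.toSubmodule) fun w hw t s => by
      change projScale t s (degScale 2 (parityInv w)) = degScale 2 (parityInv w)
      rw [projScale_degScale, projScale_parityInv, hw t s]

theorem bidegOp_apply {k : ℕ × ZMod 2} {w : Omega} (hw : w ∈ OmegaPiece k.1 k.2) :
    bidegOp w = bidegEigenvalue ℂ k • w :=
  Subtype.ext (formPiece_eigen (mem_omegaPiece.1 hw))

theorem iSupIndep_omegaPiece : iSupIndep fun k : ℕ × ZMod 2 => OmegaPiece k.1 k.2 :=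
  ((Module.End.eigenspaces_iSupIndep bidegOp).comp bidegEigenvalue_injective).mono
    fun _ _ hw => Module.End.mem_eigenspace_iff.2 (bidegOp_apply hw)

theorem isComplex_of_mem {d : Omega →ₗ[ℂ] Omega}
    (hmem : ∀ p a, ∀ x ∈ OmegaPiece p a, d x ∈ OmegaPiece (p + 1) a) (hd : ∀ x, d (d x) = 0) :
    IsComplex OmegaPiece d :=
  ⟨DirectSum.isInternal_submodule_of_iSupIndep_of_iSup_eq_top iSupIndep_omegaPiece
    iSup_omegaPiece, hmem, hd⟩

theorem coe_dbar (w : Omega) : (dbar w : FormAlg) = dbarHom w := rfl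

theorem coe_dbarTw (w : Omega) : (dbarTw w : FormAlg) = dbarTwHom w := rfl

theorem isComplex_dbar : IsComplex OmegaPiece dbar := by
  refine isComplex_of_mem (fun p a x hx => ?_) fun x => Subtype.ext ?_
  · rw [mem_omegaPiece, coe_dbar]; exact dbarHom_mem_formPiece hx
  · rw [coe_dbar, coe_dbar]; exact LinearMap.congr_fun dbarHom_mul_self x.1

theorem isComplex_dbarTw : IsComplex OmegaPiece dbarTw := by
  refine isComplex_of_mem (fun p a x hx => ?_) fun x => Subtype.ext ?_
  · rw [mem_omegaPiece, coe_dbarTw]; exact dbarTwHom_mem_formPiece hx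
  · rw [coe_dbarTw, coe_dbarTw]; exact LinearMap.congr_fun dbarTwHom_mul_self x.1

/-! ### The isomorphism of the algebras of superforms -/

/-- `ê'^F - ê^F`. -/
def coframeShift : FormAlg := -∑ A, coframe A * coefShift A

theorem coframePrime_eq (A : Dir) :
    coframePrime A = coframe A + if A = .F then coframeShift else 0 := by
  cases A with
  | F =>
    rw [if_pos rfl, coframeShift, sum_dir]
    simp [coframePrime, coefShift]
    abel
  | _ => simp [coframePrime]

theorem hasPar_coframeShift : HasPar 1 coframeShift :=
  (HasPar.sum fun A => ((hasPar_coframe A).mul (hasPar_coefShift A)).congr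
    (by cases A <;> norm_num [Dir.par])).neg

theorem oddDer_formF_coefShift (A : Dir) : oddDer .formF (coefShift A) = 0 := by
  cases A with
  | F => exact map_zero _
  | L =>
    exact oddDer_formF_sum fun i =>
      oddDer_formF_mul (oddDer_formF_thetaT i) (oddDer_formF_etaC i)
  | R =>
    exact oddDer_formF_neg <| oddDer_formF_sum fun i =>
      oddDer_formF_mul (oddDer_formF_thetaC i) (oddDer_formF_etaT i)
  | up i => exact oddDer_formF_neg (oddDer_formF_thetaT i)
  | dn i => exact oddDer_formF_neg (oddDer_formF_etaT i)

theorem oddDer_formF_coframe (A : Dir) :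
    oddDer .formF (coframe A) = if A = .F then 1 else 0 := by
  cases A <;> simp [coframe, oddDer_oddVar]

theorem oddDer_formF_coframeShift : oddDer .formF coframeShift = 0 :=
  oddDer_formF_neg <| oddDer_formF_sum fun A => by
    by_cases hA : A = .F
    · subst hA; rw [show coefShift .F = 0 from rfl, mul_zero, map_zero]
    · exact oddDer_formF_mul (by rw [oddDer_formF_coframe, if_neg hA]) (oddDer_formF_coefShift A)

/-- The derivation with `e^F ↦ ê'^F - ê^F` that annihilates the other generators. -/
def shiftDer : Op := mulBy coframeShift * oddDer .formF

theorem shiftDer_apply (w : FormAlg) : shiftDer w = coframeShift * oddDer .formF w := rfl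

theorem isSuperDer_shiftDer : IsSuperDer 0 shiftDer :=
  ((isSuperDer_oddDer _).mulBy_mul hasPar_coframeShift).congr (gradePow_two_mul 1)

/-- The shift of the coframe is free of `e^F`, so a second contraction can hit only what the first
left over, and contracting twice gives zero. -/
theorem shiftDer_mul_self : shiftDer * shiftDer = 0 := by
  ext w
  have h : oddDer .formF (oddDer .formF w) = 0 := LinearMap.congr_fun (oddDer_mul_self _) w
  rw [Module.End.mul_apply, shiftDer_apply, shiftDer_apply,
    oddDer_formF_mul oddDer_formF_coframeShift h, mul_zero, LinearMap.zero_apply]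

/-- The odd element `coframeShift` occurs twice. For a derivation this is exactly what makes `1 +
shiftDer` multiplicative. -/
theorem shiftDer_mul_shiftDer_apply (x y : FormAlg) : shiftDer x * shiftDer y = 0 := by
  rw [shiftDer_apply, shiftDer_apply, hasPar_coframeShift.odd_mul, mul_assoc, ← mul_assoc _ _
    (oddDer .formF y), hasPar_coframeShift.mul_self_odd, zero_mul, mul_zero]

theorem twistInv_mul_apply (x y : FormAlg) :
    twistInv (x * y) = twistInv x * twistInv y :=
  Module.End.exp_mul_of_derivation ℂ FormAlg (-twistField) (fun x y => by
    rw [LinearMap.neg_apply, LinearMap.neg_apply, LinearMap.neg_apply, isSuperDer_twistField,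
      gradePow_zero, mul_neg, neg_mul, neg_add, add_comm]) isNilpotent_twistField.neg x y

theorem neg_twistField_mul_mulBy {x : FormAlg} (hx : IsConst x) :
    -twistField * mulBy x = mulBy x * -twistField := by
  rw [op_neg_mul, op_mul_neg, twistField_mul_mulBy hx]

theorem twistInv_mul_mulBy {x : FormAlg} (hx : IsConst x) :
    twistInv * mulBy x = mulBy x * twistInv :=
  exp_mul_comm isNilpotent_twistField.neg (neg_twistField_mul_mulBy hx)

theorem exp_apply_of_apply_eq_zero {T : Op} (hT : IsNilpotent T) {x : FormAlg} (hx : T x = 0) :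
    IsNilpotent.exp T x = x := by
  obtain ⟨k, hk⟩ := hT
  have hk' : T ^ (k + 1) = 0 := by rw [pow_succ, hk, zero_mul]
  rw [IsNilpotent.exp_eq_sum hk', Finset.sum_range_succ', LinearMap.add_apply,
    LinearMap.sum_apply, Finset.sum_eq_zero]
  · simp
  · intro i _
    rw [LinearMap.smul_apply, pow_succ, Module.End.mul_apply, hx, map_zero, smul_zero]

theorem twistInv_of_isConst {x : FormAlg} (hx : IsConst x) : twistInv x = x :=
  exp_apply_of_apply_eq_zero isNilpotent_twistField.neg
    (by rw [LinearMap.neg_apply, twistField_of_isConst hx, neg_zero])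

theorem twistInv_one : twistInv 1 = 1 :=
  twistInv_of_isConst fun a b => (isSuperDer_pX a b).map_one

theorem oddDer_formF_mul_twistField :
    oddDer .formF * twistField = twistField * oddDer .formF := by
  rw [twistField_eq, (isSuperDer_oddDer .formF).mul_transOp (commute_oddDer_pX _) hasPar_coefX]
  simp [oddDer_formF_coefX, transOp_zero]

theorem oddDer_formF_twistInv (x : FormAlg) :
    oddDer .formF (twistInv x) = twistInv (oddDer .formF x) := by
  have h : -twistField * oddDer .formF = oddDer .formF * -twistField := by
    rw [op_neg_mul, op_mul_neg, oddDer_formF_mul_twistField]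
  exact (LinearMap.congr_fun (exp_mul_comm isNilpotent_twistField.neg h) x).symm

/-- The isomorphism `v̂^A f_A ↦ ê'^A g⁻¹ f_A` as an operator. -/
def untwistOp : Op := (1 + shiftDer) * twistInv

theorem untwistOp_apply (w : FormAlg) :
    untwistOp w = twistInv w + shiftDer (twistInv w) := rfl

theorem untwistOp_inv_right : untwistOp * (twist * (1 - shiftDer)) = 1 := by
  rw [untwistOp, mul_assoc, ← mul_assoc twistInv, twistInv_mul_twist, one_mul, add_mul, one_mul,
    mul_sub, mul_one, shiftDer_mul_self, sub_zero, sub_add_cancel]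

theorem untwistOp_inv_left : twist * (1 - shiftDer) * untwistOp = 1 := by
  rw [untwistOp, mul_assoc, ← mul_assoc (1 - shiftDer), sub_mul, one_mul, mul_add, mul_one,
    shiftDer_mul_self, add_zero, add_sub_cancel_right, one_mul,
    twist_mul_twistInv]

theorem add_shiftDer_mul (x y : FormAlg) :
    x * y + shiftDer (x * y) = (x + shiftDer x) * (y + shiftDer y) := by
  rw [isSuperDer_shiftDer, gradePow_zero, mul_add, add_mul, add_mul, shiftDer_mul_shiftDer_apply]
  abel

theorem untwistOp_mul (x y : FormAlg) : untwistOp (x * y) = untwistOp x * untwistOp y := by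
  rw [untwistOp_apply, twistInv_mul_apply, add_shiftDer_mul]; rfl

theorem untwistOp_one : untwistOp 1 = 1 := by
  rw [untwistOp_apply, twistInv_one, isSuperDer_shiftDer.map_one, add_zero]

/-- The algebra isomorphism `v̂^A f_A ↦ ê'^A g⁻¹ f_A`. -/
def untwist : FormAlg ≃ₐ[ℂ] FormAlg :=
  AlgEquiv.ofLinearEquiv
    (LinearEquiv.ofLinearMap untwistOp (twist * (1 - shiftDer)) untwistOp_inv_right untwistOp_inv_left)
    untwistOp_one untwistOp_mul

theorem untwist_apply (w : FormAlg) : untwist w = twistInv w + shiftDer (twistInv w) := rfl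

theorem untwist_of_oddDer_eq_zero {w : FormAlg} (hw : oddDer .formF w = 0) :
    untwist w = twistInv w := by
  rw [untwist_apply, shiftDer_apply, oddDer_formF_twistInv, hw, map_zero, mul_zero, add_zero]

/-- Take the scaling rule of the contraction at `c = 0`: the superfunction is fixed, while the
weight in front is zero. -/
theorem IsSuperFn.oddDer_formF {f : FormAlg} (hf : IsSuperFn f) : oddDer .formF f = 0 := by
  have h := biScale_oddDer (u := 1) (c := 0) .formF f
  rw [← degScale_eq, hf 0] at h
  rw [← h]
  exact zero_smul _ _

theorem untwist_coframe (A : Dir) : untwist (coframe A) = coframePrime A := by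
  rw [untwist_apply, twistInv_of_isConst (isConst_coframe A), shiftDer_apply, oddDer_formF_coframe,
    coframePrime_eq]
  by_cases hA : A = .F <;> simp [hA]

/-- The isomorphism is built from the twist exponent and the coframe shift alone, so any rescaling
that leaves both invariant commutes with it. This serves both gradings and the homogeneity. -/
theorem untwist_comm {ρ : FormAlg →ₐ[ℂ] FormAlg} (hX : OpScales ρ 1 twistField)
    (hN : OpScales ρ 1 shiftDer) (w : FormAlg) : ρ (untwist w) = untwist (ρ w) := by
  have h1 : OpScales ρ 1 (-twistField) := fun w => by
    rw [LinearMap.neg_apply, LinearMap.neg_apply, map_neg, hX, smul_neg]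
  have h2 : OpScales ρ 1 untwistOp :=
    ((OpScales.one.add hN).mul (h1.exp isNilpotent_twistField.neg)).congr (one_mul 1)
  exact (h2 w).trans (one_smul ℂ _)

theorem eltScales_coframeShift {u c : ℂ} (hu : u * u = 1) :
    EltScales (biScale u c) c coframeShift :=
  (EltScales.sum fun A => ((eltScales_coframe A).mul (eltScales_coefShift hu A)).congr
    (by rw [mul_assoc, ← mul_pow, hu, one_pow, mul_one])).neg

theorem opScales_shiftDer {u c : ℂ} (hu : u * u = 1) : OpScales (biScale u c) 1 shiftDer :=
  opScales_mulBy_mul_oddDer_formF ((eltScales_coframeShift hu).congr (one_mul c).symm)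

theorem degScale_untwist (c : ℂ) (w : FormAlg) : degScale c (untwist w) = untwist (degScale c w) := by
  rw [degScale_eq]
  exact untwist_comm (opScales_twistField (one_mul 1)) (opScales_shiftDer (one_mul 1)) w

theorem parityInv_untwist (w : FormAlg) : parityInv (untwist w) = untwist (parityInv w) := by
  rw [parityInv_eq]
  exact untwist_comm (opScales_twistField (by norm_num)) (opScales_shiftDer (by norm_num)) w

theorem gradeInv_untwist (w : FormAlg) : gradeInv (untwist w) = untwist (gradeInv w) := by
  rw [gradeInv_eq, AlgHom.comp_apply, AlgHom.comp_apply, parityInv_untwist, degScale_untwist]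

/-- In each summand the weights of the odd coefficient and of the field are inverse to each other,
so the exponent descends to the projective lines. -/
theorem hasWt_twistField (t s : ℂˣ) : HasWt t s 1 twistField := by
  have ht := t.ne_zero
  have hs := s.ne_zero
  have h1 : EltWt t s ((s : ℂ)⁻¹ * t) (∑ i, thetaT i * etaC i) :=
    EltWt.sum fun i => (eltWt_thetaT i).mul (eltWt_etaC i)
  have h2 : EltWt t s (s * (t : ℂ)⁻¹) (∑ i, thetaC i * etaT i) :=
    EltWt.sum fun i => (eltWt_thetaC i).mul (eltWt_etaT i)
  exact ((h1.mulBy.mul hasWt_fieldW).congr (by field_simp)).add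
    ((h2.mulBy.mul hasWt_fieldWHat).congr (by field_simp))

theorem eltWt_coefShift (t s : ℂˣ) (A : Dir) :
    EltWt t s (dirWeight t s A * (dirWeight t s .F)⁻¹) (coefShift A) := by
  have ht := t.ne_zero
  have hs := s.ne_zero
  cases A with
  | F => exact EltWt.zero
  | L =>
    exact (EltWt.sum fun i => (eltWt_thetaT i).mul (eltWt_etaC i)).congr
      (by simp only [dirWeight]; field_simp)
  | R =>
    exact (EltWt.sum fun i => (eltWt_thetaC i).mul (eltWt_etaT i)).neg.congr
      (by simp only [dirWeight]; field_simp)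
  | up i => exact (eltWt_thetaT i).neg.congr (by simp only [dirWeight]; field_simp)
  | dn i => exact (eltWt_etaT i).neg.congr (by simp only [dirWeight]; field_simp)

theorem hasWt_shiftDer (t s : ℂˣ) : HasWt t s 1 shiftDer := by
  have h : EltWt t s (dirWeight t s .F)⁻¹ coframeShift :=
    EltWt.neg <| EltWt.sum fun A => ((eltWt_coframe A).mul (eltWt_coefShift t s A)).congr
      (by rw [← mul_assoc, inv_mul_cancel₀ (dirWeight_ne_zero A), one_mul])
  exact (h.mulBy.mul (hasWt_coframeDer .F)).congr (inv_mul_cancel₀ (dirWeight_ne_zero .F))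

theorem projScale_untwist (t s : ℂˣ) (w : FormAlg) :
    projScale t s (untwist w) = untwist (projScale t s w) :=
  untwist_comm (hasWt_twistField t s) (hasWt_shiftDer t s) w

/-! ### The isomorphism intertwines the differentials -/

/-- When `y` is free of `e^F`, the operator `1 + N` only exchanges `e^F` for `ê'^F` in front of
`Ê'_F`, and the primed sum equals the unprimed one. -/
theorem frameDer_framePrime (y : FormAlg) (hy : oddDer .formF y = 0) :
    frameDer framePrime y + shiftDer (frameDer framePrime y) = frameDer frameCR y := by
  have h1 (A : Dir) : oddDer .formF (framePrime A y) = 0 := by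
    have := oddDer_formF_mul_frame isSplit_framePrime (fun A a b => by
      rw [map_add, oddDer_formF_coefCR, oddDer_formF_mul (oddDer_formF_coefShift A)
        (show oddDer .formF (coefF a b) = 0 from oddDer_ofFn _ _), add_zero]) A
    rw [← Module.End.mul_apply, this, LinearMap.smul_apply, Module.End.mul_apply, hy, map_zero,
      smul_zero]
  have h2 (A : Dir) : coframe A * framePrime A y + shiftDer (coframe A * framePrime A y) =
      coframePrime A * framePrime A y := by
    rw [add_shiftDer_mul, shiftDer_apply (framePrime A y), h1, mul_zero, add_zero, shiftDer_apply,
      oddDer_formF_coframe, coframePrime_eq]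
    by_cases hA : A = .F <;> simp [hA]
  have h3 := LinearMap.congr_fun sum_coframePrime_mul_framePrime y
  simp only [LinearMap.sum_apply, Module.End.mul_apply, mulBy_apply] at h3
  simp only [frameDer, LinearMap.sum_apply, Module.End.mul_apply, mulBy_apply, map_sum]
  rw [← Finset.sum_add_distrib, ← h3]
  exact Finset.sum_congr rfl fun A _ => h2 A

theorem twistInv_frameDer_frameTw (x : FormAlg) :
    twistInv (frameDer frameTw x) = frameDer framePrime (twistInv x) := by
  have h (A : Dir) : twistInv * (mulBy (coframe A) * frameTw A) =
      mulBy (coframe A) * framePrime A * twistInv := by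
    rw [← mul_assoc, twistInv_mul_mulBy (isConst_coframe A), mul_assoc, twistInv_mul_frameTw,
      mul_assoc]
  have h2 : twistInv * frameDer frameTw = frameDer framePrime * twistInv := by
    simp only [frameDer, Finset.mul_sum, Finset.sum_mul, h]
  exact LinearMap.congr_fun h2 x

theorem frameDer_of_isConst {E : Dir → Op} {c : Dir → Fin 2 → Fin 2 → FormAlg}
    (h : ∀ A, IsSplit A.par (E A) (derPart A) (c A)) {x : FormAlg} (hx : IsConst x) :
    frameDer E x = ∑ A, coframe A * derPart A x := by
  simp only [frameDer, LinearMap.sum_apply, Module.End.mul_apply, mulBy_apply, (h _).apply hx]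

theorem frameDer_coframe {E : Dir → Op} {c : Dir → Fin 2 → Fin 2 → FormAlg}
    (h : ∀ A, IsSplit A.par (E A) (derPart A) (c A)) (A : Dir) : frameDer E (coframe A) = 0 := by
  simp [frameDer_of_isConst h (isConst_coframe A), derPart_coframe]

/-- This is the structure equation of the changed coframe: it says that the CR differential of `ê'^F
= ê^F + coframeShift` is minus the twisted curvature. -/
theorem frameDer_coframeShift :
    frameDer frameCR coframeShift = curvature structCR - curvature structTw := by
  have hS (A : Dir) : frameDer frameCR (coframe A * coefShift A) =
      (-1 : ℂ) ^ (1 + A.par) • (coframe A * ∑ B, coframe B * derPart B (coefShift A)) := by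
    rw [isSuperDer_frameDer isSplit_frameCR, frameDer_coframe isSplit_frameCR, zero_mul, zero_add,
      (hasPar_coframe A).gradePow, one_mul, smul_mul_assoc,
      frameDer_of_isConst isSplit_frameCR (isConst_coefShift A)]
  have hRL : coframe .R * coframe .L = -(coframe .L * coframe .R) := oddVar_anticomm _ _
  have hup (i : Fin 3) (w : FormAlg) : coframe (.up i) * w = w * coframe (.up i) :=
    commute_evenVar _ w
  have hdn (i : Fin 3) (w : FormAlg) : coframe (.dn i) * w = w * coframe (.dn i) :=
    commute_evenVar _ w
  have e1 : ∑ B, coframe B * derPart B (coefShift .L) =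
      -(coframe .R * ∑ i, thetaC i * etaC i) + ∑ j, coframe (.dn j) * etaC j := by
    simp only [coefShift, derPart_thetaT_etaC, sum_dir]
    simp
  have e2 : ∑ B, coframe B * derPart B (coefShift .R) =
      coframe .L * ∑ i, thetaC i * etaC i + ∑ j, coframe (.up j) * thetaC j := by
    simp only [coefShift, map_neg, derPart_thetaC_etaT, sum_dir]
    simp
  have e3 (i : Fin 3) : ∑ B, coframe B * derPart B (coefShift (.up i)) =
      coframe .R * thetaC i - coframe (.dn i) := by
    simp only [coefShift, map_neg, derPart_thetaT, sum_dir]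
    simp [sub_eq_add_neg]
  have e4 (i : Fin 3) : ∑ B, coframe B * derPart B (coefShift (.dn i)) =
      coframe .L * etaC i - coframe (.up i) := by
    simp only [coefShift, map_neg, derPart_etaT, sum_dir]
    simp [sub_eq_add_neg]
  -- Each mixed bosonic-fermionic term arises twice, once from either label; brought to a common
  -- order, the two copies cancel.
  have t1 : coframe .R * ∑ j, coframe (.up j) * thetaC j =
      ∑ j, coframe (.up j) * (coframe .R * thetaC j) := by
    rw [Finset.mul_sum]
    exact Finset.sum_congr rfl fun j _ => by rw [← mul_assoc, ← hup, mul_assoc]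
  have t2 : coframe .L * ∑ j, coframe (.dn j) * etaC j =
      ∑ j, coframe (.dn j) * (coframe .L * etaC j) := by
    rw [Finset.mul_sum]
    exact Finset.sum_congr rfl fun j _ => by rw [← mul_assoc, ← hdn, mul_assoc]
  have t3 : ∑ i, coframe (.dn i) * coframe (.up i) = ∑ i, coframe (.up i) * coframe (.dn i) :=
    Finset.sum_congr rfl fun i _ => hdn i _
  rw [coframeShift, map_neg, map_sum]
  simp only [hS]
  rw [sum_dir]
  simp only [e1, e2, e3, e4]
  rw [show coefShift .F = 0 from rfl]
  simp only [map_zero, mul_zero, Finset.sum_const_zero, smul_zero, Dir.par, add_zero, pow_one,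
    one_add_one_eq_two, neg_one_sq, one_smul, neg_one_smul, mul_add, mul_sub, mul_neg, neg_neg,
    neg_add, Finset.sum_sub_distrib, t1, t2, t3, zero_add, ← mul_assoc (coframe .R), hRL, neg_mul]
  rw [curvature_structCR, curvature_structTw]
  simp only [two_smul, ← mul_assoc]
  abel

theorem isConst_curvature_structTw : IsConst (curvature structTw) := by
  rw [curvature_structTw]
  exact (((isConst_coframe _).mul (isConst_coframe _)).mul isConst_thetaC_etaC).smul _

/-- Both sides obey one Leibniz rule along the isomorphism, so agreement on generators suffices.
Only `e^F` meets the curvature terms; all other generators are handled by conjugating the frame and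
changing the coframe. -/
theorem untwist_dbarTwHom (w : FormAlg) : untwist (dbarTwHom w) = dbarHom (untwist w) := by
  have hker (x : FormAlg) (hx : oddDer .formF x = 0) :
      untwist (dbarTwHom x) = dbarHom (untwist x) := by
    have hy : oddDer .formF (twistInv x) = 0 := by rw [oddDer_formF_twistInv, hx, map_zero]
    have e1 : dbarTwHom x = frameDer frameTw x := by
      rw [dbarTwHom_eq, LinearMap.sub_apply, Module.End.mul_apply, hx, map_zero, sub_zero]
    have e2 : dbarHom (twistInv x) = frameDer frameCR (twistInv x) := by
      rw [dbarHom_eq, LinearMap.sub_apply, Module.End.mul_apply, hy, map_zero, sub_zero]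
    rw [untwist_of_oddDer_eq_zero hx, e1, e2, untwist_apply, twistInv_frameDer_frameTw,
      frameDer_framePrime _ hy]
  induction w using formAlg_gen_induction with
  | ofFn f => exact hker _ (oddDer_ofFn _ _)
  | oddVar k =>
    by_cases hk : OddGen.formF = k
    · subst hk
      change untwist (dbarTwHom (coframe .F)) = dbarHom (untwist (coframe .F))
      -- On the right, `e^F` contributes minus the CR curvature and the shift contributes the
      -- difference of the curvatures. On the left is minus the twisted curvature, which the
      -- isomorphism fixes because it is x-independent and free of `e^F`.
      rw [untwist_coframe, coframePrime_eq, if_pos rfl, map_add, dbarHom_eq, dbarTwHom_eq]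
      simp only [LinearMap.sub_apply, Module.End.mul_apply, mulBy_apply, oddDer_formF_coframe,
        oddDer_formF_coframeShift, frameDer_coframeShift, frameDer_coframe isSplit_frameCR,
        frameDer_coframe isSplit_frameTw, if_true, mul_one, mul_zero, zero_sub, sub_zero, map_neg]
      rw [untwist_of_oddDer_eq_zero oddDer_formF_curvature_structTw,
        twistInv_of_isConst isConst_curvature_structTw]
      abel
    · exact hker _ (by rw [oddDer_oddVar, if_neg hk])
  | evenVar k => exact hker _ (oddDer_evenVar _ _)
  | add u v hu hv => simp only [map_add, hu, hv]
  | mul u v hu hv =>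
    rw [isSuperDer_dbarTwHom, map_add, map_mul, map_mul, map_mul, isSuperDer_dbarHom, hu, hv,
      gradePow_one, gradePow_one, gradeInv_untwist]

/-! ### The isomorphism of the global forms -/

theorem algEquiv_symm_comm {ρ : FormAlg →ₐ[ℂ] FormAlg} {Φ : FormAlg ≃ₐ[ℂ] FormAlg}
    (h : ∀ w, ρ (Φ w) = Φ (ρ w)) (w : FormAlg) : ρ (Φ.symm w) = Φ.symm (ρ w) := by
  apply Φ.injective
  rw [← h, Φ.apply_symm_apply, Φ.apply_symm_apply]

theorem untwist_mem {w : FormAlg} (hw : w ∈ Omega) : untwist w ∈ Omega := fun t s => by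
  rw [projScale_untwist, hw t s]

theorem untwist_symm_mem {w : FormAlg} (hw : w ∈ Omega) : untwist.symm w ∈ Omega := fun t s => by
  rw [algEquiv_symm_comm (projScale_untwist t s), hw t s]

/-- The isomorphism `φ` of the algebras of global sections. -/
def untwistOmega : Omega ≃ₐ[ℂ] Omega :=
  AlgEquiv.ofAlgHom
    (AlgHom.codRestrict (untwist.toAlgHom.comp Omega.val) Omega fun w => untwist_mem w.2)
    (AlgHom.codRestrict (untwist.symm.toAlgHom.comp Omega.val) Omega fun w => untwist_symm_mem w.2)
    (AlgHom.ext fun w => Subtype.ext (untwist.apply_symm_apply w.1))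
    (AlgHom.ext fun w => Subtype.ext (untwist.symm_apply_apply w.1))

theorem coe_untwistOmega (w : Omega) : (untwistOmega w : FormAlg) = untwist w := rfl

theorem untwist_mem_formPiece {p : ℕ} {a : ZMod 2} {w : FormAlg} (hw : w ∈ formPiece p a) :
    untwist w ∈ formPiece p a :=
  ⟨fun c => by rw [degScale_untwist, hw.1, map_smul],
    by rw [parityInv_untwist, hw.2, map_smul]⟩

theorem untwist_symm_mem_formPiece {p : ℕ} {a : ZMod 2} {w : FormAlg} (hw : w ∈ formPiece p a) :
    untwist.symm w ∈ formPiece p a :=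
  ⟨fun c => by rw [algEquiv_symm_comm (degScale_untwist c), hw.1, map_smul],
    by rw [algEquiv_symm_comm parityInv_untwist, hw.2, map_smul]⟩

theorem untwistOmega_mem {p : ℕ} {a : ZMod 2} {w : Omega} (hw : w ∈ OmegaPiece p a) :
    untwistOmega w ∈ OmegaPiece p a :=
  mem_omegaPiece.2 (untwist_mem_formPiece (mem_omegaPiece.1 hw))

theorem untwistOmega_symm_mem {p : ℕ} {a : ZMod 2} {w : Omega} (hw : w ∈ OmegaPiece p a) :
    untwistOmega.symm w ∈ OmegaPiece p a :=
  mem_omegaPiece.2 (untwist_symm_mem_formPiece (mem_omegaPiece.1 hw))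

theorem map_untwistOmega_omegaPiece (p : ℕ) (a : ZMod 2) :
    (OmegaPiece p a).map untwistOmega.toLinearMap = OmegaPiece p a := by
  apply le_antisymm
  · rintro _ ⟨w, hw, rfl⟩; exact untwistOmega_mem hw
  · intro w hw
    exact ⟨untwistOmega.symm w, untwistOmega_symm_mem hw, untwistOmega.apply_symm_apply w⟩

theorem untwistOmega_dbarTw (w : Omega) : untwistOmega (dbarTw w) = dbar (untwistOmega w) := by
  apply Subtype.ext
  rw [coe_untwistOmega, coe_dbarTw, coe_dbar, coe_untwistOmega, untwist_dbarTwHom]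

/-! ### The differential graded Lie algebras -/

theorem omegaPiece_mul {p q : ℕ} {a b : ZMod 2} {v w : Omega} (hv : v ∈ OmegaPiece p a)
    (hw : w ∈ OmegaPiece q b) : v * w ∈ OmegaPiece (p + q) (a + b) :=
  mem_omegaPiece.2 (formPiece_mul (mem_omegaPiece.1 hv) (mem_omegaPiece.1 hw))

theorem omegaPiece_mul_comm {p q : ℕ} {a b : ZMod 2} {v w : Omega} (hv : v ∈ OmegaPiece p a)
    (hw : w ∈ OmegaPiece q b) : v * w = (-1 : ℂ) ^ ((p + a.val) * (q + b.val)) • (w * v) :=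
  Subtype.ext ((hasPar_of_mem_formPiece (mem_omegaPiece.1 hv)).mul_comm
    (hasPar_of_mem_formPiece (mem_omegaPiece.1 hw)))

theorem IsSuperDer.leibniz_formPiece {D : Op} (hD : IsSuperDer 1 D) {p : ℕ} {a : ZMod 2}
    {v : FormAlg} (hv : v ∈ formPiece p a) (w : FormAlg) :
    D (v * w) = D v * w + (-1 : ℂ) ^ (p + a.val) • (v * D w) := by
  rw [hD, (hasPar_of_mem_formPiece hv).gradePow, one_mul, smul_mul_assoc]

theorem dbar_mul {p : ℕ} {a : ZMod 2} {v : Omega} (hv : v ∈ OmegaPiece p a) (w : Omega) :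
    dbar (v * w) = dbar v * w + (-1 : ℂ) ^ (p + a.val) • (v * dbar w) :=
  Subtype.ext (isSuperDer_dbarHom.leibniz_formPiece (mem_omegaPiece.1 hv) w.1)

theorem dbarTw_mul {p : ℕ} {a : ZMod 2} {v : Omega} (hv : v ∈ OmegaPiece p a) (w : Omega) :
    dbarTw (v * w) = dbarTw v * w + (-1 : ℂ) ^ (p + a.val) • (v * dbarTw w) :=
  Subtype.ext (isSuperDer_dbarTwHom.leibniz_formPiece (mem_omegaPiece.1 hv) w.1)

/-- Signs of forms are complex scalars, those of the Lie algebra structure lie in the ground field;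
a sign acts in the same way from either. -/
theorem neg_one_pow_smul_eq {K K' M : Type*} [Ring K] [Ring K'] [AddCommGroup M] [Module K M]
    [Module K' M] (n : ℕ) (x : M) : (-1 : K) ^ n • x = (-1 : K') ^ n • x := by
  rcases Nat.even_or_odd n with h | h <;> simp [h.neg_one_pow]

/-! ### Tensoring with the Lie algebra -/

section Tensor

variable {𝕜 𝔤 : Type*} [Field 𝕜] [Algebra 𝕜 ℂ] [LieRing 𝔤] [LieAlgebra 𝕜 𝔤]

theorem tmul_mem_piece (δ : Omega →ₗ[ℂ] Omega) {p : ℕ} {a : ZMod 2} {v : Omega}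
    (hv : v ∈ OmegaPiece p a) (x : 𝔤) : v ⊗ₜ[𝕜] x ∈ (tensorLie 𝕜 𝔤 δ).piece p a :=
  ⟨(⟨v, hv⟩ : OmegaPiece p a) ⊗ₜ[𝕜] x, rfl⟩

-- The pieces are ranges of tensored inclusions, so they consist of sums of pure tensors with
-- homogeneous form factor. Identities that are additive need checking on these alone.
@[elab_as_elim]
theorem tensorLie_piece_induction {δ : Omega →ₗ[ℂ] Omega} {p : ℕ} {a : ZMod 2}
    {P : Omega ⊗[𝕜] 𝔤 → Prop} {z : Omega ⊗[𝕜] 𝔤} (hz : z ∈ (tensorLie 𝕜 𝔤 δ).piece p a)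
    (zero : P 0) (tmul : ∀ v ∈ OmegaPiece p a, ∀ x, P (v ⊗ₜ x))
    (add : ∀ y z, P y → P z → P (y + z)) : P z := by
  obtain ⟨y, rfl⟩ := hz
  induction y using TensorProduct.induction_on with
  | zero => rw [map_zero]; exact zero
  | tmul v x => exact tmul v.1 v.2 x
  | add y z hy hz => rw [map_add]; exact add _ _ hy hz

theorem tensorLie_br_tmul (δ : Omega →ₗ[ℂ] Omega) (v w : Omega) (x y : 𝔤) :
    (tensorLie 𝕜 𝔤 δ).br (v ⊗ₜ x) (w ⊗ₜ y) = (v * w) ⊗ₜ ⁅x, y⁆ := rfl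

theorem tensorLie_d_tmul (δ : Omega →ₗ[ℂ] Omega) (v : Omega) (x : 𝔤) :
    (tensorLie 𝕜 𝔤 δ).d (v ⊗ₜ x) = δ v ⊗ₜ x := rfl

theorem iSup_tensorLie_piece (δ : Omega →ₗ[ℂ] Omega) :
    ⨆ k : ℕ × ZMod 2, (tensorLie 𝕜 𝔤 δ).piece k.1 k.2 = ⊤ := by
  rw [eq_top_iff]
  rintro z -
  induction z using TensorProduct.induction_on with
  | zero => exact zero_mem _
  | add y z hy hz => exact add_mem hy hz
  | tmul w x =>
    have hw : w ∈ ⨆ k : ℕ × ZMod 2, OmegaPiece k.1 k.2 := by rw [iSup_omegaPiece]; trivial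
    refine Submodule.iSup_induction (fun k : ℕ × ZMod 2 => OmegaPiece k.1 k.2)
      (motive := fun w => w ⊗ₜ[𝕜] x ∈ ⨆ k : ℕ × ZMod 2, (tensorLie 𝕜 𝔤 δ).piece k.1 k.2) hw ?_ ?_ ?_
    · intro k v hv
      exact Submodule.mem_iSup_of_mem k (tmul_mem_piece δ hv x)
    · rw [TensorProduct.zero_tmul]; exact zero_mem _
    · intro v v' hv hv'; rw [TensorProduct.add_tmul]; exact add_mem hv hv'

/-- The operator that separates the bidegrees of forms acts on the first factor with the same
eigenvalues, now read in the ground field. -/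
theorem iSupIndep_tensorLie_piece (δ : Omega →ₗ[ℂ] Omega) :
    iSupIndep fun k : ℕ × ZMod 2 => (tensorLie 𝕜 𝔤 δ).piece k.1 k.2 := by
  refine ((Module.End.eigenspaces_iSupIndep
    (LinearMap.rTensor 𝔤 (bidegOp.restrictScalars 𝕜))).comp
      (bidegEigenvalue_injective_of_algebra 𝕜)).mono fun k z hz => ?_
  rw [Function.comp_apply, Module.End.mem_eigenspace_iff]
  refine tensorLie_piece_induction hz ?_ (fun v hv x => ?_) fun y z hy hz => ?_
  · rw [map_zero, smul_zero]
  · rw [LinearMap.rTensor_tmul, LinearMap.restrictScalars_apply, bidegOp_apply hv,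
      TensorProduct.smul_tmul', ← algebraMap_smul ℂ (bidegEigenvalue 𝕜 k) v]
    congr 2
    simp [bidegEigenvalue, map_ofNat (algebraMap 𝕜 ℂ) 2]
  · rw [map_add, hy, hz, smul_add]

/-- On pure tensors the graded sign comes from exchanging the forms, while antisymmetry and the
Jacobi identity come from the Lie bracket. The differential does not touch the second factor. -/
theorem isDGLA_tensorLie {δ : Omega →ₗ[ℂ] Omega} (hδ : IsComplex OmegaPiece δ)
    (hmul : ∀ p a, ∀ v ∈ OmegaPiece p a, ∀ w,
      δ (v * w) = δ v * w + (-1 : ℂ) ^ (p + a.val) • (v * δ w)) :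
    (tensorLie 𝕜 𝔤 δ).IsDGLA where
  isComplex :=
    { internal := DirectSum.isInternal_submodule_of_iSupIndep_of_iSup_eq_top
        (iSupIndep_tensorLie_piece δ) (iSup_tensorLie_piece δ)
      d_mem := fun p a z hz => by
        refine tensorLie_piece_induction hz ?_ (fun v hv x => ?_) fun y z hy hz => ?_
        · rw [map_zero]; exact zero_mem _
        · exact tmul_mem_piece δ (hδ.d_mem p a v hv) x
        · rw [map_add]; exact add_mem hy hz
      d_d := fun z => by
        induction z using TensorProduct.induction_on with
        | zero => rw [map_zero, map_zero]
        | tmul v x => rw [tensorLie_d_tmul, tensorLie_d_tmul, hδ.d_d, TensorProduct.zero_tmul]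
        | add y z hy hz => rw [map_add, map_add, hy, hz, add_zero] }
  br_mem p a q b y hy z hz := by
    refine tensorLie_piece_induction hy ?_ (fun v hv x => ?_) fun y y' hy hy' => ?_
    · rw [map_zero, LinearMap.zero_apply]; exact zero_mem _
    · refine tensorLie_piece_induction hz ?_ (fun w hw x' => ?_) fun z z' hz hz' => ?_
      · rw [map_zero]; exact zero_mem _
      · rw [tensorLie_br_tmul]; exact tmul_mem_piece δ (omegaPiece_mul hv hw) _
      · rw [map_add]; exact add_mem hz hz'
    · rw [map_add, LinearMap.add_apply]; exact add_mem hy hy'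
  antisymm p a q b y hy z hz := by
    refine tensorLie_piece_induction hy ?_ (fun v hv x => ?_) fun y y' hy hy' => ?_
    · simp
    · refine tensorLie_piece_induction hz ?_ (fun w hw x' => ?_) fun z z' hz hz' => ?_
      · simp
      · rw [tensorLie_br_tmul, tensorLie_br_tmul, omegaPiece_mul_comm hv hw,
          neg_one_pow_smul_eq (K := ℂ) (K' := 𝕜), ← TensorProduct.smul_tmul', ← smul_neg,
          ← TensorProduct.tmul_neg, lie_skew]
      · rw [map_add, map_add, hz, hz', LinearMap.add_apply, smul_add, neg_add]
    · rw [map_add, map_add, LinearMap.add_apply, hy, hy', smul_add, neg_add]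
  jacobi p a q b y hy z hz u := by
    refine tensorLie_piece_induction hy ?_ (fun v hv x => ?_) fun y y' hy hy' => ?_
    · simp
    · refine tensorLie_piece_induction hz ?_ (fun w hw x' => ?_) fun z z' hz hz' => ?_
      · simp
      · induction u using TensorProduct.induction_on with
        | zero => simp
        | tmul r x'' =>
          simp only [tensorLie_br_tmul]
          -- The sign turns `w * v` back into `v * w`; all terms then share the form `v * w * r`,
          -- and the Jacobi identity of the Lie algebra remains.
          rw [← mul_assoc w v r, leibniz_lie, TensorProduct.tmul_add, ← mul_assoc,
            TensorProduct.smul_tmul', ← smul_mul_assoc, neg_one_pow_smul_eq (K := 𝕜) (K' := ℂ),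
            ← omegaPiece_mul_comm hv hw]
        | add u u' hu hu' => simp only [map_add, hu, hu', smul_add]; abel
      · simp only [map_add, LinearMap.add_apply, hz, hz', smul_add]; abel
    · simp only [map_add, LinearMap.add_apply, hy, hy', smul_add]; abel
  leibniz p a y hy z := by
    refine tensorLie_piece_induction hy ?_ (fun v hv x => ?_) fun y y' hy hy' => ?_
    · simp
    · induction z using TensorProduct.induction_on with
      | zero => simp
      | tmul w x' =>
        simp only [tensorLie_br_tmul, tensorLie_d_tmul]
        rw [hmul p a v hv, TensorProduct.add_tmul, TensorProduct.smul_tmul',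
          neg_one_pow_smul_eq (K := 𝕜) (K' := ℂ)]
      | add z z' hz hz' => simp only [map_add, hz, hz', smul_add]; abel
    · simp only [map_add, LinearMap.add_apply, hy, hy', smul_add]; abel

variable (𝕜 𝔤)

/-- `φ ⊗ id`. -/
def untwistTensor : Omega ⊗[𝕜] 𝔤 ≃ₗ[𝕜] Omega ⊗[𝕜] 𝔤 :=
  TensorProduct.congr (untwistOmega.toLinearEquiv.restrictScalars 𝕜) (LinearEquiv.refl 𝕜 𝔤)

variable {𝕜 𝔤}

theorem untwistTensor_tmul (w : Omega) (x : 𝔤) :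
    untwistTensor 𝕜 𝔤 (w ⊗ₜ x) = untwistOmega w ⊗ₜ x := rfl

theorem map_untwistTensor_piece (p : ℕ) (a : ZMod 2) :
    ((tensorLie 𝕜 𝔤 dbarTw).piece p a).map (untwistTensor 𝕜 𝔤).toLinearMap =
      (tensorLie 𝕜 𝔤 dbar).piece p a := by
  apply le_antisymm
  · rw [Submodule.map_le_iff_le_comap]
    intro z hz
    rw [Submodule.mem_comap, LinearEquiv.coe_coe]
    refine tensorLie_piece_induction hz ?_ (fun v hv x => ?_) fun y z hy hz => ?_
    · rw [map_zero]; exact zero_mem _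
    · exact tmul_mem_piece dbar (untwistOmega_mem hv) x
    · rw [map_add]; exact add_mem hy hz
  · intro z hz
    refine tensorLie_piece_induction hz (zero_mem _) (fun v hv x => ?_) fun y z hy hz =>
      add_mem hy hz
    refine ⟨untwistOmega.symm v ⊗ₜ x, tmul_mem_piece dbarTw (untwistOmega_symm_mem hv) x, ?_⟩
    rw [LinearEquiv.coe_coe, untwistTensor_tmul, AlgEquiv.apply_symm_apply]

theorem untwistTensor_d (z : Omega ⊗[𝕜] 𝔤) :
    untwistTensor 𝕜 𝔤 ((tensorLie 𝕜 𝔤 dbarTw).d z) =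
      (tensorLie 𝕜 𝔤 dbar).d (untwistTensor 𝕜 𝔤 z) := by
  induction z using TensorProduct.induction_on with
  | zero => rw [map_zero, map_zero, map_zero]
  | tmul v x =>
    rw [tensorLie_d_tmul, untwistTensor_tmul, untwistTensor_tmul, tensorLie_d_tmul,
      untwistOmega_dbarTw]
  | add y z hy hz => rw [map_add, map_add, map_add, map_add, hy, hz]

theorem untwistTensor_br (y z : Omega ⊗[𝕜] 𝔤) :
    untwistTensor 𝕜 𝔤 ((tensorLie 𝕜 𝔤 dbarTw).br y z) =
      (tensorLie 𝕜 𝔤 dbar).br (untwistTensor 𝕜 𝔤 y) (untwistTensor 𝕜 𝔤 z) := by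
  induction y using TensorProduct.induction_on with
  | zero => simp only [map_zero, LinearMap.zero_apply]
  | add y y' hy hy' => simp only [map_add, LinearMap.add_apply, hy, hy']
  | tmul v x =>
    induction z using TensorProduct.induction_on with
    | zero => simp only [map_zero]
    | add z z' hz hz' => simp only [map_add, hz, hz']
    | tmul w x' =>
      rw [tensorLie_br_tmul, untwistTensor_tmul, untwistTensor_tmul, untwistTensor_tmul,
        tensorLie_br_tmul, map_mul]

variable (𝕜 𝔤)

/-- `φ ⊗ id` as an isomorphism of differential graded Lie algebras. -/
def untwistLie : (LTw 𝕜 𝔤).Iso (LCR 𝕜 𝔤) where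
  toEquiv := untwistTensor 𝕜 𝔤
  map_piece := map_untwistTensor_piece
  map_d := untwistTensor_d
  map_br := untwistTensor_br

end Tensor

end

end CRAmbitwistor

theorem mainTheorem5 (𝕜 𝔤 : Type*) [Field 𝕜] [Algebra 𝕜 ℂ] [LieRing 𝔤] [LieAlgebra 𝕜 𝔤] :
    -- the twist `g` is well defined and conjugates the changed CR frame into the twisted frame
    IsNilpotent twistField ∧ twist * twistInv = 1 ∧ twistInv * twist = 1 ∧
    (∀ A, frameTw A = twist * framePrime A * twistInv) ∧
    -- the frames close, and `g` intertwines the structure functions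
    (∀ A B, superComm frameCR A B = ∑ D, mulBy (structCR A B D) * frameCR D) ∧
    (∀ A B, superComm framePrime A B = ∑ D, mulBy (structTw A B D) * framePrime D) ∧
    (∀ A B, superComm frameTw A B = ∑ D, mulBy (structTw A B D) * frameTw D) ∧
    (∀ A B D, twist * mulBy (structTw A B D) = mulBy (structTw A B D) * twist) ∧
    (∑ A, mulBy (coframePrime A) * framePrime A = ∑ A, mulBy (coframe A) * frameCR A) ∧
    -- the two cochain complexes and the two differential graded Lie algebras
    IsComplex OmegaPiece dbar ∧ IsComplex OmegaPiece dbarTw ∧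
    (LCR 𝕜 𝔤).IsDGLA ∧ (LTw 𝕜 𝔤).IsDGLA ∧
    -- the isomorphism `v̂^A f_A ↦ ê'^A g⁻¹ f_A`
    ∃ Φ : FormAlg ≃ₐ[ℂ] FormAlg,
      (∀ f, IsSuperFn f → Φ f = twistInv f) ∧ (∀ A, Φ (coframe A) = coframePrime A) ∧
      ∃ φ : Omega ≃ₐ[ℂ] Omega,
        (∀ w, (φ w : FormAlg) = Φ w) ∧
        (∀ p a, (OmegaPiece p a).map φ.toLinearMap = OmegaPiece p a) ∧
        (∀ w, φ (dbarTw w) = dbar (φ w)) ∧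
        ∃ Ψ : (LTw 𝕜 𝔤).Iso (LCR 𝕜 𝔤), ∀ w x, Ψ.toEquiv (w ⊗ₜ x) = φ w ⊗ₜ x :=
  ⟨isNilpotent_twistField, twist_mul_twistInv, twistInv_mul_twist, frameTw_eq_conj,
    superComm_frameCR, superComm_framePrime, superComm_frameTw, twist_mul_mulBy_structTw,
    sum_coframePrime_mul_framePrime, isComplex_dbar, isComplex_dbarTw,
    isDGLA_tensorLie isComplex_dbar fun _ _ _ hv w => dbar_mul hv w,
    isDGLA_tensorLie isComplex_dbarTw fun _ _ _ hv w => dbarTw_mul hv w,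
    untwist, fun _ hf => untwist_of_oddDer_eq_zero hf.oddDer_formF, untwist_coframe,
    untwistOmega, coe_untwistOmega, map_untwistOmega_omegaPiece, untwistOmega_dbarTw,
    untwistLie 𝕜 𝔤, fun _ _ => rfl⟩
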